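/- Let $\mathbb N=\{1,2,3,\dots\}$, $\rho=(1+\sqrt{-3})/2$, and let $\mathbb H$ be the upper half-plane. Let $m\ge 0$, and let $\kappa_\rho,\kappa_i,\kappa_1,\dots,\kappa_m\in\frac12\mathbb N$ be positive half-integers with $2\kappa_\rho/3\notin\mathbb N$ and $\kappa_i\notin\mathbb N$. Let $p_1,\dots,p_m\in\mathbb H$ be points that are pairwise inequivalent under $\mathrm{SL}(2,\mathbb Z)$ and equivalent neither to $\rho$ nor to $i$, and let $\kappa_\infty>0$ be a real number. For a meromorphic modular form $Q$ of weight $4$ on $\mathrm{SL}(2,\mathbb Z)$ (meromorphic on $\mathbb H$ and at the cusp $\infty$) consider the differential equation $y''=Q(z)y$ on $\mathbb H$. It is Fuchsian at $z_0\in\mathbb H$ if $c=\lim_{z\to z_0}(z-z_0)^2Q(z)$ exists; its local exponents at $z_0$ are then the roots of $x(x-1)=c$. It is Fuchsian at $\infty$ if $Q$ is holomorphic at $\infty$; its local exponents there (in the variable $q=e^{2\pi i z}$) are then the roots of $x^2=-Q(\infty)/(4\pi^2)$. A pole $z_0\in\mathbb H$ of $Q$ is apparent if the local exponents at $z_0$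 are $1/2\pm\kappa$ with $\kappa\in\frac12\mathbb Z_{\ge0}$ and no solution near $z_0$ has a logarithmic singularity, that is, every solution near $z_0$ is $(z-z_0)^{1/2-\kappa}$ times a function holomorphic at $z_0$. Say that $Q$ is equipped with the data $(\kappa_\rho,\kappa_i,\kappa_j,p_j,\kappa_\infty)$ if (i) the poles of $Q$ on $\mathbb H$ are, up to $\mathrm{SL}(2,\mathbb Z)$-equivalence, exactly the points among $\rho,i,p_1,\dots,p_m$ whose parameter $\kappa_\rho,\kappa_i,\kappa_1,\dots,\kappa_m$ is different from $1/2$ (a point with parameter $1/2$ is a regular point); (ii) the local exponents at $\rho$, $i$, $p_j$ are $1/2\pm\kappa_\rho$, $1/2\pm\kappa_i$, $1/2\pm\kappa_j$ ($1\le j\le m$), respectively; (iii) every pole of $Q$ on $\mathbb H$ is apparent; (iv) the local exponents at $\infty$ are $\pm\kappa_\infty$. **Theorem.** There is at least one meromorphic modular form $Q$ of weight $4$ on $\mathrm{SL}(2,\mathbb Z)$ equipped with these data. Moreover, there are only finitely many such $Q$, and their number is at most $\prod_{j=1}^m(2\kappa_j)$. -/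

import Mathlib

open Filter Topology UpperHalfPlane MatrixGroups

noncomputable section

namespace ModularODE

/-- The elliptic point `ρ = (1 + √3 i) / 2` of the upper half-plane. -/
def rho : ℍ := ⟨⟨1 / 2, Real.sqrt 3 / 2⟩, by positivity⟩

/-- `SL(2, ℤ)`-equivalence of points of the upper half-plane. -/
def Equivalent (z w : ℍ) : Prop := ∃ γ : SL(2, ℤ), γ • z = w

/-- A meromorphic function on the upper half-plane, extended to a function on `ℂ` by an irrelevant
value off the upper half-plane. -/
abbrev ext (Q : ℍ → ℂ) : ℂ → ℂ := Q ∘ ofComplex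

/-- `Q` is a meromorphic modular form of weight `k` on `SL(2, ℤ)`. Meromorphic functions on `ℍ` are
represented by functions in normal form (the value is `0` at a pole and is the limit elsewhere),
so that two meromorphic functions are the same if and only if they are equal as functions.
Meromorphy at the cusp is meromorphy at `q = 0` in the variable `q = exp (2 π i z)`. -/
structure IsMeromorphicModularForm (k : ℤ) (Q : ℍ → ℂ) : Prop where
  meromorphic : MeromorphicNFOn (ext Q) {z : ℂ | 0 < z.im}
  transform : ∀ (γ : SL(2, ℤ)) (z : ℍ),
    Q (γ • z) = (((γ 1 0 : ℤ) : ℂ) * (z : ℂ) + ((γ 1 1 : ℤ) : ℂ)) ^ k * Q z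
  meromorphic_cusp : ∃ F : ℂ → ℂ, MeromorphicAt F 0 ∧
    ∀ᶠ z : ℍ in atImInfty, Q z = F (Complex.exp (2 * Real.pi * Complex.I * (z : ℂ)))

/-- `p` is a pole of the meromorphic function `Q` on the upper half-plane. -/
def IsPole (Q : ℍ → ℂ) (p : ℍ) : Prop := meromorphicOrderAt (ext Q) (p : ℂ) < 0

/-- The equation `y'' = f y` is Fuchsian at `p` (so that `(z - p) ^ 2 f(z)` has a limit `c` at `p`)
and `a`, `b` are its local exponents at `p`, i.e. the two roots, with multiplicity, of the indicial
polynomial `x (x - 1) - c`. -/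
def HasLocalExponents (f : ℂ → ℂ) (p a b : ℂ) : Prop :=
  ∃ c : ℂ, Tendsto (fun z => (z - p) ^ 2 * f z) (𝓝[≠] p) (𝓝 c) ∧
    ∀ x : ℂ, x * (x - 1) - c = (x - a) * (x - b)

/-- The equation `y'' = Q y` is Fuchsian at the cusp `∞` (so that `Q` has a finite value `c` there)
and `a`, `b` are its local exponents at `∞`. In the variable `q = exp (2 π i z)` the equation is
`(q d/dq) ^ 2 y = - Q / (4 π ^ 2) y`, whose indicial polynomial is `x ^ 2 + c / (4 π ^ 2)`. -/
def HasLocalExponentsAtInfty (Q : ℍ → ℂ) (a b : ℂ) : Prop :=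
  ∃ c : ℂ, Tendsto Q atImInfty (𝓝 c) ∧
    ∀ x : ℂ, x ^ 2 + c / (4 * (Real.pi : ℂ) ^ 2) = (x - a) * (x - b)

/-- The filter of slit neighbourhoods of `p`: discs centred at `p` from which the ray issuing
from `p` in the negative real direction is removed. -/
def slitNhds (p : ℂ) : Filter ℂ := 𝓝[{z : ℂ | z - p ∈ Complex.slitPlane}] p

/-- No solution of `y'' = f y` near `p` has a logarithmic singularity at `p`, where the local
exponents are `1/2 ± κ` with `2 κ` a natural number: every solution on a slit neighbourhood of `p`
is `(z - p) ^ (1/2 - κ)` times a function that is holomorphic at `p`. -/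
def NoLogarithm (f : ℂ → ℂ) (p : ℂ) (κ : ℝ) : Prop :=
  ∀ y : ℂ → ℂ,
    (∀ᶠ z in slitNhds p, AnalyticAt ℂ y z ∧ iteratedDeriv 2 y z = f z * y z) →
    ∃ h : ℂ → ℂ, AnalyticAt ℂ h p ∧
      ∀ᶠ z in slitNhds p, y z = (z - p) ^ ((1 / 2 - κ : ℝ) : ℂ) * h z

/-- The equation `y'' = f y` is apparent at its singular point `p`. -/
def IsApparentAt (f : ℂ → ℂ) (p : ℂ) : Prop :=
  ∃ κ : ℝ, (∃ n : ℕ, κ = n / 2) ∧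
    HasLocalExponents f p ((1 / 2 + κ : ℝ) : ℂ) ((1 / 2 - κ : ℝ) : ℂ) ∧ NoLogarithm f p κ

/-- `Q` is apparent on `ℍ`: the equation `y'' = Q y` is apparent at every pole of `Q`. -/
def IsApparent (Q : ℍ → ℂ) : Prop := ∀ p : ℍ, IsPole Q p → IsApparentAt (ext Q) (p : ℂ)

/-- `Q` is a meromorphic modular form of weight `4` on `SL(2, ℤ)` equipped with the exponents
`κρ`, `κi`, `κ j` at `ρ`, `i`, `p j` and with the exponents `± κ∞` at `∞`. A marked point whose
exponent parameter is `1/2` is a regular point of the equation; the other marked points are, up to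
equivalence, the poles. -/
structure IsEquipped {m : ℕ} (κρ κi : ℝ) (κ : Fin m → ℝ) (p : Fin m → ℍ) (κinf : ℝ)
    (Q : ℍ → ℂ) : Prop where
  modular : IsMeromorphicModularForm 4 Q
  poles : ∀ z : ℍ, IsPole Q z ↔
    (Equivalent rho z ∧ κρ ≠ 1 / 2) ∨ (Equivalent UpperHalfPlane.I z ∧ κi ≠ 1 / 2) ∨
      ∃ j, Equivalent (p j) z ∧ κ j ≠ 1 / 2
  exponents_rho : HasLocalExponents (ext Q) (rho : ℂ)
    ((1 / 2 + κρ : ℝ) : ℂ) ((1 / 2 - κρ : ℝ) : ℂ)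
  exponents_I : HasLocalExponents (ext Q) (UpperHalfPlane.I : ℂ)
    ((1 / 2 + κi : ℝ) : ℂ) ((1 / 2 - κi : ℝ) : ℂ)
  exponents : ∀ j, HasLocalExponents (ext Q) (p j : ℂ)
    ((1 / 2 + κ j : ℝ) : ℂ) ((1 / 2 - κ j : ℝ) : ℂ)
  apparent : IsApparent Q
  exponents_infty : HasLocalExponentsAtInfty Q (κinf : ℂ) (-κinf : ℂ)

/-- `x` is a positive half-integer, an element of `ℕ / 2` with `ℕ` the positive integers. -/
def IsPosHalfInt (x : ℝ) : Prop := ∃ n : ℕ, 0 < n ∧ x = n / 2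

end ModularODE

end

/-!
The conditions on `Q` at a marked point with parameter `κ = n / 2` are first put into one condition:
the equation `y'' = Q y` has a solution `(z - p) ^ (1/2 - n/2) h` with `h` holomorphic and `h p = 1`
(`HasSmallSolution`). Such a solution determines the exponents, makes `p` a pole exactly for `n ≠ 1`,
and spans the solutions together with the solution of exponent `1/2 + n/2`, so that there are no
logarithms; conversely, if no solution has a logarithm, the second solution obtained from the
Wronskian is of this shape (`hasSmallSolution_iff`). The method of Frobenius then expresses the
condition by one equation: the coefficients of `h` are given by a recursion which degenerates only at
the index `n`, and `h` exists if and only if the right-hand side of the recursion vanishes there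
(`obstruction`, `exists_frobEq_neg_iff`).

The forms of weight `4` with the right exponents, at most double poles at the marked points and the
right value at the cusp are `R₀ + ∑ b_j T_j`, where `R₀` has the prescribed leading coefficients and
`T_j` has a simple pole on the orbit of `p_j` (`IsFamily`). Nothing else is possible: a difference of
two such forms with equal residues at the `p_j` has at most simple poles at `ρ` and `i`, so that its
product with `E₄ E₆` is a cusp form of weight `14`, and there is none but zero (`eventuallyEq_zero`).

At `ρ` and `i` the obstruction vanishes for every `b`. In a coordinate in which the stabiliser acts
by rotations, the equation is invariant under a rotation `ζ` of order `3` or `2`, the obstruction is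
multiplied by `ζ ^ n`, and `ζ ^ n ≠ 1` because `3 ∤ 2 κ_ρ` and `2 ∤ 2 κ_i`
(`IsPotential.hasSmallSolution_of_fixedPoint`). At `p_j`, with `n_j = 2 κ_j`, the obstruction is a
polynomial in `b` whose part of degree `n_j` is a nonzero multiple of `b_j ^ n_j`, all other terms
being of lower degree (`IsFamily.exists_polynomial`). The equipped forms therefore correspond to the
zeros of `m` polynomials in `m` variables with leading forms `α_j X_j ^ n_j`. Modulo such a system
the polynomial ring is spanned by the `∏ n_j` monomials with exponents below the `n_j`, which bounds
the number of zeros; and it is finite over the subring generated by the system, which is thus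
algebraically independent and has a common zero (`zeros_nonempty_finite_ncard_le`).

Two facts on modular forms enter the construction of `R₀` and `T_j`. The bracket
`2 E₄ E₆' - 3 E₆ E₄'` is a cusp form of weight `12`, hence a nonzero multiple of `Δ`, so that the
zeros of `E₄` and `E₆` are simple and `J = E₄³ / Δ` has nonzero derivative elsewhere. And `J`
separates orbits (`equivalent_of_jFun_eq`): the values taken on two different orbits form an open
bounded set which is closed in the complement of `{0, 1728}`, so there are none.
-/

noncomputable section

namespace ModularODE

/-! ### Systems of polynomials with prescribed leading forms -/

section Algebra

open MvPolynomial

variable {m : ℕ} {n : Fin m → ℕ} {α : Fin m → ℂ} {P : Fin m → MvPolynomial (Fin m) ℂ}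

/-- The exponents of the monomials `∏ X_j ^ s_j` with `s_j < n_j`. -/
def boxExponents (n : Fin m → ℕ) : Set (Fin m →₀ ℕ) := {s | ∀ j, s j < n j}

lemma boxExponents_finite_ncard (n : Fin m → ℕ) :
    (boxExponents n).Finite ∧ (boxExponents n).ncard ≤ ∏ j, n j := by
  have key : boxExponents n = (Finsupp.equivFunOnFinite : (Fin m →₀ ℕ) ≃ (Fin m → ℕ)).symm ''
      (Fintype.piFinset fun j => Finset.range (n j) : Finset (Fin m → ℕ)) := by
    ext s
    simp only [boxExponents, Set.mem_ofPred_eq, Set.mem_image, Finset.mem_coe,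
      Fintype.mem_piFinset, Finset.mem_range]
    constructor
    · intro h
      exact ⟨s, h, by ext; simp⟩
    · rintro ⟨t, ht, rfl⟩
      simpa using ht
  rw [key]
  refine ⟨(Finset.finite_toSet _).image _, (Set.ncard_image_le (Finset.finite_toSet _)).trans ?_⟩
  rw [Set.ncard_coe_finset, Fintype.card_piFinset]
  simp

/-- If `P_j` has leading form `α_j X_j ^ n_j`, every subspace of the polynomial ring that contains
the monomials with exponents in the box `s_j < n_j` and is stable under multiplication by each
`P_j` is everything: a monomial outside the box is divisible by some `X_j ^ n_j`, which may be
replaced by `P_j` at the cost of terms of lower degree. -/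
lemma submodule_eq_top_of_box (hα : ∀ j, α j ≠ 0)
    (hP : ∀ j, (P j - C (α j) * X j ^ n j).totalDegree < n j)
    (N : Submodule ℂ (MvPolynomial (Fin m) ℂ))
    (hbox : ∀ s ∈ boxExponents n, monomial s 1 ∈ N)
    (hmul : ∀ j, ∀ x ∈ N, P j * x ∈ N) : N = ⊤ := by
  have key : ∀ d : ℕ, ∀ q : MvPolynomial (Fin m) ℂ, q.totalDegree ≤ d → q ∈ N := by
    intro d
    induction d using Nat.strong_induction_on with
    | _ d ih =>
    intro q hq
    rw [q.as_sum]
    refine Submodule.sum_mem _ fun s hs => ?_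
    have hsd : (s.sum fun _ e => e) ≤ d := (le_totalDegree hs).trans hq
    have : monomial s (coeff s q) = coeff s q • monomial s (1 : ℂ) := by
      simp [smul_monomial]
    rw [this]
    refine N.smul_mem _ ?_
    by_cases hsb : s ∈ boxExponents n
    · exact hbox s hsb
    · obtain ⟨j, hj⟩ : ∃ j, n j ≤ s j := by
        simpa [boxExponents] using hsb
      obtain ⟨t, rfl⟩ : ∃ t, s = t + Finsupp.single j (n j) := by
        refine ⟨s - Finsupp.single j (n j), ?_⟩
        rw [tsub_add_cancel_of_le]
        simpa using hj
      have hn : 0 < n j := lt_of_le_of_lt (Nat.zero_le _) (hP j)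
      have hdeg : (t.sum fun _ e => e) + n j ≤ d := by
        rw [Finsupp.sum_add_index' (by simp) (by simp)] at hsd
        simpa using hsd
      have e1 : monomial (t + Finsupp.single j (n j)) (1 : ℂ) =
          (α j)⁻¹ • (P j * monomial t 1 - (P j - C (α j) * X j ^ n j) * monomial t 1) := by
        have : monomial (t + Finsupp.single j (n j)) (1 : ℂ) = X j ^ n j * monomial t 1 := by
          rw [X_pow_eq_monomial, monomial_mul, add_comm]; simp
        rw [this, ← sub_mul, sub_sub_cancel, smul_eq_C_mul, ← mul_assoc, ← mul_assoc, ← C_mul,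
          inv_mul_cancel₀ (hα j), C_1, one_mul]
      have ht : (monomial t (1 : ℂ)).totalDegree ≤ t.sum fun _ e => e := totalDegree_monomial_le _ _
      rw [e1]
      refine N.smul_mem _ (N.sub_mem (hmul j _ (ih (d - n j) (by omega) _ (by omega))) ?_)
      exact ih (d - 1) (by omega) _ ((totalDegree_mul _ _).trans (by have := hP j; omega))
  exact eq_top_iff.2 fun q _ => key _ q le_rfl

/-- Zeros of the system are bounded in number by the dimension of the quotient by the `P_j`, which
is spanned by the box monomials. -/
lemma card_zeros_le (hα : ∀ j, α j ≠ 0)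
    (hP : ∀ j, (P j - C (α j) * X j ^ n j).totalDegree < n j)
    (S : Finset (Fin m → ℂ)) (hS : ∀ b ∈ S, ∀ j, eval b (P j) = 0) :
    S.card ≤ ∏ j, n j := by
  classical
  let ev : MvPolynomial (Fin m) ℂ →ₐ[ℂ] (S → ℂ) :=
    { toFun := fun q b => eval b.1 q
      map_one' := by ext; simp
      map_mul' := by intros; ext; simp
      map_zero' := by ext; simp
      map_add' := by intros; ext; simp
      commutes' := by intro r; ext; simp [algebraMap_eq] }
  have hev : ∀ q b, ev q b = eval b.1 q := fun _ _ => rfl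
  let N : Submodule ℂ (MvPolynomial (Fin m) ℂ) :=
    (Submodule.span ℂ ((fun s => ev (monomial s 1)) '' boxExponents n)).comap ev.toLinearMap
  have hN : N = ⊤ := by
    refine submodule_eq_top_of_box hα hP N (fun s hs => Submodule.subset_span ⟨s, hs, rfl⟩) ?_
    intro j x _
    have : ev (P j * x) = 0 := by
      ext b
      simp [hev, hS b.1 b.2 j]
    rw [Submodule.mem_comap]
    change ev (P j * x) ∈ (_ : Submodule ℂ (S → ℂ))
    rw [this]
    exact Submodule.zero_mem _
  -- Interpolation: the evaluations at distinct points are independent.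
  have hsurj : Function.Surjective ev := by
    have hsep : ∀ b c : S, b ≠ c → ∃ q, ev q b = 1 ∧ ev q c = 0 := by
      intro b c hbc
      have : b.1 ≠ c.1 := fun h => hbc (Subtype.ext h)
      obtain ⟨j, hj⟩ := Function.ne_iff.1 this
      refine ⟨C (b.1 j - c.1 j)⁻¹ * (X j - C (c.1 j)), ?_, ?_⟩
      · simp [hev, inv_mul_cancel₀ (sub_ne_zero.2 hj)]
      · simp [hev]
    choose! q hq1 hq0 using hsep
    have hsingle : ∀ b : S, ev (∏ c ∈ Finset.univ.erase b, q b c) = Pi.single b 1 := by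
      intro b
      ext c
      rw [map_prod, Finset.prod_apply]
      by_cases hcb : c = b
      · subst hcb
        rw [Pi.single_eq_same]
        exact Finset.prod_eq_one fun d hd => hq1 _ _ (Finset.ne_of_mem_erase hd).symm
      · rw [Pi.single_eq_of_ne hcb]
        exact Finset.prod_eq_zero (Finset.mem_erase.2 ⟨hcb, Finset.mem_univ _⟩)
          (hq0 b c (Ne.symm hcb))
    intro v
    refine ⟨∑ b, v b • ∏ c ∈ Finset.univ.erase b, q b c, ?_⟩
    rw [map_sum]
    simp only [map_smul, hsingle]
    ext c
    simp [Finset.sum_apply, Pi.single_apply]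
  have hspan : Submodule.span ℂ ((fun s => ev (monomial s 1)) '' boxExponents n) = ⊤ := by
    rw [eq_top_iff]
    intro v _
    obtain ⟨x, rfl⟩ := hsurj v
    have : x ∈ N := hN ▸ Submodule.mem_top
    exact this
  obtain ⟨hfin, hcard⟩ := boxExponents_finite_ncard n
  have h1 := finrank_span_finset_le_card (R := ℂ)
    (hfin.toFinset.image fun s => ev (monomial s 1))
  rw [Set.finrank, Finset.coe_image, Set.Finite.coe_toFinset, hspan, finrank_top,
    Module.finrank_pi, Fintype.card_coe] at h1
  refine h1.trans (Finset.card_image_le.trans ?_)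
  rwa [← Set.ncard_eq_toFinset_card _ hfin]

/-- A system of `m` polynomials in `m` variables whose leading forms are `α_j X_j ^ n_j` has a
zero: the polynomial ring is finite over the subalgebra generated by the `P_j`, which are therefore
algebraically independent, and a maximal ideal lies over the ideal they generate there. -/
lemma exists_zero (hα : ∀ j, α j ≠ 0)
    (hP : ∀ j, (P j - C (α j) * X j ^ n j).totalDegree < n j) :
    ∃ b : Fin m → ℂ, ∀ j, eval b (P j) = 0 := by
  let A := Algebra.adjoin ℂ (Set.range P)
  obtain ⟨hfin, -⟩ := boxExponents_finite_ncard n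
  have htop : Submodule.span A ((fun s => monomial s (1 : ℂ)) '' boxExponents n) = ⊤ := by
    have := submodule_eq_top_of_box hα hP
      ((Submodule.span A ((fun s => monomial s (1 : ℂ)) '' boxExponents n)).restrictScalars ℂ)
      (fun s hs => Submodule.subset_span ⟨s, hs, rfl⟩)
      (fun j x hx => Submodule.smul_mem _
        (⟨P j, Algebra.subset_adjoin ⟨j, rfl⟩⟩ : A) hx)
    simpa using this
  have hmf : Module.Finite A (MvPolynomial (Fin m) ℂ) :=
    ⟨(Submodule.fg_def).2 ⟨_, hfin.image _, htop⟩⟩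
  have hint : Algebra.IsIntegral A (MvPolynomial (Fin m) ℂ) := inferInstance
  have hindep : AlgebraicIndependent ℂ P := by
    have : Algebra.IsAlgebraic (Algebra.adjoin ℂ (Set.range P)) (MvPolynomial (Fin m) ℂ) :=
      hint.isAlgebraic
    refine (Algebra.IsAlgebraic.isTranscendenceBasis_of_le_trdeg_of_finite ℂ P ?_).1
    rw [MvPolynomial.trdeg_of_isDomain]
    simp
  -- Algebraic independence provides the point of the subalgebra at which every `P_j` vanishes.
  let φ : A →ₐ[ℂ] ℂ := (aeval (fun _ => (0 : ℂ))).comp hindep.aevalEquiv.symm.toAlgHom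
  have hφ : ∀ j, φ ⟨P j, Algebra.subset_adjoin ⟨j, rfl⟩⟩ = 0 := by
    intro j
    have : hindep.aevalEquiv.symm ⟨P j, Algebra.subset_adjoin ⟨j, rfl⟩⟩ = X j := by
      rw [AlgEquiv.symm_apply_eq]
      apply Subtype.ext
      have := hindep.algebraMap_aevalEquiv (X j)
      rw [aeval_X] at this
      exact this.symm
    simp [φ, this]
  have hsurj : Function.Surjective φ := fun c => ⟨algebraMap ℂ A c, by rw [φ.commutes]; rfl⟩
  have : (RingHom.ker φ).IsMaximal := RingHom.ker_isMaximal_of_surjective φ hsurj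
  obtain ⟨M, hM, hMc⟩ := Ideal.exists_ideal_over_maximal_of_isIntegral
    (S := MvPolynomial (Fin m) ℂ) (RingHom.ker φ) (by
      intro x hx
      have : x = 0 := Subtype.ext hx
      rw [this]; exact Ideal.zero_mem _)
  obtain ⟨b, rfl⟩ := MvPolynomial.isMaximal_iff_eq_vanishingIdeal_singleton.1 hM
  refine ⟨b, fun j => ?_⟩
  have h1 : (⟨P j, Algebra.subset_adjoin ⟨j, rfl⟩⟩ : A) ∈ RingHom.ker φ := hφ j
  rw [← hMc, Ideal.mem_comap, MvPolynomial.mem_vanishingIdeal_singleton_iff] at h1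
  simpa [aeval_eq_eval] using h1

/-- A system of `m` polynomials `P_j` in `m` variables with leading forms `α_j X_j ^ n_j` has at
least one and at most `∏ n_j` zeros. -/
lemma zeros_nonempty_finite_ncard_le (hα : ∀ j, α j ≠ 0)
    (hP : ∀ j, (P j - C (α j) * X j ^ n j).totalDegree < n j) :
    {b : Fin m → ℂ | ∀ j, eval b (P j) = 0}.Nonempty ∧
    {b : Fin m → ℂ | ∀ j, eval b (P j) = 0}.Finite ∧
    {b : Fin m → ℂ | ∀ j, eval b (P j) = 0}.ncard ≤ ∏ j, n j := by
  refine ⟨exists_zero hα hP, ?_⟩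
  have hle : ∀ S : Finset (Fin m → ℂ), (S : Set (Fin m → ℂ)) ⊆
      {b | ∀ j, eval b (P j) = 0} → S.card ≤ ∏ j, n j :=
    fun S hS => card_zeros_le hα hP S fun b hb => hS hb
  have hfin : {b : Fin m → ℂ | ∀ j, eval b (P j) = 0}.Finite := by
    by_contra hinf
    obtain ⟨S, hS, hc⟩ := Set.Infinite.exists_subset_card_eq hinf (∏ j, n j + 1)
    have := hle S hS
    omega
  refine ⟨hfin, ?_⟩
  rw [Set.ncard_eq_toFinset_card _ hfin]
  exact hle _ (by simp)

end Algebra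

/-! ### Taylor series -/

section Taylor

open PowerSeries

/-- The Taylor series of `f` at `p` as a formal power series. -/
def taylor (f : ℂ → ℂ) (p : ℂ) : PowerSeries ℂ :=
  PowerSeries.mk fun l => iteratedDeriv l f p / l.factorial

variable {f g : ℂ → ℂ} {p : ℂ}

lemma coeff_taylor (f : ℂ → ℂ) (p : ℂ) (l : ℕ) :
    coeff l (taylor f p) = iteratedDeriv l f p / l.factorial := by
  simp [taylor]

lemma coeff_zero_taylor (f : ℂ → ℂ) (p : ℂ) : coeff 0 (taylor f p) = f p := by
  simp [coeff_taylor]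

lemma taylor_congr (h : f =ᶠ[𝓝 p] g) : taylor f p = taylor g p := by
  ext l
  rw [coeff_taylor, coeff_taylor, h.iteratedDeriv_eq]

lemma taylor_mul (hf : AnalyticAt ℂ f p) (hg : AnalyticAt ℂ g p) :
    taylor (f * g) p = taylor f p * taylor g p := by
  ext l
  simp only [coeff_taylor, iteratedDeriv_mul hf.contDiffAt hg.contDiffAt, PowerSeries.coeff_mul,
    Finset.Nat.sum_antidiagonal_eq_sum_range_succ_mk, Nat.succ_eq_add_one, Finset.sum_div]
  refine Finset.sum_congr rfl fun i hi => ?_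
  rw [Nat.cast_choose _ (by grind)]
  field_simp [Nat.factorial_ne_zero]

lemma taylor_add (hf : AnalyticAt ℂ f p) (hg : AnalyticAt ℂ g p) :
    taylor (f + g) p = taylor f p + taylor g p := by
  ext l
  simp [coeff_taylor, iteratedDeriv_add hf.contDiffAt hg.contDiffAt, add_div]

lemma taylor_const (c p : ℂ) : taylor (fun _ => c) p = C c := by
  ext l
  simp only [coeff_taylor, iteratedDeriv_const, coeff_C]
  split_ifs with h
  · simp [h]
  · simp

lemma taylor_const_mul (hf : AnalyticAt ℂ f p) (c : ℂ) :
    taylor (fun z => c * f z) p = C c * taylor f p := by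
  rw [← taylor_const c p, ← taylor_mul analyticAt_const hf]
  rfl

lemma taylor_sum {ι : Type*} (s : Finset ι) (F : ι → ℂ → ℂ) (hF : ∀ i ∈ s, AnalyticAt ℂ (F i) p) :
    taylor (fun z => ∑ i ∈ s, F i z) p = ∑ i ∈ s, taylor (F i) p := by
  classical
  induction s using Finset.induction_on with
  | empty => simpa using taylor_const 0 p
  | insert a s ha ih =>
    rw [Finset.sum_insert ha, ← ih fun i hi => hF i (Finset.mem_insert_of_mem hi),
      ← taylor_add (hF a (Finset.mem_insert_self _ _))
        (Finset.analyticAt_fun_sum _ fun i hi => hF i (Finset.mem_insert_of_mem hi))]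
    refine congrArg (taylor · p) ?_
    ext z
    simp [Finset.sum_insert ha]

lemma taylor_deriv (f : ℂ → ℂ) (p : ℂ) : taylor (deriv f) p = derivative ℂ (taylor f p) := by
  ext l
  rw [coeff_derivative, coeff_taylor, coeff_taylor, ← iteratedDeriv_succ', Nat.factorial_succ]
  have : (l.factorial : ℂ) ≠ 0 := by exact_mod_cast l.factorial_ne_zero
  have : (l + 1 : ℂ) ≠ 0 := by exact_mod_cast l.succ_ne_zero
  push_cast
  field_simp

lemma taylor_sub_self (p : ℂ) : taylor (fun z => z - p) p = PowerSeries.X := by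
  ext l
  rw [coeff_X]
  rcases l with _ | _ | l
  · simp [coeff_zero_taylor]
  · simp [coeff_taylor]
  · have : deriv (fun z : ℂ => z - p) = fun _ => 1 := by ext; simp
    rw [coeff_taylor, iteratedDeriv_succ', this, iteratedDeriv_const]
    simp

lemma hasFPowerSeriesAt_taylor (hf : AnalyticAt ℂ f p) :
    HasFPowerSeriesAt f (FormalMultilinearSeries.ofScalars ℂ fun l => coeff l (taylor f p)) p := by
  simpa only [coeff_taylor] using hf.hasFPowerSeriesAt

lemma eventuallyEq_of_taylor_eq (hf : AnalyticAt ℂ f p) (hg : AnalyticAt ℂ g p)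
    (h : taylor f p = taylor g p) : f =ᶠ[𝓝 p] g := by
  have h1 := hasFPowerSeriesAt_taylor hf
  rw [h] at h1
  obtain ⟨r, hr⟩ := h1
  obtain ⟨r', hr'⟩ := hasFPowerSeriesAt_taylor hg
  have hr0 := lt_min hr.r_pos hr'.r_pos
  filter_upwards [Metric.eball_mem_nhds p hr0] with z hz
  exact (hr.mono hr0 (min_le_left _ _)).unique (hr'.mono hr0 (min_le_right _ _)) hz

lemma exists_coeff_taylor_le (hf : AnalyticAt ℂ f p) :
    ∃ M R : ℝ, 0 < M ∧ 0 < R ∧ ∀ l, ‖coeff l (taylor f p)‖ ≤ M * R ^ l := by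
  obtain ⟨M, R, hM, hR, h⟩ :=
    FormalMultilinearSeries.le_mul_pow_of_radius_pos _ (hasFPowerSeriesAt_taylor hf).radius_pos
  refine ⟨M, R, hM, hR, fun l => ?_⟩
  simpa using h l

/-- A power series with geometrically bounded coefficients is the Taylor series of a holomorphic
function. -/
lemma exists_taylor_eq (c : PowerSeries ℂ) (p : ℂ) {M S : ℝ} (hS : 0 < S)
    (hc : ∀ l, ‖coeff l c‖ ≤ M * S ^ l) : ∃ f, AnalyticAt ℂ f p ∧ taylor f p = c := by
  let P := FormalMultilinearSeries.ofScalars ℂ fun l => coeff l c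
  have hrad : 0 < P.radius := by
    refine lt_of_lt_of_le ?_ (P.le_radius_of_bound M (r := (S⁻¹).toNNReal) fun l => ?_)
    · simpa using hS
    · rw [FormalMultilinearSeries.ofScalars_norm, Real.coe_toNNReal _ (inv_pos.2 hS).le, inv_pow,
        ← div_eq_mul_inv]
      exact div_le_of_le_mul₀ (by positivity)
          ((norm_nonneg _).trans (by simpa using hc 0)) (hc l)
  have h0 : HasFPowerSeriesAt (fun z => P.sum (z - p)) P p := by
    simpa using ((P.hasFPowerSeriesOnBall hrad).comp_sub p).hasFPowerSeriesAt
  refine ⟨_, h0.analyticAt, ?_⟩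
  have h1 := (hasFPowerSeriesAt_taylor h0.analyticAt).eq_formalMultilinearSeries h0
  ext l
  have h2 := congrArg (fun Q => FormalMultilinearSeries.coeff Q l) h1
  simpa [P, FormalMultilinearSeries.coeff_ofScalars] using h2

end Taylor

/-! ### Formal and convergent Frobenius solutions -/

section Frobenius

open PowerSeries

/-- The coefficients `c_l` of the normalised formal solution `∑ c_l t ^ l` of
`t² h'' + (1 + ν) t h' = (∑ g_i t ^ i) h`, where `g_0 = 0`. At the resonance `l + ν = 0` the value
of `c_l` is free and division by zero makes it `0`. -/
def frobCoeff (g : ℕ → ℂ) (ν : ℤ) : ℕ → ℂ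
  | 0 => 1
  | l + 1 => (∑ i : Fin (l + 1), g (l + 1 - i) * frobCoeff g ν i) / ((l + 1) * (l + 1 + ν))

/-- The right-hand side of the recursion at the resonance of the exponent difference `n`; it has
to vanish for the formal solution with the smaller exponent to exist. -/
def obstruction (g : ℕ → ℂ) (n : ℕ) : ℂ :=
  ∑ i ∈ Finset.range n, g (n - i) * frobCoeff g (-n) i

lemma frobCoeff_succ (g : ℕ → ℂ) (ν : ℤ) (l : ℕ) :
    frobCoeff g ν (l + 1) =
      (∑ i ∈ Finset.range (l + 1), g (l + 1 - i) * frobCoeff g ν i) / ((l + 1) * (l + 1 + ν)) := by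
  rw [frobCoeff, Finset.sum_range]

/-- The coefficients of the formal solution grow at most geometrically, so that it converges. -/
lemma norm_frobCoeff_le {g : ℕ → ℂ} (ν : ℤ) {M R : ℝ} (hM : 0 < M) (hR : 0 < R)
    (hg : ∀ l, ‖g l‖ ≤ M * R ^ l) (l : ℕ) : ‖frobCoeff g ν l‖ ≤ (R * (1 + M)) ^ l := by
  induction l using Nat.strong_induction_on with
  | _ l ih =>
  rcases l with _ | l
  · simp [frobCoeff]
  rw [frobCoeff_succ, norm_div]
  have hnum : ‖∑ i ∈ Finset.range (l + 1), g (l + 1 - i) * frobCoeff g ν i‖ ≤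
      (R * (1 + M)) ^ (l + 1) := by
    calc _ ≤ ∑ i ∈ Finset.range (l + 1), R ^ (l + 1) * (M * (1 + M) ^ i) := by
          refine norm_sum_le_of_le _ fun i hi => ?_
          have hi' : i < l + 1 := Finset.mem_range.1 hi
          rw [norm_mul]
          calc _ ≤ M * R ^ (l + 1 - i) * (R * (1 + M)) ^ i :=
                mul_le_mul (hg _) (ih i hi') (norm_nonneg _) (by positivity)
            _ = R ^ (l + 1) * (M * (1 + M) ^ i) := by
                rw [mul_pow, ← pow_sub_mul_pow R hi'.le]; ring
      _ = R ^ (l + 1) * ((1 + M) ^ (l + 1) - 1) := by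
          rw [← Finset.mul_sum, ← Finset.mul_sum]
          have := mul_geom_sum (1 + M) (l + 1)
          rw [add_sub_cancel_left] at this
          rw [this]
      _ ≤ _ := by
          rw [mul_pow]
          have : 0 < R ^ (l + 1) := by positivity
          nlinarith
  -- The denominator is an integer: it vanishes, or it has absolute value at least `1`.
  have hden : ‖((l : ℂ) + 1) * (l + 1 + ν)‖ = 0 ∨ 1 ≤ ‖((l : ℂ) + 1) * (l + 1 + ν)‖ := by
    have : ((l : ℂ) + 1) * (l + 1 + ν) = (((l + 1) * (l + 1 + ν) : ℤ) : ℂ) := by push_cast; ring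
    rw [this, Complex.norm_intCast]
    norm_cast
    have := abs_nonneg ((l + 1 : ℤ) * (l + 1 + ν))
    push_cast
    omega
  rcases hden with h | h
  · rw [h, div_zero]; positivity
  · exact (div_le_self (norm_nonneg _) h).trans hnum

variable {E h : ℂ → ℂ} {p : ℂ}

/-- The equation `t² h'' + (1 + ν) t h' = E h` near `p`, with `t = z - p`, satisfied by
`h = t ^ (-s) y` when `y'' = (s (s - 1) + E) / t² y` and `ν = 2 s - 1`. -/
def FrobEq (E : ℂ → ℂ) (p ν : ℂ) (h : ℂ → ℂ) (z : ℂ) : Prop :=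
  (z - p) ^ 2 * deriv (deriv h) z + (1 + ν) * (z - p) * deriv h z = E z * h z

/-- The Frobenius equation amounts to the recursion `l (l + ν) c_l = ∑ g_{l - i} c_i` for the Taylor
coefficients of the solution. -/
lemma frobEq_iff_coeff (hE : AnalyticAt ℂ E p) (hh : AnalyticAt ℂ h p) (ν : ℂ) :
    (∀ᶠ z in 𝓝 p, FrobEq E p ν h z) ↔ ∀ l : ℕ, (l : ℂ) * (l + ν) * coeff l (taylor h p) =
      coeff l (taylor E p * taylor h p) := by
  have ht : AnalyticAt ℂ (fun z : ℂ => z - p) p := by fun_prop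
  have hd := hh.deriv
  have hdd := hd.deriv
  set L : ℂ → ℂ := (fun z => z - p) * ((fun z => z - p) * deriv (deriv h)) +
    fun z => (1 + ν) * ((fun z => z - p) * deriv h) z with hL
  have hLa : AnalyticAt ℂ L p :=
    (ht.mul (ht.mul hdd)).add (analyticAt_const.mul (ht.mul hd))
  have hEh : AnalyticAt ℂ (E * h) p := hE.mul hh
  have hcL : ∀ l : ℕ, coeff l (taylor L p) = (l : ℂ) * (l + ν) * coeff l (taylor h p) := by
    intro l
    rw [hL, taylor_add (hf := ht.mul (ht.mul hdd))
        (f := (fun z => z - p) * ((fun z => z - p) * deriv (deriv h)))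
        (g := fun z => (1 + ν) * ((fun z => z - p) * deriv h) z)
        (hg := analyticAt_const.mul (ht.mul hd)),
      taylor_mul ht (ht.mul hdd), taylor_mul ht hdd, taylor_const_mul (ht.mul hd),
      taylor_mul ht hd, taylor_sub_self, taylor_deriv, taylor_deriv, map_add, coeff_C_mul]
    rcases l with _ | _ | l
    · simp
    · simp [coeff_succ_X_mul, coeff_derivative, PowerSeries.coeff_zero_X_mul]
    · rw [coeff_succ_X_mul, coeff_succ_X_mul, coeff_succ_X_mul, coeff_derivative,
        coeff_derivative]
      push_cast
      ring
  have hiff : (∀ᶠ z in 𝓝 p, FrobEq E p ν h z) ↔ L =ᶠ[𝓝 p] E * h := by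
    refine eventually_congr (Eventually.of_forall fun z => ?_)
    simp only [FrobEq, hL, Pi.add_apply, Pi.mul_apply]
    constructor <;> intro H <;> rw [← H] <;> ring
  rw [hiff]
  constructor
  · intro H l
    rw [← hcL, taylor_congr H, taylor_mul hE hh]
  · intro H
    refine eventuallyEq_of_taylor_eq hLa hEh ?_
    ext l
    rw [hcL, H, taylor_mul hE hh]

lemma coeff_mul_eq_sum_range {g c : PowerSeries ℂ} (hg : coeff 0 g = 0) (l : ℕ) :
    coeff l (g * c) = ∑ i ∈ Finset.range l, coeff (l - i) g * coeff i c := by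
  rw [mul_comm, PowerSeries.coeff_mul, Finset.Nat.sum_antidiagonal_eq_sum_range_succ
    (fun i j => coeff i c * coeff j g), Finset.sum_range_succ]
  simp only [Nat.sub_self, hg, mul_zero, add_zero]
  exact Finset.sum_congr rfl fun i _ => mul_comm _ _

/-- Existence of a convergent Frobenius solution, provided that the recursion for the coefficients
is solvable at the resonance. -/
lemma exists_frobEq (hE : AnalyticAt ℂ E p) (hE0 : E p = 0) (ν : ℤ)
    (hres : ∀ l : ℕ, 0 < l → (l : ℤ) + ν = 0 →
      ∑ i ∈ Finset.range l, coeff (l - i) (taylor E p) *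
        frobCoeff (fun i => coeff i (taylor E p)) ν i = 0) :
    ∃ h, AnalyticAt ℂ h p ∧ h p = 1 ∧ ∀ᶠ z in 𝓝 p, FrobEq E p ν h z := by
  obtain ⟨M, R, hM, hR, hb⟩ := exists_coeff_taylor_le hE
  set g : ℕ → ℂ := fun i => coeff i (taylor E p) with hg
  obtain ⟨h, hh, hc⟩ := exists_taylor_eq (PowerSeries.mk (frobCoeff g ν)) p
    (M := 1) (S := R * (1 + M)) (by positivity)
    (fun l => by simpa using norm_frobCoeff_le ν hM hR hb l)
  refine ⟨h, hh, ?_, (frobEq_iff_coeff hE hh ν).2 fun l => ?_⟩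
  · rw [← coeff_zero_taylor h p, hc]
    simp [frobCoeff]
  · rw [coeff_mul_eq_sum_range (by rw [coeff_zero_taylor, hE0]), hc]
    simp only [coeff_mk]
    rcases l with _ | l
    · simp
    by_cases hl : ((l + 1 : ℕ) : ℤ) + ν = 0
    · rw [hres (l + 1) l.succ_pos hl]
      have : (((l + 1 : ℕ) : ℂ) + ν) = 0 := by exact_mod_cast hl
      rw [this]; simp
    · have h1 : ((l : ℂ) + 1 + ν) ≠ 0 := by exact_mod_cast hl
      have h2 : ((l : ℂ) + 1) ≠ 0 := by exact_mod_cast l.succ_ne_zero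
      rw [frobCoeff_succ]
      push_cast
      field_simp
      rfl

/-- Below the resonance at `n` the recursion forces the coefficients of a solution. -/
lemma coeff_eq_frobCoeff (hE : AnalyticAt ℂ E p) (hE0 : E p = 0) (hh : AnalyticAt ℂ h p)
    (hp : h p = 1) {n : ℕ} (heq : ∀ᶠ z in 𝓝 p, FrobEq E p (-n) h z) (l : ℕ) (hl : l < n) :
    coeff l (taylor h p) = frobCoeff (fun i => coeff i (taylor E p)) (-n) l := by
  induction l using Nat.strong_induction_on with
  | _ l ih =>
  have H := (frobEq_iff_coeff hE hh _).1 heq l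
  rw [coeff_mul_eq_sum_range (by rw [coeff_zero_taylor, hE0])] at H
  rcases l with _ | l
  · rw [coeff_zero_taylor, hp, frobCoeff]
  · rw [frobCoeff_succ]
    have h1 : ((l : ℂ) + 1 + (-n : ℤ)) ≠ 0 := by
      have : ((l : ℤ) + 1 + -n) ≠ 0 := by omega
      exact_mod_cast this
    have h2 : ((l : ℂ) + 1) ≠ 0 := by exact_mod_cast l.succ_ne_zero
    rw [eq_div_iff (mul_ne_zero h2 h1), mul_comm]
    push_cast at H ⊢
    rw [H]
    exact Finset.sum_congr rfl fun i hi => by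
      rw [ih i (Finset.mem_range.1 hi) ((Finset.mem_range.1 hi).trans hl)]

/-- A Frobenius solution with the smaller exponent exists if and only if the obstruction
vanishes. -/
lemma exists_frobEq_neg_iff (hE : AnalyticAt ℂ E p) (hE0 : E p = 0) {n : ℕ} (hn : 0 < n) :
    (∃ h, AnalyticAt ℂ h p ∧ h p = 1 ∧ ∀ᶠ z in 𝓝 p, FrobEq E p (-n) h z) ↔
      obstruction (fun i => coeff i (taylor E p)) n = 0 := by
  constructor
  · rintro ⟨h, hh, hp, heq⟩
    have H := (frobEq_iff_coeff hE hh _).1 heq n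
    rw [coeff_mul_eq_sum_range (by rw [coeff_zero_taylor, hE0]), add_neg_cancel, mul_zero,
      zero_mul] at H
    rw [obstruction, H]
    exact Finset.sum_congr rfl fun i hi => by
      rw [coeff_eq_frobCoeff hE hE0 hh hp heq i (Finset.mem_range.1 hi)]
  · intro H
    have := exists_frobEq hE hE0 (-n) (fun l _ hl => by
      have : l = n := by omega
      subst this
      exact H)
    simpa using this

end Frobenius

/-! ### The solution with the smaller exponent -/

section Local

open PowerSeries

/-- The equation `y'' = f y` has a solution `(z - p) ^ (1/2 - n/2) h` with `h` holomorphic at `p`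
and `h p = 1`; written as an equation for `h`, so that no branch of the power is involved. -/
def HasSmallSolution (f : ℂ → ℂ) (p : ℂ) (n : ℕ) : Prop :=
  ∃ h, AnalyticAt ℂ h p ∧ h p = 1 ∧
    ∀ᶠ z in 𝓝[≠] p, FrobEq (fun z => (z - p) ^ 2 * f z - ((n : ℂ) ^ 2 - 1) / 4) p (-n) h z

variable {f E h : ℂ → ℂ} {p : ℂ} {n : ℕ}

lemma frobEq_congr {E₁ E₂ : ℂ → ℂ} {ν z : ℂ} (hE : E₁ z = E₂ z) :
    FrobEq E₁ p ν h z ↔ FrobEq E₂ p ν h z := by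
  simp [FrobEq, hE]

/-- `E` is the holomorphic part of `(z - p) ^ 2 f`, for exponents `1/2 ± n/2` at `p`. -/
structure IsPotential (f : ℂ → ℂ) (p : ℂ) (n : ℕ) (E : ℂ → ℂ) : Prop where
  analyticAt : AnalyticAt ℂ E p
  zero : E p = 0
  eq : ∀ᶠ z in 𝓝[≠] p, (z - p) ^ 2 * f z = ((n : ℂ) ^ 2 - 1) / 4 + E z

lemma IsPotential.hasSmallSolution_iff (hE : IsPotential f p n E) :
    HasSmallSolution f p n ↔
      ∃ h, AnalyticAt ℂ h p ∧ h p = 1 ∧ ∀ᶠ z in 𝓝 p, FrobEq E p (-n) h z := by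
  refine exists_congr fun h => and_congr_right fun _ => and_congr_right fun _ => ?_
  have h1 : (∀ᶠ z in 𝓝 p, FrobEq E p (-n) h z) ↔ ∀ᶠ z in 𝓝[≠] p, FrobEq E p (-n) h z := by
    rw [eventually_nhdsWithin_iff]
    refine eventually_congr (Eventually.of_forall fun z => ?_)
    by_cases hz : z = p
    · subst hz
      simp [FrobEq, hE.zero]
    · simp [hz]
  rw [h1]
  refine eventually_congr ?_
  filter_upwards [hE.eq] with z hz
  exact frobEq_congr (by rw [hz]; ring)

lemma IsPotential.hasSmallSolution_iff_obstruction (hE : IsPotential f p n E) (hn : 0 < n) :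
    HasSmallSolution f p n ↔ obstruction (fun i => coeff i (taylor E p)) n = 0 := by
  rw [hE.hasSmallSolution_iff, exists_frobEq_neg_iff hE.analyticAt hE.zero hn]

lemma HasSmallSolution.exists_isPotential (hf : HasSmallSolution f p n) :
    ∃ E, IsPotential f p n E := by
  obtain ⟨h, hh, hp, heq⟩ := hf
  have hne : ∀ᶠ z in 𝓝 p, h z ≠ 0 := hh.continuousAt.eventually_ne (by rw [hp]; exact one_ne_zero)
  refine ⟨fun z => ((z - p) ^ 2 * deriv (deriv h) z + (1 + -n) * (z - p) * deriv h z) / h z,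
    ?_, by simp, ?_⟩
  · have hd := hh.deriv
    have hdd := hd.deriv
    exact AnalyticAt.fun_div (by fun_prop) hh (by rw [hp]; exact one_ne_zero)
  · filter_upwards [heq, nhdsWithin_le_nhds hne] with z hz hz0
    rw [FrobEq] at hz
    rw [hz]
    field_simp
    ring

lemma HasSmallSolution.congr {f₁ f₂ : ℂ → ℂ} (hf : HasSmallSolution f₁ p n)
    (hfg : f₁ =ᶠ[𝓝[≠] p] f₂) : HasSmallSolution f₂ p n := by
  obtain ⟨h, hh, hp, heq⟩ := hf
  refine ⟨h, hh, hp, ?_⟩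
  filter_upwards [heq, hfg] with z hz hz'
  exact (frobEq_congr (by rw [hz'])).1 hz

lemma IsPotential.hasLocalExponents (hE : IsPotential f p n E) :
    HasLocalExponents f p ((1 / 2 + (n / 2 : ℝ) : ℝ) : ℂ) ((1 / 2 - (n / 2 : ℝ) : ℝ) : ℂ) := by
  refine ⟨((n : ℂ) ^ 2 - 1) / 4, ?_, fun x => by push_cast; ring⟩
  have h1 : Tendsto (fun z => ((n : ℂ) ^ 2 - 1) / 4 + E z) (𝓝[≠] p) (𝓝 (((n : ℂ) ^ 2 - 1) / 4)) := by
    have := (hE.analyticAt.continuousAt.tendsto.const_add (((n : ℂ) ^ 2 - 1) / 4)).mono_left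
      (nhdsWithin_le_nhds (s := {p}ᶜ))
    rwa [hE.zero, add_zero] at this
  exact h1.congr' (by filter_upwards [hE.eq] with z hz using hz.symm)

/-! ### Functions on slit discs -/

/-- The points of the disc of radius `r` about `p` off the slit. -/
def slitDisc (p : ℂ) (r : ℝ) : Set ℂ := {z | z - p ∈ Complex.slitPlane} ∩ Metric.ball p r

lemma isOpen_slit (p : ℂ) : IsOpen {z : ℂ | z - p ∈ Complex.slitPlane} :=
  Complex.isOpen_slitPlane.preimage (by fun_prop)

lemma isOpen_slitDisc (p : ℂ) (r : ℝ) : IsOpen (slitDisc p r) :=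
  (isOpen_slit p).inter Metric.isOpen_ball

lemma slitDisc_mem {r : ℝ} (p : ℂ) (hr : 0 < r) : slitDisc p r ∈ slitNhds p :=
  inter_mem_nhdsWithin _ (Metric.ball_mem_nhds p hr)

lemma eventually_slitNhds_iff {P : ℂ → Prop} :
    (∀ᶠ z in slitNhds p, P z) ↔ ∃ r > 0, ∀ z ∈ slitDisc p r, P z := by
  rw [slitNhds, Metric.nhdsWithin_basis_ball.eventually_iff]
  simp [slitDisc, and_comm]

/-- A slit disc is star-shaped about the points of its positive real radius. -/
lemma isPreconnected_slitDisc (p : ℂ) {r : ℝ} (hr : 0 < r) : IsPreconnected (slitDisc p r) := by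
  have hstar : StarConvex ℝ (p + (r / 2 : ℝ)) (slitDisc p r) := by
    have h1 : StarConvex ℝ (p + (r / 2 : ℝ)) {z : ℂ | z - p ∈ Complex.slitPlane} := by
      intro z hz a b ha hb hab
      have hz' : 0 < (z - p).re ∨ (z - p).im ≠ 0 := hz
      have e : a • (p + (r / 2 : ℝ)) + b • z - p = ((a * (r / 2) : ℝ) : ℂ) + b • (z - p) := by
        have : (p : ℂ) = ((a + b : ℝ) : ℂ) * p := by rw [hab]; simp
        simp only [Complex.real_smul]
        push_cast at this ⊢
        linear_combination -this
      change a • (p + (r / 2 : ℝ)) + b • z - p ∈ Complex.slitPlane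
      rw [e, Complex.mem_slitPlane_iff]
      simp only [Complex.add_re, Complex.ofReal_re, Complex.smul_re, Complex.add_im,
        Complex.ofReal_im, Complex.smul_im, zero_add, smul_eq_mul]
      rcases eq_or_lt_of_le hb with rfl | hb
      · left
        have : a = 1 := by linarith
        subst this
        simpa using hr
      · rcases hz' with h | h
        · left; positivity
        · right; positivity
    refine h1.inter ((convex_ball p r).starConvex ?_)
    rw [Metric.mem_ball, dist_eq_norm, add_sub_cancel_left, Complex.norm_real, Real.norm_eq_abs,
      abs_of_pos (by positivity)]
    linarith
  refine (hstar.isPathConnected ?_).isConnected.isPreconnected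
  refine ⟨?_, ?_⟩
  · change p + ((r / 2 : ℝ) : ℂ) - p ∈ Complex.slitPlane
    rw [add_sub_cancel_left]
    exact Complex.ofReal_mem_slitPlane.2 (by positivity)
  · rw [Metric.mem_ball, dist_eq_norm, add_sub_cancel_left, Complex.norm_real, Real.norm_eq_abs,
      abs_of_pos (by positivity)]
    linarith

instance slitNhds_neBot (p : ℂ) : (slitNhds p).NeBot := by
  refine Metric.nhdsWithin_basis_ball.neBot_iff.2 fun {r} hr => ⟨p + ((r / 2 : ℝ) : ℂ), ?_, ?_⟩
  · rw [Metric.mem_ball, dist_eq_norm, add_sub_cancel_left, Complex.norm_real, Real.norm_eq_abs,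
      abs_of_pos (by positivity)]
    linarith
  · change p + ((r / 2 : ℝ) : ℂ) - p ∈ Complex.slitPlane
    rw [add_sub_cancel_left]
    exact Complex.ofReal_mem_slitPlane.2 (by positivity)

lemma slitNhds_le (p : ℂ) : slitNhds p ≤ 𝓝[≠] p :=
  nhdsWithin_mono _ fun z hz h => by
    rw [Set.mem_singleton_iff] at h
    subst h
    simp at hz

lemma eventually_mem_slit (p : ℂ) : ∀ᶠ z in slitNhds p, z - p ∈ Complex.slitPlane :=
  eventually_mem_nhdsWithin

lemma eventually_slitNhds_nhds {P : ℂ → Prop} (h : ∀ᶠ z in slitNhds p, P z) :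
    ∀ᶠ z in slitNhds p, ∀ᶠ w in 𝓝 z, P w := by
  filter_upwards [eventually_eventually_nhdsWithin.2 h, eventually_mem_slit p] with z hz hs
  rwa [(isOpen_slit p).nhdsWithin_eq hs] at hz

lemma AnalyticAt.eventually_slitNhds (hh : AnalyticAt ℂ h p) :
    ∀ᶠ z in slitNhds p, AnalyticAt ℂ h z :=
  ((slitNhds_le p).trans nhdsWithin_le_nhds) hh.eventually_analyticAt

lemma hasDerivAt_cpow_mul {s z : ℂ} (hz : z - p ∈ Complex.slitPlane) (hh : AnalyticAt ℂ h z) :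
    HasDerivAt (fun w => (w - p) ^ s * h w)
      ((z - p) ^ (s - 1) * (s * h z + (z - p) * deriv h z)) z := by
  have h1 : HasDerivAt (fun w : ℂ => (w - p) ^ s) (s * (z - p) ^ (s - 1) * 1) z :=
    ((hasDerivAt_id z).sub_const p).cpow_const hz
  have h2 := h1.mul hh.differentiableAt.hasDerivAt
  refine h2.congr_deriv ?_
  have h3 : (z - p) ^ s = (z - p) ^ (s - 1) * (z - p) := by
    rw [Complex.cpow_sub _ _ (Complex.slitPlane_ne_zero hz), Complex.cpow_one,
      div_mul_cancel₀ _ (Complex.slitPlane_ne_zero hz)]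
  rw [h3]
  ring

lemma iteratedDeriv_two_cpow_mul {s z : ℂ} (hz : z - p ∈ Complex.slitPlane)
    (hh : AnalyticAt ℂ h z) :
    (z - p) ^ 2 * iteratedDeriv 2 (fun w => (w - p) ^ s * h w) z =
      (z - p) ^ s * (s * (s - 1) * h z + 2 * s * (z - p) * deriv h z +
        (z - p) ^ 2 * deriv (deriv h) z) := by
  have hz0 := Complex.slitPlane_ne_zero hz
  have h1 : deriv (fun w => (w - p) ^ s * h w) =ᶠ[𝓝 z]
      fun w => (w - p) ^ (s - 1) * (s * h w + (w - p) * deriv h w) := by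
    filter_upwards [(isOpen_slit p).mem_nhds hz, hh.eventually_analyticAt] with w hw hhw
    exact (hasDerivAt_cpow_mul hw hhw).deriv
  have hd := hh.deriv
  have h2 := hasDerivAt_cpow_mul (s := s - 1) (h := fun w => s * h w + (w - p) * deriv h w) hz
    (by fun_prop)
  have h3 : HasDerivAt (fun w => s * h w + (w - p) * deriv h w)
      (s * deriv h z + (1 * deriv h z + (z - p) * deriv (deriv h) z)) z :=
    (hh.differentiableAt.hasDerivAt.const_mul s).add
      (((hasDerivAt_id z).sub_const p).mul hd.differentiableAt.hasDerivAt)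
  rw [iteratedDeriv_succ, iteratedDeriv_one, h1.deriv_eq, h2.deriv, h3.deriv]
  have h4 : (z - p) ^ s = (z - p) ^ (s - 1 - 1) * (z - p) ^ 2 := by
    rw [sub_sub, one_add_one_eq_two, Complex.cpow_sub _ _ hz0, ← Complex.cpow_natCast (z - p) 2]
    push_cast
    rw [div_mul_cancel₀]
    simp [hz0]
  rw [h4]
  ring

/-- `(z - p) ^ s h` solves `y'' = f y` if and only if `h` solves the corresponding Frobenius
equation. -/
lemma IsPotential.solution_iff (hE : IsPotential f p n E) (hh : AnalyticAt ℂ h p) {s ν : ℂ}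
    (hs : s * (s - 1) = ((n : ℂ) ^ 2 - 1) / 4) (hν : 2 * s = 1 + ν) :
    ∀ᶠ z in slitNhds p, (iteratedDeriv 2 (fun w => (w - p) ^ s * h w) z =
      f z * ((z - p) ^ s * h z) ↔ FrobEq E p ν h z) := by
  filter_upwards [eventually_mem_slit p, AnalyticAt.eventually_slitNhds hh,
    slitNhds_le p hE.eq] with z hz hhz hEz
  have hz0 := Complex.slitPlane_ne_zero hz
  have hz2 : (z - p) ^ 2 ≠ 0 := pow_ne_zero 2 hz0
  have hzs : (z - p) ^ s ≠ 0 := by simp [Complex.cpow_eq_zero_iff, hz0]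
  rw [← mul_right_inj' hz2, iteratedDeriv_two_cpow_mul hz hhz, ← mul_assoc, hEz,
    mul_left_comm, mul_right_inj' hzs, hs, hν, FrobEq]
  constructor <;> intro H <;> linear_combination H

end Local

/-! ### Logarithms -/

section NoLog

open PowerSeries

variable {f E h : ℂ → ℂ} {p : ℂ} {n : ℕ}

lemma analyticAt_cpow_mul {s z : ℂ} (hz : z - p ∈ Complex.slitPlane) (hh : AnalyticAt ℂ h z) :
    AnalyticAt ℂ (fun w => (w - p) ^ s * h w) z :=
  have h1 : AnalyticAt ℂ (fun w : ℂ => w - p) z := by fun_prop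
  (h1.cpow analyticAt_const hz).mul hh

lemma hasDerivAt_deriv_of_analyticAt {y : ℂ → ℂ} {z : ℂ} (hy : AnalyticAt ℂ y z) :
    HasDerivAt (deriv y) (iteratedDeriv 2 y z) z := by
  rw [iteratedDeriv_succ, iteratedDeriv_one]
  exact hy.deriv.differentiableAt.hasDerivAt

/-- The Wronskian of two solutions of `y'' = f y` is constant on a slit disc. -/
lemma exists_wronskian_eq {y₁ y₂ : ℂ → ℂ} {r : ℝ} (hr : 0 < r)
    (h₁ : ∀ z ∈ slitDisc p r, AnalyticAt ℂ y₁ z ∧ iteratedDeriv 2 y₁ z = f z * y₁ z)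
    (h₂ : ∀ z ∈ slitDisc p r, AnalyticAt ℂ y₂ z ∧ iteratedDeriv 2 y₂ z = f z * y₂ z) :
    ∃ w : ℂ, ∀ z ∈ slitDisc p r, y₁ z * deriv y₂ z - deriv y₁ z * y₂ z = w := by
  have hd : ∀ z ∈ slitDisc p r,
      HasDerivAt (fun z => y₁ z * deriv y₂ z - deriv y₁ z * y₂ z) 0 z := by
    intro z hz
    obtain ⟨ha₁, he₁⟩ := h₁ z hz
    obtain ⟨ha₂, he₂⟩ := h₂ z hz
    refine ((ha₁.differentiableAt.hasDerivAt.mul (hasDerivAt_deriv_of_analyticAt ha₂)).sub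
      ((hasDerivAt_deriv_of_analyticAt ha₁).mul ha₂.differentiableAt.hasDerivAt)).congr_deriv ?_
    rw [he₁, he₂]
    ring
  obtain ⟨w, hw⟩ := (isOpen_slitDisc p r).exists_is_const_of_deriv_eq_zero
    (isPreconnected_slitDisc p hr)
    (fun z hz => (hd z hz).differentiableAt.differentiableWithinAt) (fun z hz => (hd z hz).deriv)
  exact ⟨w, hw⟩

/-- The solution with the larger exponent `1/2 + n/2` exists unconditionally. -/
lemma IsPotential.exists_large (hE : IsPotential f p n E) :
    ∃ h, AnalyticAt ℂ h p ∧ h p = 1 ∧ ∀ᶠ z in 𝓝 p, FrobEq E p n h z := by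
  have := exists_frobEq hE.analyticAt hE.zero n (fun l hl h => by omega)
  simpa using this

lemma IsPotential.isSolution (hE : IsPotential f p n E) (hh : AnalyticAt ℂ h p) {s ν : ℂ}
    (hs : s * (s - 1) = ((n : ℂ) ^ 2 - 1) / 4) (hν : 2 * s = 1 + ν)
    (heq : ∀ᶠ z in 𝓝 p, FrobEq E p ν h z) :
    ∀ᶠ z in slitNhds p, AnalyticAt ℂ (fun w => (w - p) ^ s * h w) z ∧
      iteratedDeriv 2 (fun w => (w - p) ^ s * h w) z = f z * ((z - p) ^ s * h z) := by
  filter_upwards [hE.solution_iff hh hs hν, ((slitNhds_le p).trans nhdsWithin_le_nhds) heq,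
    eventually_mem_slit p, AnalyticAt.eventually_slitNhds hh] with z hz hz' hzs hhz
  exact ⟨analyticAt_cpow_mul hzs hhz, hz.2 hz'⟩

/-- If the solution with the smaller exponent exists, every solution is a combination of it and of
the solution with the larger exponent. -/
lemma HasSmallSolution.noLogarithm (hn : 0 < n) (hf : HasSmallSolution f p n) :
    NoLogarithm f p (n / 2) := by
  intro y hy
  obtain ⟨E, hE⟩ := hf.exists_isPotential
  obtain ⟨h₂, ha₂, hp₂, heq₂⟩ := hE.hasSmallSolution_iff.1 hf
  obtain ⟨h₁, ha₁, hp₁, heq₁⟩ := hE.exists_large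
  set s₁ : ℂ := 1 / 2 + n / 2 with hs₁
  set s₂ : ℂ := 1 / 2 - n / 2 with hs₂
  have hsol₁ := hE.isSolution ha₁ (s := s₁) (ν := n) (by rw [hs₁]; ring) (by rw [hs₁]; ring) heq₁
  have hsol₂ := hE.isSolution ha₂ (s := s₂) (ν := -n) (by rw [hs₂]; ring) (by rw [hs₂]; ring) heq₂
  obtain ⟨r, hr, H⟩ := eventually_slitNhds_iff.1 (hy.and (hsol₁.and (hsol₂.and
    ((AnalyticAt.eventually_slitNhds ha₁).and (AnalyticAt.eventually_slitNhds ha₂)))))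
  obtain ⟨w, hw⟩ := exists_wronskian_eq hr (fun z hz => (H z hz).2.1) (fun z hz => (H z hz).2.2.1)
  obtain ⟨w₁, hw₁⟩ := exists_wronskian_eq hr (fun z hz => (H z hz).1) (fun z hz => (H z hz).2.1)
  obtain ⟨w₂, hw₂⟩ := exists_wronskian_eq hr (fun z hz => (H z hz).1) (fun z hz => (H z hz).2.2.1)
  -- The constant Wronskian of the two Frobenius solutions is its limit `s₂ - s₁` at `p`.
  have hwn : w = -n := by
    have hlim : Tendsto (fun z => h₁ z * (s₂ * h₂ z + (z - p) * deriv h₂ z) -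
        (s₁ * h₁ z + (z - p) * deriv h₁ z) * h₂ z) (slitNhds p)
        (𝓝 (h₁ p * (s₂ * h₂ p + (p - p) * deriv h₂ p) -
        (s₁ * h₁ p + (p - p) * deriv h₁ p) * h₂ p)) := by
      have hd₁ := ha₁.deriv
      have hd₂ := ha₂.deriv
      have : AnalyticAt ℂ (fun z => h₁ z * (s₂ * h₂ z + (z - p) * deriv h₂ z) -
        (s₁ * h₁ z + (z - p) * deriv h₁ z) * h₂ z) p := by fun_prop
      exact this.continuousAt.tendsto.mono_left ((slitNhds_le p).trans nhdsWithin_le_nhds)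
    have hconst : Tendsto (fun _ : ℂ => w) (slitNhds p) (𝓝 w) := tendsto_const_nhds
    have := tendsto_nhds_unique (hlim.congr' ?_) hconst
    · rw [← this, hp₁, hp₂, hs₁, hs₂]
      ring
    · filter_upwards [slitDisc_mem p hr] with z hz
      obtain ⟨-, -, -, hz₁, hz₂⟩ := H z hz
      have hz0 := Complex.slitPlane_ne_zero hz.1
      rw [← hw z hz, (hasDerivAt_cpow_mul hz.1 hz₁).deriv, (hasDerivAt_cpow_mul hz.1 hz₂).deriv]
      have e₁ : (z - p) ^ s₁ * (z - p) ^ (s₂ - 1) = 1 := by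
        rw [← Complex.cpow_add _ _ hz0, hs₁, hs₂, show (1 / 2 + (n : ℂ) / 2 + (1 / 2 - n / 2 - 1)) = 0
          by ring, Complex.cpow_zero]
      have e₂ : (z - p) ^ (s₁ - 1) * (z - p) ^ s₂ = 1 := by
        rw [← Complex.cpow_add _ _ hz0, hs₁, hs₂, show (1 / 2 + (n : ℂ) / 2 - 1 + (1 / 2 - n / 2)) = 0
          by ring, Complex.cpow_zero]
      linear_combination (-(h₁ z * (s₂ * h₂ z + (z - p) * deriv h₂ z))) * e₁ +
        ((s₁ * h₁ z + (z - p) * deriv h₁ z) * h₂ z) * e₂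
  have hn0 : (n : ℂ) ≠ 0 := by exact_mod_cast hn.ne'
  refine ⟨fun z => ((z - p) ^ n * h₁ z * w₂ - h₂ z * w₁) / w, ?_, ?_⟩
  · exact AnalyticAt.fun_div (by fun_prop) analyticAt_const (by rw [hwn]; simpa using hn0)
  · filter_upwards [slitDisc_mem p hr] with z hz
    have hz0 := Complex.slitPlane_ne_zero hz.1
    have e : (z - p) ^ s₁ = (z - p) ^ s₂ * (z - p) ^ n := by
      rw [← Complex.cpow_natCast, ← Complex.cpow_add _ _ hz0, hs₁, hs₂]
      congr 1; ring
    have e' : (((1 : ℝ) / 2 - (n : ℝ) / 2 : ℝ) : ℂ) = s₂ := by rw [hs₂]; push_cast; ring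
    have hw0 : w ≠ 0 := by rw [hwn]; simpa using hn0
    rw [e', mul_div_assoc', eq_div_iff hw0]
    have := hw z hz
    have i1 := hw₁ z hz
    have i2 := hw₂ z hz
    rw [← hw z hz, ← i1, ← i2]
    linear_combination (-(h₁ z) * (y z * deriv (fun w => (w - p) ^ s₂ * h₂ w) z -
      deriv y z * ((z - p) ^ s₂ * h₂ z))) * (-e)

lemma tendsto_pow_mul_log (hn : 0 < n) :
    Tendsto (fun z => (z - p) ^ n * Complex.log (z - p)) (slitNhds p) (𝓝 0) := by
  have hsub : Tendsto (fun z : ℂ => z - p) (slitNhds p) (𝓝[≠] 0) := by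
    have h1 : Tendsto (fun z : ℂ => z - p) (slitNhds p) (𝓝 0) := by
      have : ContinuousAt (fun z : ℂ => z - p) p := by fun_prop
      have := this.tendsto.mono_left ((slitNhds_le p).trans nhdsWithin_le_nhds)
      rwa [sub_self] at this
    refine tendsto_nhdsWithin_iff.2 ⟨h1, ?_⟩
    filter_upwards [eventually_mem_slit p] with z hz using Complex.slitPlane_ne_zero hz
  have h0 : Tendsto (fun t : ℂ => t ^ n * Complex.log t) (𝓝[≠] 0) (𝓝 0) := by
    have hnorm : Tendsto (fun t : ℂ => ‖t‖) (𝓝[≠] 0) (𝓝[>] 0) := tendsto_norm_nhdsNE_zero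
    have h2 : Tendsto (fun x : ℝ => |Real.log x * x| + Real.pi * x) (𝓝[>] 0) (𝓝 0) := by
      have a1 : Tendsto (fun x : ℝ => |Real.log x * x|) (𝓝[>] 0) (𝓝 |0|) := by
        simpa using (tendsto_log_mul_rpow_nhdsGT_zero one_pos).abs
      have a2 : Tendsto (fun x : ℝ => Real.pi * x) (𝓝[>] 0) (𝓝 0) := by
        have : ContinuousAt (fun x : ℝ => Real.pi * x) 0 := by fun_prop
        simpa using this.tendsto.mono_left (nhdsWithin_le_nhds (s := Set.Ioi 0))
      simpa using a1.add a2
    refine squeeze_zero_norm' ?_ (h2.comp hnorm)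
    have hsmall : ∀ᶠ t : ℂ in 𝓝[≠] 0, ‖t‖ < 1 :=
      nhdsWithin_le_nhds (by simpa [Metric.ball, dist_eq_norm] using Metric.ball_mem_nhds (0 : ℂ) one_pos)
    filter_upwards [hsmall] with t ht
    rw [norm_mul, norm_pow]
    have hlog : ‖Complex.log t‖ ≤ |Real.log ‖t‖| + Real.pi := by
      refine (Complex.norm_le_abs_re_add_abs_im _).trans ?_
      rw [Complex.log_re, Complex.log_im]
      gcongr
      exact Complex.abs_arg_le_pi t
    have hpow : ‖t‖ ^ n ≤ ‖t‖ := pow_le_of_le_one (norm_nonneg _) ht.le hn.ne'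
    calc ‖t‖ ^ n * ‖Complex.log t‖ ≤ ‖t‖ * (|Real.log ‖t‖| + Real.pi) := by gcongr
      _ = _ := by
        simp only [Function.comp, abs_mul, abs_norm]
        ring
  exact h0.comp hsub

/-- A logarithmic primitive of `t ^ (-1 - n) k`: with `g`, `r` as here, it is
`t ^ (-n) g + r log t`. -/
lemma exists_primitive_data {k : ℂ → ℂ} (hk : AnalyticAt ℂ k p) (n : ℕ) :
    ∃ (g : ℂ → ℂ) (r : ℂ), AnalyticAt ℂ g p ∧ -n * g p = (if n = 0 then 0 else k p) ∧
      ∀ᶠ z in 𝓝 p, (z - p) * deriv g z - n * g z + r * (z - p) ^ n = k z := by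
  obtain ⟨M, R, hM, hR, hb⟩ := exists_coeff_taylor_le hk
  set c : ℕ → ℂ := fun l => coeff l (taylor k p) / (((l : ℤ) - n : ℤ) : ℂ) with hc
  obtain ⟨g, hg, hgt⟩ := exists_taylor_eq (PowerSeries.mk c) p (M := M) hR (fun l => by
    rw [coeff_mk, hc]
    simp only
    rw [norm_div, Complex.norm_intCast]
    have hden : |(((l : ℤ) - n : ℤ) : ℝ)| = 0 ∨ 1 ≤ |(((l : ℤ) - n : ℤ) : ℝ)| := by
      rw [← Int.cast_abs]
      have := abs_nonneg ((l : ℤ) - n)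
      rcases this.eq_or_lt with h | h
      · left; rw [← h]; simp
      · right; exact_mod_cast h
    rcases hden with h | h
    · rw [h, div_zero]; positivity
    · exact (div_le_self (norm_nonneg _) h).trans (hb l))
  refine ⟨g, coeff n (taylor k p), hg, ?_, ?_⟩
  · rw [← coeff_zero_taylor g, hgt, coeff_mk, hc]
    simp only [← coeff_zero_taylor k]
    split_ifs with h
    · subst h; simp
    · have : (n : ℂ) ≠ 0 := by exact_mod_cast h
      push_cast
      field_simp
      simp [mul_comm]
  · have ht : AnalyticAt ℂ (fun z : ℂ => z - p) p := by fun_prop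
    have hgd := hg.deriv
    have htn : AnalyticAt ℂ ((fun z : ℂ => z - p) ^ n) p := ht.pow n
    have hpow : taylor ((fun z : ℂ => z - p) ^ n) p = PowerSeries.X ^ n := by
      clear * -
      induction n with
      | zero => exact (taylor_const 1 p).trans (by simp)
      | succ n ih =>
        have ht : AnalyticAt ℂ (fun z : ℂ => z - p) p := by fun_prop
        rw [pow_succ, taylor_mul (ht.pow n) ht, ih, taylor_sub_self, pow_succ]
    have key : (fun z => z - p) * deriv g + ((fun z => (-n : ℂ) * g z) +
        fun z => coeff n (taylor k p) * ((fun z : ℂ => z - p) ^ n) z) =ᶠ[𝓝 p] k := by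
      refine eventuallyEq_of_taylor_eq ((ht.mul hgd).add ((analyticAt_const.mul hg).add
        (analyticAt_const.mul htn))) hk ?_
      have a1 : AnalyticAt ℂ (fun z => (-n : ℂ) * g z) p := analyticAt_const.mul hg
      have a2 : AnalyticAt ℂ (fun z => coeff n (taylor k p) * ((fun z : ℂ => z - p) ^ n) z) p :=
        analyticAt_const.mul htn
      rw [taylor_add (ht.mul hgd) (a1.add a2), taylor_add a1 a2,
        taylor_const_mul hg, taylor_const_mul htn, taylor_mul ht hgd, taylor_sub_self,
        taylor_deriv, hpow, hgt]
      ext l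
      have e1 : coeff l (PowerSeries.X * derivative ℂ (PowerSeries.mk c)) = l * c l := by
        rcases l with _ | l
        · simp
        · rw [coeff_succ_X_mul, coeff_derivative, coeff_mk]; push_cast; ring
      rw [map_add, map_add, e1, coeff_C_mul, coeff_C_mul, coeff_mk, coeff_X_pow, hc]
      simp only
      by_cases hl : l = n
      · subst hl; simp
      · have : ((l : ℂ) - n) ≠ 0 := sub_ne_zero.2 (by exact_mod_cast hl)
        simp only [hl, if_false]
        push_cast
        field_simp
        ring
    filter_upwards [key] with z hz
    simp only [Pi.add_apply, Pi.mul_apply, Pi.pow_apply] at hz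
    rw [← hz]
    ring

/-- If no solution has a logarithm, the solution with the smaller exponent exists. It is obtained
from the second solution `y₁ ∫ y₁⁻²`, where `y₁` is the solution with the larger exponent. -/
lemma IsPotential.hasSmallSolution_of_noLogarithm (hE : IsPotential f p n E) (hn : 0 < n)
    (hlog : NoLogarithm f p (n / 2)) : HasSmallSolution f p n := by
  obtain ⟨h₁, ha₁, hp₁, heq₁⟩ := hE.exists_large
  have hn0 : (n : ℂ) ≠ 0 := by exact_mod_cast hn.ne'
  have hne : h₁ p ≠ 0 := by rw [hp₁]; exact one_ne_zero
  have hk : AnalyticAt ℂ (fun z => (h₁ z ^ 2)⁻¹) p := (ha₁.pow 2).fun_inv (pow_ne_zero 2 hne)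
  obtain ⟨g, r, hg, hgp, hgr⟩ := exists_primitive_data hk n
  rw [if_neg hn.ne', hp₁] at hgp
  set s₁ : ℂ := 1 / 2 + n / 2 with hs₁
  set s₂ : ℂ := 1 / 2 - n / 2 with hs₂
  set y₁ : ℂ → ℂ := fun w => (w - p) ^ s₁ * h₁ w with hy₁
  set Φ : ℂ → ℂ := fun z => g z / (z - p) ^ n + r * Complex.log (z - p) with hΦ
  have hsol₁ := hE.isSolution ha₁ (s := s₁) (ν := n) (by rw [hs₁]; ring) (by rw [hs₁]; ring) heq₁
  have hne' : ∀ᶠ z in slitNhds p, h₁ z ≠ 0 :=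
    ((slitNhds_le p).trans nhdsWithin_le_nhds) (ha₁.continuousAt.eventually_ne hne)
  have hy₁ne : ∀ᶠ z in slitNhds p, y₁ z ≠ 0 := by
    filter_upwards [hne', eventually_mem_slit p] with z hz hzs
    exact mul_ne_zero (by simp [Complex.cpow_eq_zero_iff, Complex.slitPlane_ne_zero hzs]) hz
  have hΦa : ∀ᶠ z in slitNhds p, AnalyticAt ℂ Φ z := by
    filter_upwards [eventually_mem_slit p, AnalyticAt.eventually_slitNhds hg] with z hz hgz
    have : AnalyticAt ℂ (fun z : ℂ => Complex.log (z - p)) z := AnalyticAt.clog (by fun_prop) hz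
    have hp : AnalyticAt ℂ (fun z : ℂ => (z - p) ^ n) z := by fun_prop
    exact (hgz.fun_div hp (pow_ne_zero n (Complex.slitPlane_ne_zero hz))).add
      (analyticAt_const.mul this)
  have hΦd : ∀ᶠ z in slitNhds p, HasDerivAt Φ (y₁ z ^ 2)⁻¹ z := by
    filter_upwards [eventually_mem_slit p, AnalyticAt.eventually_slitNhds hg, hne',
      ((slitNhds_le p).trans nhdsWithin_le_nhds) hgr] with z hz hgz hz1 hzr
    have hz0 := Complex.slitPlane_ne_zero hz
    have d1 : HasDerivAt (fun w : ℂ => (w - p) ^ n) (n * (z - p) ^ (n - 1) * 1) z :=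
      ((hasDerivAt_id z).sub_const p).pow n
    have d2 : HasDerivAt (fun w : ℂ => Complex.log (w - p)) (1 / (z - p)) z :=
      ((hasDerivAt_id z).sub_const p).clog hz
    refine ((hgz.differentiableAt.hasDerivAt.div d1 (pow_ne_zero n hz0)).add
      (d2.const_mul r)).congr_deriv ?_
    have e : ((z - p) ^ s₁) ^ 2 = (z - p) ^ n * (z - p) := by
      rw [← Complex.cpow_nat_mul, ← pow_succ, ← Complex.cpow_natCast, hs₁]
      congr 1; push_cast; ring
    simp only [hy₁, mul_pow, e, mul_inv, ← hzr]
    obtain ⟨l, rfl⟩ : ∃ l, n = l + 1 := ⟨n - 1, by omega⟩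
    simp only [Nat.add_sub_cancel]
    field_simp
    push_cast
    ring
  have hsol₂ : ∀ᶠ z in slitNhds p, AnalyticAt ℂ (y₁ * Φ) z ∧
      iteratedDeriv 2 (y₁ * Φ) z = f z * (y₁ * Φ) z := by
    filter_upwards [hΦa, eventually_slitNhds_nhds hΦd, eventually_slitNhds_nhds hsol₁,
      hy₁ne] with z hza hzd hzs hz0
    obtain ⟨hza₁, hze₁⟩ := hzs.self_of_nhds
    replace hza₁ : AnalyticAt ℂ y₁ z := hza₁
    refine ⟨hza₁.mul hza, ?_⟩
    have h1 : deriv (y₁ * Φ) =ᶠ[𝓝 z] fun w => deriv y₁ w * Φ w + y₁ w * (y₁ w ^ 2)⁻¹ := by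
      filter_upwards [hzd, hzs] with w hwd hws
      exact (hws.1.differentiableAt.hasDerivAt.mul hwd).deriv
    have hd₁ : HasDerivAt y₁ (deriv y₁ z) z := hza₁.differentiableAt.hasDerivAt
    have h2 := ((hasDerivAt_deriv_of_analyticAt hza₁).mul hzd.self_of_nhds).add
      (hd₁.mul ((hd₁.pow 2).inv (pow_ne_zero 2 hz0)))
    rw [iteratedDeriv_succ, iteratedDeriv_one, h1.deriv_eq]
    refine h2.deriv.trans ?_
    change iteratedDeriv 2 y₁ z = f z * y₁ z at hze₁
    simp only [hze₁, Pi.mul_apply, Pi.inv_apply, Pi.pow_apply]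
    generalize y₁ z = a, deriv y₁ z = b, Φ z = c, f z = d at hz0 ⊢
    field_simp
    push_cast
    ring
  -- By assumption the second solution is `(z - p) ^ s₂ h` with `h` holomorphic at `p`.
  obtain ⟨h, hh, heq⟩ := hlog _ hsol₂
  have e' : (((1 : ℝ) / 2 - (n : ℝ) / 2 : ℝ) : ℂ) = s₂ := by rw [hs₂]; push_cast; ring
  rw [e'] at heq
  have hheq : ∀ᶠ z in slitNhds p,
      h z = h₁ z * g z + r * h₁ z * ((z - p) ^ n * Complex.log (z - p)) := by
    filter_upwards [heq, eventually_mem_slit p] with z hz hzs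
    have hz0 := Complex.slitPlane_ne_zero hzs
    have hzs2 : (z - p) ^ s₂ ≠ 0 := by simp [Complex.cpow_eq_zero_iff, hz0]
    have e : (z - p) ^ s₁ = (z - p) ^ s₂ * (z - p) ^ n := by
      rw [← Complex.cpow_natCast, ← Complex.cpow_add _ _ hz0, hs₁, hs₂]
      congr 1; ring
    rw [← mul_right_inj' hzs2, ← hz]
    simp only [Pi.mul_apply, hy₁, hΦ, e]
    field_simp
  have hle : slitNhds p ≤ 𝓝 p := (slitNhds_le p).trans nhdsWithin_le_nhds
  -- The logarithmic term tends to zero, and `g p = -1 / n` is nonzero.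
  have hhp : h p = g p := by
    have t1 : Tendsto h (slitNhds p) (𝓝 (h p)) := hh.continuousAt.tendsto.mono_left hle
    have t2 := (((ha₁.mul hg).continuousAt.tendsto.mono_left hle)).add
      (((ha₁.continuousAt.tendsto.mono_left hle).const_mul r).mul (tendsto_pow_mul_log (p := p) hn))
    have := tendsto_nhds_unique (t1.congr' hheq) t2
    simpa [hp₁] using this
  have hhp0 : h p ≠ 0 := by
    rw [hhp]
    intro h0
    rw [h0] at hgp
    norm_num at hgp
  have hfrob : ∀ᶠ z in slitNhds p, FrobEq E p (-n) h z := by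
    filter_upwards [hE.solution_iff hh (s := s₂) (ν := -n) (by rw [hs₂]; ring) (by rw [hs₂]; ring),
      eventually_slitNhds_nhds heq, hsol₂] with z hz hzh hzs
    rw [← hz, ← Filter.EventuallyEq.iteratedDeriv_eq (f := y₁ * Φ) 2 hzh, hzs.2,
      hzh.self_of_nhds]
  have hfrob' : ∀ᶠ z in 𝓝 p, FrobEq E p (-n) h z := by
    have hd := hh.deriv
    have hdd := hd.deriv
    have hEa := hE.analyticAt
    refine (AnalyticAt.frequently_eq_iff_eventually_eq (by fun_prop) (by fun_prop)).1
      (hfrob.frequently.filter_mono (slitNhds_le p))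
  refine hE.hasSmallSolution_iff.2 ⟨fun z => (h p)⁻¹ * h z, analyticAt_const.mul hh,
    inv_mul_cancel₀ hhp0, ?_⟩
  filter_upwards [hfrob'] with z hz
  have d1 : deriv (fun z => (h p)⁻¹ * h z) = fun z => (h p)⁻¹ * deriv h z := by
    ext w; exact deriv_const_mul_field _
  have d2 : deriv (fun z => (h p)⁻¹ * deriv h z) = fun z => (h p)⁻¹ * deriv (deriv h) z := by
    ext w; exact deriv_const_mul_field _
  rw [FrobEq] at hz ⊢
  rw [d1, d2]
  linear_combination (h p)⁻¹ * hz

end NoLog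

/-! ### Möbius transformations -/

section Moebius

open PowerSeries

variable {f F E h : ℂ → ℂ} {p : ℂ} {n : ℕ}

lemma eventually_comp_of_hasDerivAt {g : ℂ → ℂ} {g' q : ℂ} (hg : HasDerivAt g g' p) (hg' : g' ≠ 0)
    (hq : g p = q) {P : ℂ → Prop} (hP : ∀ᶠ w in 𝓝[≠] q, P w) : ∀ᶠ z in 𝓝[≠] p, P (g z) := by
  have h1 : Tendsto g (𝓝[≠] p) (𝓝[≠] (g p)) := hg.tendsto_nhdsNE hg'
  rw [hq] at h1
  exact h1.eventually hP

/-- The algebraic identity behind the Möbius invariance of the Frobenius equation. Here `t = z - p`,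
`u = c z + d`, the transformation has determinant `D`, the two unknowns differ by the automorphy
factor `α`, and `h0`, `h1`, `h2` are the values at the image of `z` of the solution and its first two
derivatives, `F0` that of the potential. -/
lemma moebius_identity {D t u c α h0 h1 h2 F0 : ℂ} (hu : u ≠ 0) (he : u - c * t ≠ 0)
    (h : (D * t / (u * (u - c * t))) ^ 2 * h2 + (1 + -(n : ℂ)) * (D * t / (u * (u - c * t))) * h1 =
      ((D * t / (u * (u - c * t))) ^ 2 * F0 - ((n : ℂ) ^ 2 - 1) / 4) * h0) :
    t ^ 2 * (((0 * u - ((n : ℂ) + 1) / 2 * c * (c * 1)) / u ^ 2 * α +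
      ((n : ℂ) + 1) / 2 * c / u * (((n : ℂ) + 1) / 2 * c / u * α)) * h0 +
      ((n : ℂ) + 1) / 2 * c / u * α * (h1 * (D / u ^ 2)) +
      (((n : ℂ) + 1) / 2 * c / u * α * (h1 * (D / u ^ 2)) +
      α * (h2 * (D / u ^ 2) * (D / u ^ 2) +
        h1 * ((0 * u ^ 2 - D * ((2 : ℕ) * u ^ (2 - 1) * (c * 1))) / (u ^ 2) ^ 2)))) +
      (1 + -(n : ℂ)) * t * (((n : ℂ) + 1) / 2 * c / u * α * h0 + α * (h1 * (D / u ^ 2))) =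
    (t ^ 2 * (D ^ 2 / u ^ 4 * F0) - ((n : ℂ) ^ 2 - 1) / 4) * (α * h0) := by
  have key : D ^ 2 * t ^ 2 * h2 = (D ^ 2 * t ^ 2 * F0 -
      ((n : ℂ) ^ 2 - 1) / 4 * (u * (u - c * t)) ^ 2) * h0 -
        (1 + -(n : ℂ)) * (D * t * (u * (u - c * t))) * h1 := by
    have hue : u * (u - c * t) ≠ 0 := mul_ne_zero hu he
    generalize u * (u - c * t) = v at h hue ⊢
    field_simp at h
    linear_combination h / 4
  have e : t ^ 2 * (h2 * (D / u ^ 2) * (D / u ^ 2)) = (D ^ 2 * t ^ 2 * h2) / u ^ 4 := by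
    field_simp
  have e' : ((t ^ 2 * (D ^ 2 / u ^ 4 * F0) - ((n : ℂ) ^ 2 - 1) / 4) * (α * h0)) =
    α * ((D ^ 2 * t ^ 2 * F0) * h0 / u ^ 4 - ((n : ℂ) ^ 2 - 1) / 4 * h0) := by
    field_simp
  rw [e', show D ^ 2 * t ^ 2 * F0 * h0 = D ^ 2 * t ^ 2 * h2 +
    ((n : ℂ) ^ 2 - 1) / 4 * (u * (u - c * t)) ^ 2 * h0 +
      (1 + -(n : ℂ)) * (D * t * (u * (u - c * t))) * h1 by linear_combination -key]
  push_cast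
  field_simp
  ring

/-- Existence of the solution with the smaller exponent is invariant under Möbius
transformations `w = (a z + b) / (c z + d)`, the potential being transformed with weight `4`:
a solution `y` is transformed to `(c z + d) y(w)`. -/
lemma HasSmallSolution.moebius (a b c d : ℂ) (hD : a * d - b * c ≠ 0) (he : c * p + d ≠ 0)
    (hF : HasSmallSolution F ((a * p + b) / (c * p + d)) n)
    (hf : ∀ᶠ z in 𝓝[≠] p, f z =
      (a * d - b * c) ^ 2 / (c * z + d) ^ 4 * F ((a * z + b) / (c * z + d))) :
    HasSmallSolution f p n := by
  obtain ⟨h, hh, hp, heq⟩ := hF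
  set D : ℂ := a * d - b * c with hDdef
  set e : ℂ := c * p + d with hedef
  set q : ℂ := (a * p + b) / e with hq
  set g : ℂ → ℂ := fun z => (a * z + b) / (c * z + d) with hg
  have hgp : g p = q := rfl
  have hne : ∀ᶠ z in 𝓝 p, c * z + d ≠ 0 := by
    have : ContinuousAt (fun z => c * z + d) p := by fun_prop
    exact this.eventually_ne he
  have hgd : ∀ z, c * z + d ≠ 0 → HasDerivAt g (D / (c * z + d) ^ 2) z := by
    intro z hz
    have h1 : HasDerivAt (fun z => a * z + b) (a * 1) z := ((hasDerivAt_id z).const_mul a).add_const b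
    have h2 : HasDerivAt (fun z => c * z + d) (c * 1) z := ((hasDerivAt_id z).const_mul c).add_const d
    refine (h1.div h2 hz).congr_deriv ?_
    rw [hDdef]
    field_simp
    ring
  have hga : ∀ z, c * z + d ≠ 0 → AnalyticAt ℂ g z := fun z hz =>
    AnalyticAt.fun_div (by fun_prop) (by fun_prop) hz
  -- The automorphy factor `((c z + d) / (c p + d)) ^ ((n + 1) / 2)` between the two unknowns.
  set A : ℂ → ℂ := fun z => ((c * z + d) / e) ^ (((n : ℂ) + 1) / 2) with hA
  have hslit : ∀ᶠ z in 𝓝 p, (c * z + d) / e ∈ Complex.slitPlane := by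
    have : ContinuousAt (fun z => (c * z + d) / e) p := by fun_prop
    refine this.eventually_mem (Complex.isOpen_slitPlane.mem_nhds ?_)
    rw [← hedef, div_self he]
    exact Complex.one_mem_slitPlane
  have hAa : AnalyticAt ℂ A p := by
    have h1 : AnalyticAt ℂ (fun z => (c * z + d) / e) p := by fun_prop
    exact h1.cpow analyticAt_const hslit.self_of_nhds
  have hAp : A p = 1 := by
    simp only [hA]
    rw [← hedef, div_self he, Complex.one_cpow]
  have hAd : ∀ᶠ z in 𝓝 p, HasDerivAt A (((n : ℂ) + 1) / 2 * c / (c * z + d) * A z) z := by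
    filter_upwards [hslit, hne] with z hz hz0
    have h1 : HasDerivAt (fun z => (c * z + d) / e) (c * 1 / e) z :=
      (((hasDerivAt_id z).const_mul c).add_const d).div_const e
    refine (h1.cpow_const hz).congr_deriv ?_
    rw [Complex.cpow_sub _ _ (Complex.slitPlane_ne_zero hz), Complex.cpow_one]
    simp only [hA]
    field_simp
  have hhg : AnalyticAt ℂ (h ∘ g) p := AnalyticAt.comp (hgp ▸ hh) (hga p he)
  refine ⟨A * (h ∘ g), hAa.mul hhg, by simp [hAp, hgp, hp], ?_⟩
  have hgcont : Tendsto g (𝓝 p) (𝓝 q) := (hga p he).continuousAt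
  have hev : ∀ᶠ z in 𝓝 p, c * z + d ≠ 0 ∧ AnalyticAt ℂ h (g z) ∧
      HasDerivAt A (((n : ℂ) + 1) / 2 * c / (c * z + d) * A z) z := by
    filter_upwards [hne, hgcont.eventually hh.eventually_analyticAt, hAd] with z h1 h2 h3
    exact ⟨h1, h2, h3⟩
  have hgdp : D / (c * p + d) ^ 2 ≠ 0 := div_ne_zero hD (pow_ne_zero 2 he)
  filter_upwards [nhdsWithin_le_nhds hev.eventually_nhds, hf,
    eventually_comp_of_hasDerivAt (hgd p he) hgdp hgp heq] with z hz hfz hFz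
  obtain ⟨hz0, hhz, hAz⟩ := hz.self_of_nhds
  have hd1 : deriv (A * (h ∘ g)) =ᶠ[𝓝 z] fun w =>
      (((n : ℂ) + 1) / 2 * c / (c * w + d) * A w) * h (g w) +
        A w * (deriv h (g w) * (D / (c * w + d) ^ 2)) := by
    filter_upwards [hz] with w hw
    exact (hw.2.2.mul (hw.2.1.differentiableAt.hasDerivAt.comp w (hgd w hw.1))).deriv
  have hh1 : HasDerivAt (fun w => h (g w)) (deriv h (g z) * (D / (c * z + d) ^ 2)) z :=
    hhz.differentiableAt.hasDerivAt.comp z (hgd z hz0)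
  have hh2 : HasDerivAt (fun w => deriv h (g w))
      (deriv (deriv h) (g z) * (D / (c * z + d) ^ 2)) z :=
    hhz.deriv.differentiableAt.hasDerivAt.comp z (hgd z hz0)
  have hl : HasDerivAt (fun w => c * w + d) (c * 1) z := ((hasDerivAt_id z).const_mul c).add_const d
  have hl1 : HasDerivAt (fun w => ((n : ℂ) + 1) / 2 * c / (c * w + d))
      ((0 * (c * z + d) - ((n : ℂ) + 1) / 2 * c * (c * 1)) / (c * z + d) ^ 2) z :=
    (hasDerivAt_const z (((n : ℂ) + 1) / 2 * c)).div hl hz0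
  have hl2 : HasDerivAt (fun w => D / (c * w + d) ^ 2)
      ((0 * (c * z + d) ^ 2 - D * ((2 : ℕ) * (c * z + d) ^ (2 - 1) * (c * 1))) /
        ((c * z + d) ^ 2) ^ 2) z :=
    (hasDerivAt_const z D).div (hl.pow 2) (pow_ne_zero 2 hz0)
  have hd2 := (((hl1.mul hAz).mul hh1).add (hAz.mul (hh2.mul hl2))).deriv
  rw [FrobEq] at hFz ⊢
  rw [hd1.deriv_eq, hd1.self_of_nhds]
  beta_reduce
  have hd2' := hd2
  simp only [Pi.mul_def, Pi.add_def] at hd2'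
  rw [hd2', hfz]
  have hgq : g z - q = D * (z - p) / ((c * z + d) * e) := by
    change (a * z + b) / (c * z + d) - (a * p + b) / (c * p + d) =
      (a * d - b * c) * (z - p) / ((c * z + d) * (c * p + d))
    rw [div_sub_div _ _ hz0 he]
    ring
  change (g z - q) ^ 2 * _ + (1 + -(n : ℂ)) * (g z - q) * _ =
    ((g z - q) ^ 2 * F (g z) - _) * _ at hFz
  change _ = ((z - p) ^ 2 * (D ^ 2 / (c * z + d) ^ 4 * F (g z)) - _) * (A z * h (g z))
  rw [hgq] at hFz
  have hcz : e = c * z + d - c * (z - p) := by rw [hedef]; ring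
  generalize A z = α, h (g z) = h0, deriv h (g z) = h1, deriv (deriv h) (g z) = h2,
    F (g z) = F0 at hFz ⊢
  generalize c * z + d = u at hFz hz0 hcz ⊢
  generalize z - p = t at hFz hcz ⊢
  exact moebius_identity hz0 (hcz ▸ he) (by rw [← hcz]; exact hFz)

end Moebius

/-! ### Points with a nontrivial stabiliser -/

section Stabilizer

open PowerSeries

variable {f E : ℂ → ℂ} {p : ℂ} {n : ℕ}

lemma coeff_taylor_comp_mul (f : ℂ → ℂ) (ζ : ℂ) (l : ℕ) :
    coeff l (taylor (fun w => f (ζ * w)) 0) = ζ ^ l * coeff l (taylor f 0) := by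
  have h : ∀ l : ℕ, iteratedDeriv l (fun w => f (ζ * w)) =
      fun w => ζ ^ l * iteratedDeriv l f (ζ * w) := by
    intro l
    induction l with
    | zero => simp
    | succ l ih =>
      rw [iteratedDeriv_succ, ih]
      ext w
      rw [deriv_const_mul_field, deriv_comp_mul_left ζ (iteratedDeriv l f) w, iteratedDeriv_succ,
        smul_eq_mul]
      ring
  rw [coeff_taylor, coeff_taylor, h]
  simp [mul_div_assoc]

/-- If the potential is invariant under the rotation `t ↦ ζ t`, so is the formal solution,
while the obstruction is homogeneous of weight `n`. -/
lemma obstruction_eq_zero_of_rotation {g : ℕ → ℂ} {ζ : ℂ} (hg : ∀ i, ζ ^ i * g i = g i)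
    (hζ : ζ ^ n ≠ 1) : obstruction g n = 0 := by
  have hc : ∀ l, ζ ^ l * frobCoeff g (-n) l = frobCoeff g (-n) l := by
    intro l
    induction l using Nat.strong_induction_on with
    | _ l ih =>
    rcases l with _ | l
    · simp
    · rw [frobCoeff_succ, mul_div_assoc', Finset.mul_sum]
      congr 1
      refine Finset.sum_congr rfl fun i hi => ?_
      have hi' := Finset.mem_range.1 hi
      rw [← pow_sub_mul_pow ζ hi'.le, mul_mul_mul_comm, hg, ih i hi']
  refine Finset.sum_eq_zero fun i hi => ?_
  have hi' := Finset.mem_range.1 hi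
  have h1 : ζ ^ n * (g (n - i) * frobCoeff g (-n) i) = g (n - i) * frobCoeff g (-n) i := by
    rw [← pow_sub_mul_pow ζ hi'.le, mul_mul_mul_comm, hg, hc]
  have h2 : (ζ ^ n - 1) * (g (n - i) * frobCoeff g (-n) i) = 0 := by
    rw [sub_mul, h1]; ring
  exact (mul_eq_zero.1 h2).resolve_left (sub_ne_zero.2 hζ)

/-- At a point `p` fixed by a Möbius transformation whose derivative `ζ` there satisfies
`ζ ^ n ≠ 1`, the symmetry of the potential forces the obstruction to vanish. In the coordinate
`(z - p) / (z - q)`, with `q` the other fixed point, the transformation is a rotation. -/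
lemma IsPotential.hasSmallSolution_of_fixedPoint (hE : IsPotential f p n E) (hn : 0 < n)
    {a b c d q : ℂ} (hdet : a * d - b * c = 1) (hpq : p ≠ q)
    (hfp : a * p + b = p * (c * p + d)) (hfq : a * q + b = q * (c * q + d))
    (hep : c * p + d ≠ 0) (heq : c * q + d ≠ 0)
    (hζ : ((c * q + d) / (c * p + d)) ^ n ≠ 1)
    (hf : ∀ᶠ z in 𝓝[≠] p, f ((a * z + b) / (c * z + d)) = (c * z + d) ^ 4 * f z) :
    HasSmallSolution f p n := by
  set ζ : ℂ := (c * q + d) / (c * p + d) with hζdef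
  have hD : p - q ≠ 0 := sub_ne_zero.2 hpq
  set C : ℂ → ℂ := fun w => (-q * w + p) / (-1 * w + 1) with hC
  set F : ℂ → ℂ := fun w => (p - q) ^ 2 / (1 - w) ^ 4 * f (C w) with hF
  have hCp : C 0 = p := by simp [hC]
  have hCd : HasDerivAt C (p - q) 0 := by
    have h1 : HasDerivAt (fun w => -q * w + p) (-q * 1) 0 :=
      ((hasDerivAt_id (0 : ℂ)).const_mul (-q)).add_const p
    have h2 : HasDerivAt (fun w : ℂ => -1 * w + 1) (-1 * 1) 0 :=
      ((hasDerivAt_id (0 : ℂ)).const_mul (-1)).add_const 1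
    refine (h1.div h2 (by norm_num)).congr_deriv ?_
    norm_num
    ring
  have h1w : ∀ᶠ w in 𝓝[≠] (0 : ℂ), 1 - w ≠ 0 := by
    have : ContinuousAt (fun w : ℂ => 1 - w) 0 := by fun_prop
    exact nhdsWithin_le_nhds (this.eventually_ne (by norm_num))
  -- The potential in the new coordinate.
  have hCan : AnalyticAt ℂ C 0 := AnalyticAt.fun_div (by fun_prop) (by fun_prop) (by norm_num)
  have hECan : AnalyticAt ℂ (fun w => E (C w)) 0 :=
    AnalyticAt.fun_comp (hCp.symm ▸ hE.analyticAt) hCan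
  set Ê : ℂ → ℂ := fun w =>
    (((n : ℂ) ^ 2 - 1) / 4 + E (C w)) / (1 - w) ^ 2 - ((n : ℂ) ^ 2 - 1) / 4 with hÊ
  have hpot : IsPotential F 0 n Ê := by
    refine ⟨?_, ?_, ?_⟩
    · exact ((analyticAt_const.add hECan).fun_div (by fun_prop) (by norm_num)).sub analyticAt_const
    · simp [hÊ, hCp, hE.zero]
    · filter_upwards [h1w, eventually_comp_of_hasDerivAt hCd hD hCp hE.eq] with w hw hEw
      have hw' : -1 * w + 1 ≠ 0 := by convert hw using 1; ring
      have hCw : C w - p = (p - q) * w / (1 - w) := by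
        simp only [hC]
        rw [show -1 * w + 1 = 1 - w by ring]
        field_simp
        ring
      rw [hCw] at hEw
      simp only [hÊ, hF, ← hEw]
      field_simp
      ring
  have hrot : ∀ᶠ w in 𝓝[≠] (0 : ℂ), Ê (ζ * w) = Ê w := by
    have hζ0 : ζ ≠ 0 := div_ne_zero heq hep
    have hζd : HasDerivAt (fun w : ℂ => ζ * w) (ζ * 1) 0 := (hasDerivAt_id (0 : ℂ)).const_mul ζ
    have hne0 : ∀ᶠ w in 𝓝[≠] (0 : ℂ), w ≠ 0 := eventually_mem_nhdsWithin
    have hcz : ∀ᶠ w in 𝓝[≠] (0 : ℂ), c * C w + d ≠ 0 := by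
      have : ContinuousAt (fun w => c * C w + d) 0 := by
        have := hCan.continuousAt; fun_prop
      exact nhdsWithin_le_nhds (this.eventually_ne (by rw [hCp]; exact hep))
    have hrw := eventually_comp_of_hasDerivAt (p := 0) (q := 0) hζd (by simpa using hζ0) (by simp)
      (h1w.and hpot.eq)
    filter_upwards [h1w, hpot.eq, hrw, hcz, hne0,
      eventually_comp_of_hasDerivAt hCd hD hCp hf] with w hw1 hw2 ⟨hw3, hw4⟩ hw5 hw0 hw6
    have hw1' : -1 * w + 1 ≠ 0 := by convert hw1 using 1; ring
    have hw3' : -1 * (ζ * w) + 1 ≠ 0 := by convert hw3 using 1; ring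
    have hCw : C w * (1 - w) = p - q * w := by
      simp only [hC]
      rw [show -1 * w + 1 = 1 - w by ring]
      field_simp
      ring
    have hcd : (c * C w + d) * (1 - w) = (c * p + d) * (1 - ζ * w) := by
      have : ζ * (c * p + d) = c * q + d := by rw [hζdef]; field_simp
      linear_combination c * hCw + w * this
    have hCζ : C (ζ * w) = (a * C w + b) / (c * C w + d) := by
      have h2 : C (ζ * w) * (1 - ζ * w) = p - q * (ζ * w) := by
        simp only [hC]
        rw [show -1 * (ζ * w) + 1 = 1 - ζ * w by ring]
        field_simp
        ring
      rw [eq_div_iff hw5]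
      have h3 : (1 - w) * (1 - ζ * w) ≠ 0 := mul_ne_zero hw1 hw3
      have h4 : ζ * (c * p + d) = c * q + d := by rw [hζdef]; field_simp
      refine mul_right_cancel₀ h3 ?_
      linear_combination C (ζ * w) * (1 - ζ * w) * hcd + (c * p + d) * (1 - ζ * w) * h2 -
        (1 - ζ * w) * a * hCw - (1 - ζ * w) * hfp + w * (1 - ζ * w) * hfq -
        q * w * (1 - ζ * w) * h4
    have hFζ : ζ ^ 2 * F (ζ * w) = F w := by
      simp only [hF]
      rw [hCζ, hw6]
      clear_value ζ C
      have h4 : (c * C w + d) ^ 4 * (1 - w) ^ 4 = (c * p + d) ^ 4 * (1 - ζ * w) ^ 4 := by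
        rw [← mul_pow, hcd, mul_pow]
      -- `c p + d` and `c q + d` are the eigenvalues of a matrix of determinant one.
      have hdd : (c * p + d) * (c * q + d) = 1 := by
        have h5 : (p - q) * ((c * p + d) * (c * q + d) - 1) = 0 := by
          linear_combination (-(c * q + d)) * hfp + (c * p + d) * hfq + (p - q) * hdet
        exact sub_eq_zero.1 ((mul_eq_zero.1 h5).resolve_left hD)
      have hζ2 : ζ ^ 2 * (c * p + d) ^ 4 = 1 := by
        rw [hζdef]
        field_simp
        linear_combination ((c * p + d) * (c * q + d) + 1) * hdd
      have h6 : (c * C w + d) ^ 4 = (c * p + d) ^ 4 * (1 - ζ * w) ^ 4 / (1 - w) ^ 4 :=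
        eq_div_of_mul_eq (pow_ne_zero 4 hw1) h4
      calc _ = ζ ^ 2 * (c * p + d) ^ 4 * ((p - q) ^ 2 / (1 - w) ^ 4 * f (C w)) := by
            rw [h6]; field_simp
        _ = _ := by rw [hζ2, one_mul]
    have h5 : (w - 0) ^ 2 * F w = (ζ * w - 0) ^ 2 * F (ζ * w) := by
      rw [← hFζ]; ring
    rw [hw2, hw4] at h5
    exact (add_left_cancel h5).symm
  have hrot' : (fun w => Ê (ζ * w)) =ᶠ[𝓝 0] Ê := by
    have h0 : Ê (ζ * 0) = Ê 0 := by simp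
    rw [EventuallyEq, ← nhdsNE_sup_pure]
    exact eventually_sup.2 ⟨hrot, h0⟩
  have hsmall : HasSmallSolution F 0 n := by
    rw [hpot.hasSmallSolution_iff_obstruction hn]
    refine obstruction_eq_zero_of_rotation (ζ := ζ) (fun i => ?_) hζ
    rw [← coeff_taylor_comp_mul, taylor_congr hrot']
  have hpp : (1 * p + -p) / (1 * p + -q) = 0 := by simp
  refine HasSmallSolution.moebius (F := F) 1 (-p) 1 (-q) ?_ ?_ (by rwa [hpp]) ?_
  · intro h0; exact hD (by linear_combination h0)
  · intro h0; exact hD (by linear_combination h0)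
  · have hzq : ∀ᶠ z in 𝓝[≠] p, z - q ≠ 0 := by
      have : ContinuousAt (fun z : ℂ => z - q) p := by fun_prop
      exact nhdsWithin_le_nhds (this.eventually_ne hD)
    filter_upwards [hzq] with z hz
    have hw : (1 * z + -p) / (1 * z + -q) = (z - p) / (z - q) := by ring
    have h1 : 1 - (z - p) / (z - q) = (p - q) / (z - q) := by field_simp; ring
    have hCz : C ((z - p) / (z - q)) = z := by
      simp only [hC]
      rw [show -1 * ((z - p) / (z - q)) + 1 = (p - q) / (z - q) by rw [← h1]; ring]
      field_simp
      ring
    rw [hw]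
    simp only [hF]
    rw [h1, hCz, show (1 : ℂ) * -q - -p * 1 = p - q by ring, show 1 * z + -q = z - q by ring]
    field_simp

end Stabilizer

/-! ### The obstruction as a polynomial in parameters -/

section ObstructionPolynomial

open MvPolynomial

variable {m : ℕ}

/-- The coefficients of the formal solution when the `g_i` depend polynomially on parameters. -/
def frobPoly (G : ℕ → MvPolynomial (Fin m) ℂ) (ν : ℤ) : ℕ → MvPolynomial (Fin m) ℂ
  | 0 => 1
  | l + 1 => C (((l + 1) * (l + 1 + ν) : ℂ)⁻¹) *
      ∑ i : Fin (l + 1), G (l + 1 - i) * frobPoly G ν i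

lemma frobPoly_succ (G : ℕ → MvPolynomial (Fin m) ℂ) (ν : ℤ) (l : ℕ) :
    frobPoly G ν (l + 1) = C (((l + 1) * (l + 1 + ν) : ℂ)⁻¹) *
      ∑ i ∈ Finset.range (l + 1), G (l + 1 - i) * frobPoly G ν i := by
  rw [frobPoly, Finset.sum_range]

lemma eval_frobPoly (G : ℕ → MvPolynomial (Fin m) ℂ) (ν : ℤ) (b : Fin m → ℂ) (l : ℕ) :
    eval b (frobPoly G ν l) = frobCoeff (fun i => eval b (G i)) ν l := by
  induction l using Nat.strong_induction_on with
  | _ l ih =>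
  rcases l with _ | l
  · simp [frobPoly, frobCoeff]
  · rw [frobPoly_succ, frobCoeff_succ, map_mul, map_sum, eval_C, div_eq_inv_mul]
    congr 1
    exact Finset.sum_congr rfl fun i hi => by rw [map_mul, ih i (Finset.mem_range.1 hi)]

variable {G : ℕ → MvPolynomial (Fin m) ℂ} {j : Fin m} {β γ : ℂ}

/-- In the right-hand side of the recursion, the part of degree `l + 1` comes from `g_1 c_l` alone. -/
lemma totalDegree_sum_sub_le (hG : ∀ i, (G i).totalDegree ≤ 1) (hG1 : G 1 = C β + C γ * X j)
    {c : ℕ → MvPolynomial (Fin m) ℂ} {α : ℂ} {l : ℕ} (hc : ∀ i ≤ l, (c i).totalDegree ≤ i)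
    (hl : (c l - C α * X j ^ l).totalDegree + 1 ≤ l ∨ c l - C α * X j ^ l = 0) :
    ((∑ i ∈ Finset.range (l + 1), G (l + 1 - i) * c i) - C (γ * α) * X j ^ (l + 1)).totalDegree
      ≤ l := by
  have e : (∑ i ∈ Finset.range (l + 1), G (l + 1 - i) * c i) - C (γ * α) * X j ^ (l + 1) =
      (∑ i ∈ Finset.range l, G (l + 1 - i) * c i) +
        (C β * c l + C γ * X j * (c l - C α * X j ^ l)) := by
    rw [Finset.sum_range_succ, Nat.add_sub_cancel_left, hG1, C_mul]
    ring
  rw [e]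
  refine (totalDegree_add _ _).trans (max_le ?_ ((totalDegree_add _ _).trans (max_le ?_ ?_)))
  · refine totalDegree_finsetSum_le fun i hi => (totalDegree_mul _ _).trans ?_
    have := hG (l + 1 - i)
    have := Finset.mem_range.1 hi
    have := hc i (by omega)
    omega
  · refine (totalDegree_mul _ _).trans ?_
    rw [totalDegree_C, zero_add]
    exact hc l le_rfl
  · rcases hl with hl | hl
    · refine (totalDegree_mul _ _).trans ?_
      have : (C γ * X j : MvPolynomial (Fin m) ℂ).totalDegree ≤ 1 :=
        (totalDegree_mul _ _).trans (by rw [totalDegree_C, totalDegree_X])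
      omega
    · rw [hl, mul_zero, totalDegree_zero]
      exact Nat.zero_le _

/-- Below the resonance `c_l` has leading form a nonzero multiple of `X_j ^ l`. -/
lemma frobPoly_lead (hG : ∀ i, (G i).totalDegree ≤ 1) (hG1 : G 1 = C β + C γ * X j) (hγ : γ ≠ 0)
    (n l : ℕ) (hl : l < n) : (frobPoly G (-n) l).totalDegree ≤ l ∧ ∃ α : ℂ, α ≠ 0 ∧
      ((frobPoly G (-n) l - C α * X j ^ l).totalDegree + 1 ≤ l ∨
        frobPoly G (-n) l - C α * X j ^ l = 0) := by
  induction l using Nat.strong_induction_on with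
  | _ l ih =>
  rcases l with _ | l
  · refine ⟨by simp [frobPoly], 1, one_ne_zero, Or.inr (by simp [frobPoly])⟩
  · obtain ⟨-, α, hα, hlead⟩ := ih l l.lt_succ_self (by omega)
    have h1 := totalDegree_sum_sub_le hG hG1 (c := frobPoly G (-n))
      (fun i hi => (ih i (by omega) (by omega)).1) hlead
    have hd : (((l : ℂ) + 1) * (l + 1 + ((-n : ℤ) : ℂ))) ≠ 0 := by
      have : ((l + 1 : ℤ) * (l + 1 + -n)) ≠ 0 := mul_ne_zero (by omega) (by omega)
      exact_mod_cast this
    set δ : ℂ := (((l : ℂ) + 1) * (l + 1 + ((-n : ℤ) : ℂ)))⁻¹ with hδ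
    have h2 : (frobPoly G (-n) (l + 1) - C (δ * (γ * α)) * X j ^ (l + 1)).totalDegree ≤ l := by
      rw [frobPoly_succ, ← hδ, C_mul (a := δ), mul_assoc (C δ), ← mul_sub]
      exact (totalDegree_mul _ _).trans (by rw [totalDegree_C, zero_add]; exact h1)
    refine ⟨?_, δ * (γ * α), mul_ne_zero (inv_ne_zero hd) (mul_ne_zero hγ hα),
      Or.inl (by omega)⟩
    rw [← sub_add_cancel (frobPoly G (-n) (l + 1)) (C (δ * (γ * α)) * X j ^ (l + 1))]
    refine (totalDegree_add _ _).trans (max_le (by omega) ((totalDegree_mul _ _).trans ?_))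
    rw [totalDegree_C, totalDegree_X_pow, zero_add]

/-- If the `g_i` are affine functions of parameters and `g_1` involves only `b_j`, the obstruction
is a polynomial with leading form a nonzero multiple of `b_j ^ n`: a product `g_{i_1} ⋯ g_{i_r}` with
`i_1 + ⋯ + i_r = n` has degree `n` only if all indices are `1`. -/
lemma exists_obstruction_polynomial (hG : ∀ i, (G i).totalDegree ≤ 1)
    (hG1 : G 1 = C β + C γ * X j) (hγ : γ ≠ 0) {n : ℕ} (hn : 0 < n) :
    ∃ (P : MvPolynomial (Fin m) ℂ) (α : ℂ), α ≠ 0 ∧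
      (P - C α * X j ^ n).totalDegree < n ∧
      ∀ b, eval b P = obstruction (fun i => eval b (G i)) n := by
  obtain ⟨l, rfl⟩ : ∃ l, n = l + 1 := ⟨n - 1, by omega⟩
  obtain ⟨-, α, hα, hlead⟩ := frobPoly_lead hG hG1 hγ (l + 1) l l.lt_succ_self
  refine ⟨∑ i ∈ Finset.range (l + 1), G (l + 1 - i) * frobPoly G (-((l + 1 : ℕ) : ℤ)) i, γ * α,
    mul_ne_zero hγ hα, ?_, ?_⟩
  · exact Nat.lt_succ_of_le (totalDegree_sum_sub_le hG hG1
      (fun i hi => (frobPoly_lead hG hG1 hγ (l + 1) i (by omega)).1) hlead)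
  · intro b
    simp only [obstruction, map_sum, map_mul, eval_frobPoly]

end ObstructionPolynomial

/-! ### Level one modular forms -/

open ModularForm
open scoped Manifold

/-- The automorphy factor `c z + d` of `γ = (a, b; c, d)`. -/
def autFactor (γ : SL(2, ℤ)) (z : ℂ) : ℂ := ((γ 1 0 : ℤ) : ℂ) * z + ((γ 1 1 : ℤ) : ℂ)

/-- The transformation law of weight `k` under `SL(2, ℤ)`. -/
def Transforms (k : ℤ) (f : ℍ → ℂ) : Prop :=
  ∀ (γ : SL(2, ℤ)) (z : ℍ), f (γ • z) = autFactor γ z ^ k * f z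

lemma autFactor_eq_denom (γ : SL(2, ℤ)) (z : ℍ) :
    autFactor γ z = denom (Matrix.SpecialLinearGroup.toGL
      ((Matrix.SpecialLinearGroup.map (Int.castRingHom ℝ)) γ)) (z : ℂ) :=
  (ModularGroup.denom_apply γ z).symm

lemma autFactor_ne_zero (γ : SL(2, ℤ)) (z : ℍ) : autFactor γ z ≠ 0 := by
  rw [autFactor_eq_denom]
  exact denom_ne_zero _ z

lemma transforms_iff_slash {k : ℤ} {f : ℍ → ℂ} :
    Transforms k f ↔ ∀ γ : SL(2, ℤ), f ∣[k] γ = f := by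
  refine forall_congr' fun γ => ?_
  rw [funext_iff]
  refine forall_congr' fun z => ?_
  rw [SL_slash_apply, ← autFactor_eq_denom, zpow_neg, ← div_eq_mul_inv,
    div_eq_iff (zpow_ne_zero _ (autFactor_ne_zero γ z)), mul_comm (f z)]

lemma transforms_modularForm {k : ℤ} (f : ModularForm 𝒮ℒ k) : Transforms k f :=
  transforms_iff_slash.2 fun γ => f.slash_action_eq' _ ⟨γ, rfl⟩

lemma transforms_discriminant : Transforms 12 discriminant :=
  transforms_iff_slash.2 fun γ => CuspForm.discriminant.slash_action_eq' _ ⟨γ, rfl⟩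

namespace Transforms

variable {k l : ℤ} {f g : ℍ → ℂ}

lemma mul (hf : Transforms k f) (hg : Transforms l g) :
    Transforms (k + l) (fun z => f z * g z) := fun γ z => by
  simp only [hf γ z, hg γ z, zpow_add₀ (autFactor_ne_zero γ z)]
  ring

lemma add (hf : Transforms k f) (hg : Transforms k g) : Transforms k (fun z => f z + g z) :=
  fun γ z => by simp only [hf γ z, hg γ z]; ring

lemma sub (hf : Transforms k f) (hg : Transforms k g) : Transforms k (fun z => f z - g z) :=
  fun γ z => by simp only [hf γ z, hg γ z]; ring

lemma const_mul (c : ℂ) (hf : Transforms k f) : Transforms k (fun z => c * f z) :=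
  fun γ z => by simp only [hf γ z]; ring

lemma div (hf : Transforms k f) (hg : Transforms l g) :
    Transforms (k - l) (fun z => f z / g z) := fun γ z => by
  simp only [hf γ z, hg γ z, zpow_sub₀ (autFactor_ne_zero γ z)]
  exact mul_div_mul_comm ..

lemma pow (hf : Transforms k f) (n : ℕ) : Transforms (k * n) (fun z => f z ^ n) := fun γ z => by
  simp only [hf γ z, mul_pow, zpow_mul, zpow_natCast]

lemma cast (hf : Transforms k f) (h : k = l) : Transforms l f := h ▸ hf

end Transforms

/-- A holomorphic function with the transformation law of weight `k` that vanishes at the cusp is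
a cusp form. -/
lemma Transforms.exists_cuspForm {k : ℤ} {f : ℍ → ℂ} (hf : Transforms k f) (hd : MDiff f)
    (h0 : Tendsto f atImInfty (𝓝 0)) : ∃ g : CuspForm 𝒮ℒ k, ⇑g = f := by
  rw [transforms_iff_slash] at hf
  refine ⟨⟨⟨f, ?_⟩, hd, ?_⟩, rfl⟩
  · rintro _ ⟨γ, rfl⟩
    exact hf γ
  · intro c hc
    rw [Subgroup.IsArithmetic.isCusp_iff_isCusp_SL2Z] at hc
    rw [OnePoint.isZeroAt_iff_forall_SL2Z hc]
    intro γ _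
    rw [hf γ]
    exact h0

lemma mdiff_iff_analyticAt {f : ℍ → ℂ} : MDiff f ↔ ∀ z : ℍ, AnalyticAt ℂ (ext f) z := by
  rw [UpperHalfPlane.mdifferentiable_iff]
  constructor
  · exact fun h z => h.analyticAt (isOpen_upperHalfPlaneSet.mem_nhds z.im_pos)
  · exact fun h z hz => (h ⟨z, hz⟩).differentiableAt.differentiableWithinAt

@[simp] lemma ext_coe (f : ℍ → ℂ) (z : ℍ) : ext f z = f z := by simp [ext]

lemma analyticAt_modularForm {k : ℤ} (f : ModularForm 𝒮ℒ k) (z : ℍ) : AnalyticAt ℂ (ext f) z :=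
  mdiff_iff_analyticAt.1 f.holo' z

lemma analyticAt_discriminant (z : ℍ) : AnalyticAt ℂ (ext discriminant) z :=
  mdiff_iff_analyticAt.1 CuspForm.discriminant.holo' z

/-- There are no cusp forms of weight `14` and level one. -/
lemma Transforms.eq_zero_of_weight_fourteen {f : ℍ → ℂ} (hf : Transforms 14 f) (hd : MDiff f)
    (h0 : Tendsto f atImInfty (𝓝 0)) : f = 0 := by
  obtain ⟨g, rfl⟩ := hf.exists_cuspForm hd h0
  have h2 : CuspForm.discriminantEquiv g = 0 :=
    rank_zero_iff_forall_zero.1 levelOne_weight_two_rank_zero _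
  rw [(LinearEquiv.map_eq_zero_iff _).1 h2]
  rfl

/-- The variable `q = exp (2 π i z)` at the cusp. -/
def qVar (z : ℂ) : ℂ := Complex.exp (2 * Real.pi * Complex.I * z)

lemma qParam_one (z : ℂ) : Function.Periodic.qParam 1 z = qVar z := by
  simp [Function.Periodic.qParam, qVar]

lemma tendsto_qVar : Tendsto (fun z : ℍ => qVar z) atImInfty (𝓝 0) := by
  simpa only [qParam_one] using qParam_tendsto_atImInfty one_pos

lemma hasDerivAt_qVar (z : ℂ) : HasDerivAt qVar (2 * Real.pi * Complex.I * qVar z) z := by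
  have := ((hasDerivAt_id z).const_mul (2 * Real.pi * Complex.I)).cexp
  rw [mul_one, mul_comm (Complex.exp _)] at this
  exact this

lemma cuspFunction_qVar {k : ℤ} {F : Type*} [FunLike F ℍ ℂ] [ModularFormClass F 𝒮ℒ k]
    (f : F) (z : ℍ) : cuspFunction 1 f (qVar z) = f z := by
  rw [← qParam_one]
  exact SlashInvariantFormClass.eq_cuspFunction (k := k) f z one_mem_strictPeriods_SL one_ne_zero

lemma analyticAt_cuspFunction {k : ℤ} {F : Type*} [FunLike F ℍ ℂ] [ModularFormClass F 𝒮ℒ k]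
    (f : F) : AnalyticAt ℂ (cuspFunction 1 f) 0 :=
  ModularFormClass.analyticAt_cuspFunction_zero (k := k) f one_pos one_mem_strictPeriods_SL

lemma tendsto_modularForm {k : ℤ} (f : ModularForm 𝒮ℒ k) :
    Tendsto f atImInfty (𝓝 (cuspFunction 1 f 0)) := by
  have := (analyticAt_cuspFunction f).continuousAt.tendsto.comp tendsto_qVar
  refine this.congr fun z => cuspFunction_qVar f z

/-- The derivative of a modular form is `2 π i q F'(q)` in terms of its expansion `F` at the
cusp. -/
lemma eventually_deriv_ext_modularForm {k : ℤ} (f : ModularForm 𝒮ℒ k) :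
    ∀ᶠ z : ℍ in atImInfty, deriv (ext f) z =
    deriv (cuspFunction 1 f) (qVar z) * (2 * Real.pi * Complex.I * qVar z) := by
  have h := tendsto_qVar.eventually (analyticAt_cuspFunction f).eventually_analyticAt
  filter_upwards [h] with z hz
  have h1 : HasDerivAt (fun w => cuspFunction 1 f (qVar w)) _ (z : ℂ) :=
    hz.differentiableAt.hasDerivAt.comp (z : ℂ) (hasDerivAt_qVar z)
  refine (h1.congr_of_eventuallyEq ?_).deriv
  filter_upwards [isOpen_upperHalfPlaneSet.mem_nhds z.im_pos] with w hw
  have := cuspFunction_qVar f ⟨w, hw⟩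
  rw [show qVar w = qVar ((⟨w, hw⟩ : ℍ) : ℂ) from rfl, this]
  simp [ext, ofComplex_apply_of_im_pos hw]

lemma tendsto_deriv_modularForm {k : ℤ} (f : ModularForm 𝒮ℒ k) :
    Tendsto (fun z : ℍ => deriv (ext f) z) atImInfty (𝓝 0) := by
  refine Tendsto.congr' (EventuallyEq.symm (eventually_deriv_ext_modularForm f)) ?_
  have h1 := (analyticAt_cuspFunction f).deriv.continuousAt.tendsto.comp tendsto_qVar
  have h2 := h1.mul (tendsto_qVar.const_mul (2 * Real.pi * Complex.I))
  simpa using h2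

lemma cuspFunction_E₄_zero : cuspFunction 1 E₄ 0 = 1 := by
  have h := EisensteinSeries.E_qExpansion_coeff_zero (k := 4) (by norm_num) ⟨2, rfl⟩
  rwa [qExpansion_coeff, Nat.factorial_zero, Nat.cast_one, inv_one, iteratedDeriv_zero, one_mul]
    at h

lemma cuspFunction_E₆_zero : cuspFunction 1 E₆ 0 = 1 := by
  have h := EisensteinSeries.E_qExpansion_coeff_zero (k := 6) (by norm_num) ⟨3, rfl⟩
  rwa [qExpansion_coeff, Nat.factorial_zero, Nat.cast_one, inv_one, iteratedDeriv_zero, one_mul]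
    at h

lemma tendsto_E₄ : Tendsto E₄ atImInfty (𝓝 1) := by
  simpa [cuspFunction_E₄_zero] using tendsto_modularForm E₄

lemma tendsto_E₆ : Tendsto E₆ atImInfty (𝓝 1) := by
  simpa [cuspFunction_E₆_zero] using tendsto_modularForm E₆

lemma tendsto_discriminant : Tendsto discriminant atImInfty (𝓝 0) := discriminant_isZeroAtImInfty

lemma discriminant_eq (z : ℍ) : discriminant z = (E₄ z ^ 3 - E₆ z ^ 2) / 1728 :=
  discriminant_eq_E₄_cube_sub_E₆_sq z

/-! ### The Wronskian of the Eisenstein series -/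

/-- The Rankin–Cohen bracket `2 E₄ E₆' - 3 E₆ E₄'`, which has weight `12`. -/
def bracket (z : ℍ) : ℂ := 2 * E₄ z * deriv (ext E₆) z - 3 * E₆ z * deriv (ext E₄) z

lemma bracket_eq_serreDerivative (z : ℍ) : bracket z = 2 * Real.pi * Complex.I *
    (2 * (E₄ z * Derivative.serreDerivative (6 : ℤ) E₆ z) -
      3 * (E₆ z * Derivative.serreDerivative (4 : ℤ) E₄ z)) := by
  have := Complex.two_pi_I_ne_zero
  simp only [bracket, Derivative.serreDerivative_apply, Derivative.normalizedDerivOfComplex]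
  push_cast
  field_simp
  ring

lemma transforms_bracket : Transforms 12 bracket := by
  have h6 : Transforms (6 + 2) (Derivative.serreDerivative (6 : ℤ) E₆) :=
    transforms_iff_slash.2 fun γ => Derivative.serreDerivative_slash_invariant E₆.holo'
      (transforms_iff_slash.1 (transforms_modularForm E₆) γ)
  have h4 : Transforms (4 + 2) (Derivative.serreDerivative (4 : ℤ) E₄) :=
    transforms_iff_slash.2 fun γ => Derivative.serreDerivative_slash_invariant E₄.holo'
      (transforms_iff_slash.1 (transforms_modularForm E₄) γ)
  have := ((((((transforms_modularForm E₄).mul h6).cast (by norm_num : _ = (12 : ℤ))).const_mul 2).sub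
    ((((transforms_modularForm E₆).mul h4).cast
      (by norm_num : _ = (12 : ℤ))).const_mul 3))).const_mul (2 * Real.pi * Complex.I)
  exact fun γ z => by simpa only [bracket_eq_serreDerivative] using this γ z

lemma eventuallyEq_ext_coe (z : ℍ) : ∀ᶠ w in 𝓝 (z : ℂ), ((ofComplex w : ℍ) : ℂ) = w :=
  eventuallyEq_coe_comp_ofComplex z.im_pos

lemma analyticAt_bracket (z : ℍ) : AnalyticAt ℂ (ext bracket) z := by
  have h4 := analyticAt_modularForm E₄ z
  have h6 := analyticAt_modularForm E₆ z
  have h : AnalyticAt ℂ (fun w => 2 * ext E₄ w * deriv (ext E₆) w -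
      3 * ext E₆ w * deriv (ext E₄) w) z :=
    ((analyticAt_const.mul h4).mul h6.deriv).sub ((analyticAt_const.mul h6).mul h4.deriv)
  refine h.congr ?_
  filter_upwards [eventuallyEq_ext_coe z] with w hw
  simp only [ext, Function.comp_apply, bracket, hw]

lemma tendsto_bracket : Tendsto bracket atImInfty (𝓝 0) := by
  have h := ((tendsto_E₄.const_mul 2).mul (tendsto_deriv_modularForm E₆)).sub
    ((tendsto_E₆.const_mul 3).mul (tendsto_deriv_modularForm E₄))
  simp only [mul_zero, sub_zero] at h
  exact h

lemma exists_bracket_eq : ∃ c : ℂ, ∀ z, bracket z = c * discriminant z := by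
  obtain ⟨g, hg⟩ := transforms_bracket.exists_cuspForm
    (mdiff_iff_analyticAt.2 analyticAt_bracket) tendsto_bracket
  obtain ⟨c, hc⟩ := CuspForm.exists_smul_discriminant_of_weight_eq_twelve g
  refine ⟨c, fun z => ?_⟩
  rw [← hg, ← hc]
  rfl

/-- The modular function `J = E₄³ / Δ`. -/
def jFun (z : ℍ) : ℂ := E₄ z ^ 3 / discriminant z

lemma analyticAt_jFun (z : ℍ) : AnalyticAt ℂ (ext jFun) z :=
  ((analyticAt_modularForm E₄ z).pow 3).div (analyticAt_discriminant z)
    (by simpa using discriminant_ne_zero z)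

lemma ext_discriminant_eq (w : ℂ) :
    ext discriminant w = (ext E₄ w ^ 3 - ext E₆ w ^ 2) / 1728 := discriminant_eq _

lemma deriv_ext_discriminant (z : ℍ) : deriv (ext discriminant) z =
    (3 * E₄ z ^ 2 * deriv (ext E₄) z - 2 * E₆ z * deriv (ext E₆) z) / 1728 := by
  have h4 := (analyticAt_modularForm E₄ z).differentiableAt.hasDerivAt
  have h6 := (analyticAt_modularForm E₆ z).differentiableAt.hasDerivAt
  have h := ((h4.pow 3).sub (h6.pow 2)).div_const 1728
  rw [show ext discriminant = _ from funext ext_discriminant_eq]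
  refine (h.congr_deriv ?_).deriv
  simp

/-- The derivative of `J` is `E₄² E₆` times the bracket, divided by `1728 Δ²`. -/
lemma hasDerivAt_jFun (z : ℍ) : HasDerivAt (ext jFun)
    (E₄ z ^ 2 * E₆ z * bracket z / (1728 * discriminant z ^ 2)) z := by
  have h4 := (analyticAt_modularForm E₄ z).differentiableAt.hasDerivAt
  have hΔ := (analyticAt_discriminant z).differentiableAt.hasDerivAt
  have hne : ext discriminant z ≠ 0 := by simpa using discriminant_ne_zero z
  have h := (h4.pow 3).div hΔ hne
  refine h.congr_deriv ?_
  rw [deriv_ext_discriminant]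
  have h0 := discriminant_ne_zero z
  simp only [ext_coe]
  simp only [Pi.pow_apply, ext_coe]
  rw [div_eq_div_iff (pow_ne_zero _ h0) (mul_ne_zero (by norm_num) (pow_ne_zero _ h0)), bracket]
  rw [show (discriminant z) = _ from discriminant_eq z]
  push_cast
  ring

lemma bracket_ne_zero (z : ℍ) : bracket z ≠ 0 := by
  obtain ⟨c, hc⟩ := exists_bracket_eq
  rw [hc]
  refine mul_ne_zero ?_ (discriminant_ne_zero z)
  rintro rfl
  -- if the bracket vanished identically, `J` would be constant, whereas `J` has a pole at the cusp
  have hderiv : ∀ w ∈ upperHalfPlaneSet, deriv (ext jFun) w = 0 := by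
    intro w hw
    rw [show w = ((⟨w, hw⟩ : ℍ) : ℂ) from rfl, (hasDerivAt_jFun _).deriv, hc]
    simp
  have hconst : ∀ w : ℍ, jFun w = jFun z := by
    intro w
    have hcv : Convex ℝ upperHalfPlaneSet := convex_halfSpace_im_gt 0
    have := isOpen_upperHalfPlaneSet.is_const_of_deriv_eq_zero hcv.isPreconnected
      (fun v hv => (analyticAt_jFun ⟨v, hv⟩).differentiableAt.differentiableWithinAt)
      hderiv w.im_pos z.im_pos
    simpa using this
  have h1 : Tendsto (fun w : ℍ => E₄ w ^ 3) atImInfty (𝓝 0) := by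
    have h := tendsto_discriminant.const_mul (jFun z)
    rw [mul_zero] at h
    refine h.congr fun w => ?_
    rw [← hconst w, jFun, div_mul_cancel₀ _ (discriminant_ne_zero w)]
  have h2 := tendsto_E₄.pow 3
  rw [one_pow] at h2
  exact zero_ne_one (tendsto_nhds_unique h1 h2)

lemma deriv_E₄_ne_zero {z : ℍ} (h : E₄ z = 0) : deriv (ext E₄) z ≠ 0 := by
  intro h'
  apply bracket_ne_zero z
  rw [bracket, h, h']
  ring

lemma deriv_E₆_ne_zero {z : ℍ} (h : E₆ z = 0) : deriv (ext E₆) z ≠ 0 := by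
  intro h'
  apply bracket_ne_zero z
  rw [bracket, h, h']
  ring

lemma E₆_ne_zero_of_E₄_eq_zero {z : ℍ} (h : E₄ z = 0) : E₆ z ≠ 0 := by
  intro h'
  apply bracket_ne_zero z
  rw [bracket, h, h']
  ring

lemma deriv_jFun_ne_zero {z : ℍ} (h4 : E₄ z ≠ 0) (h6 : E₆ z ≠ 0) : deriv (ext jFun) z ≠ 0 := by
  rw [(hasDerivAt_jFun z).deriv]
  exact div_ne_zero (mul_ne_zero (mul_ne_zero (pow_ne_zero _ h4) h6)
    (bracket_ne_zero z)) (mul_ne_zero (by norm_num) (pow_ne_zero _ (discriminant_ne_zero z)))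

/-! ### Injectivity of the modular function on orbits -/

lemma Equivalent.refl (z : ℍ) : Equivalent z z := ⟨1, one_smul _ _⟩

lemma Equivalent.symm {z w : ℍ} : Equivalent z w → Equivalent w z := by
  rintro ⟨γ, rfl⟩
  exact ⟨γ⁻¹, inv_smul_smul _ _⟩

lemma Equivalent.trans {z w v : ℍ} : Equivalent z w → Equivalent w v → Equivalent z v := by
  rintro ⟨γ, rfl⟩ ⟨δ, rfl⟩
  exact ⟨δ * γ, mul_smul _ _ _⟩

lemma Transforms.eq_of_equivalent {f : ℍ → ℂ} (hf : Transforms 0 f) {z w : ℍ}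
    (h : Equivalent z w) : f w = f z := by
  obtain ⟨γ, rfl⟩ := h
  simpa using hf γ z

lemma Transforms.eq_zero_iff_of_equivalent {k : ℤ} {f : ℍ → ℂ} (hf : Transforms k f) {z w : ℍ}
    (h : Equivalent z w) : f w = 0 ↔ f z = 0 := by
  obtain ⟨γ, rfl⟩ := h
  rw [hf γ z, mul_eq_zero, or_iff_right (zpow_ne_zero _ (autFactor_ne_zero γ z))]

lemma transforms_jFun : Transforms 0 jFun :=
  (((transforms_modularForm E₄).pow 3).div transforms_discriminant).cast (by norm_num)

lemma jFun_eq_zero_iff {z : ℍ} : jFun z = 0 ↔ E₄ z = 0 := by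
  simp [jFun, discriminant_ne_zero]

lemma jFun_eq_1728_iff {z : ℍ} : jFun z = 1728 ↔ E₆ z = 0 := by
  rw [jFun, div_eq_iff (discriminant_ne_zero z), discriminant_eq]
  constructor
  · intro h
    have : E₆ z ^ 2 = 0 := by linear_combination h
    simpa using this
  · intro h
    rw [h]
    ring

lemma isClosed_equivalent : IsClosed {x : ℍ × ℍ | Equivalent x.1 x.2} := by
  have : T2Space (Quotient (MulAction.orbitRel 𝒮ℒ ℍ)) :=
    t2Space_of_properlyDiscontinuousSMul_of_t2Space
  have hc : Continuous (Quotient.mk (MulAction.orbitRel 𝒮ℒ ℍ)) := continuous_quotient_mk'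
  have := isClosed_eq (hc.comp (continuous_fst (X := ℍ) (Y := ℍ)))
    (hc.comp (continuous_snd (X := ℍ) (Y := ℍ)))
  convert! this using 1
  ext ⟨z, w⟩
  simp only [Set.mem_ofPred_eq, Function.comp_apply]
  rw [Quotient.eq, MulAction.orbitRel_apply, MulAction.mem_orbit_iff]
  constructor
  · intro h
    obtain ⟨γ, hγ⟩ := h.symm
    exact ⟨⟨_, γ, rfl⟩, hγ⟩
  · rintro ⟨⟨_, γ, rfl⟩, hγ⟩
    exact Equivalent.symm ⟨γ, hγ⟩

lemma continuous_jFun : Continuous jFun :=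
  continuous_iff_continuousAt.2 fun z => by
    have h := (analyticAt_jFun z).continuousAt.comp (f := UpperHalfPlane.coe) (x := z)
      UpperHalfPlane.continuous_coe.continuousAt
    have h2 : ext jFun ∘ UpperHalfPlane.coe = jFun := funext fun w => ext_coe jFun w
    rwa [h2] at h

/-- The zeros of `E₄` and of `E₆` are isolated. -/
lemma eventually_ne_zero_E₄_E₆ (z : ℍ) :
    ∀ᶠ w in 𝓝[≠] (z : ℂ), ext E₄ w ≠ 0 ∧ ext E₆ w ≠ 0 := by
  refine Eventually.and ?_ ?_
  · by_cases h : E₄ z = 0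
    · exact (analyticAt_modularForm E₄ z).differentiableAt.hasDerivAt.eventually_ne
        (deriv_E₄_ne_zero h)
    · refine ((analyticAt_modularForm E₄ z).continuousAt.eventually_ne ?_).filter_mono
        nhdsWithin_le_nhds
      simpa using h
  · by_cases h : E₆ z = 0
    · exact (analyticAt_modularForm E₆ z).differentiableAt.hasDerivAt.eventually_ne
        (deriv_E₆_ne_zero h)
    · refine ((analyticAt_modularForm E₆ z).continuousAt.eventually_ne ?_).filter_mono
        nhdsWithin_le_nhds
      simpa using h

lemma nhds_jFun_le_map (z : ℍ) : 𝓝 (jFun z) ≤ map jFun (𝓝 z) := by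
  rcases (analyticAt_jFun z).eventually_constant_or_nhds_le_map_nhds with h | h
  · -- a locally constant `J` would have a vanishing derivative
    exfalso
    have h1 := h.eventually_nhds.filter_mono (nhdsWithin_le_nhds (s := {(z : ℂ)}ᶜ))
    have h2 : ∀ᶠ w in 𝓝[≠] (z : ℂ), 0 < w.im :=
      nhdsWithin_le_nhds (isOpen_upperHalfPlaneSet.mem_nhds z.im_pos)
    obtain ⟨w, hw1, hw2, hw4, hw6⟩ := (h1.and (h2.and (eventually_ne_zero_E₄_E₆ z))).exists
    rw [show w = ((⟨w, hw2⟩ : ℍ) : ℂ) from rfl, ext_coe] at hw4 hw6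
    apply deriv_jFun_ne_zero hw4 hw6
    have : ext jFun =ᶠ[𝓝 w] fun _ => ext jFun z := hw1
    rw [show ((⟨w, hw2⟩ : ℍ) : ℂ) = w from rfl, this.deriv_eq, deriv_const]
  · rw [← isOpenEmbedding_coe.map_nhds_eq, map_map, ext_coe] at h
    have h2 : ext jFun ∘ UpperHalfPlane.coe = jFun := funext fun w => ext_coe jFun w
    rwa [h2] at h

/-- `J` is locally injective away from the zeros of `E₄` and `E₆`. -/
lemma exists_injOn_jFun {z : ℍ} (h4 : E₄ z ≠ 0) (h6 : E₆ z ≠ 0) :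
    ∃ s ∈ 𝓝 z, Set.InjOn jFun s := by
  have hs : HasStrictDerivAt (ext jFun) (deriv (ext jFun) z) z :=
    (analyticAt_jFun z).hasStrictDerivAt
  have hl := hs.eventually_left_inverse (deriv_jFun_ne_zero h4 h6)
  have hl' := UpperHalfPlane.continuous_coe.continuousAt.eventually hl
  refine ⟨_, hl', fun u hu v hv huv => ?_⟩
  apply UpperHalfPlane.ext
  have hu' : _ = (u : ℂ) := hu
  have hv' : _ = (v : ℂ) := hv
  rw [ext_coe] at hu' hv'
  rw [← hu', ← hv', huv]

lemma cuspFunction_discriminant_zero : cuspFunction 1 discriminant 0 = 0 := by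
  rw [← CuspForm.coe_discriminant]
  exact CuspFormClass.cuspFunction_apply_zero CuspForm.discriminant one_pos one_mem_strictPeriods_SL

lemma deriv_cuspFunction_discriminant : deriv (cuspFunction 1 discriminant) 0 = 1 := by
  have h := discriminant_qExpansion_coeff_one
  rwa [qExpansion_coeff, Nat.factorial_one, Nat.cast_one, inv_one, iteratedDeriv_one, one_mul] at h

lemma cuspFunction_discriminant_qVar (z : ℍ) :
    cuspFunction 1 discriminant (qVar z) = discriminant z := by
  rw [← CuspForm.coe_discriminant]
  exact cuspFunction_qVar CuspForm.discriminant z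

/-- The variable `q` separates the orbits of translations. -/
lemma equivalent_of_qVar_eq {z w : ℍ} (h : qVar z = qVar w) : Equivalent w z := by
  obtain ⟨n, hn⟩ := Complex.exp_eq_exp_iff_exists_int.1 h
  refine ⟨ModularGroup.T ^ n, UpperHalfPlane.ext ?_⟩
  rw [ModularGroup.coe_T_zpow_smul_eq]
  have h0 := Complex.two_pi_I_ne_zero
  have : 2 * Real.pi * Complex.I * (z : ℂ) = 2 * Real.pi * Complex.I * (w + n) := by
    rw [hn]; ring
  exact (mul_left_cancel₀ h0 this).symm

lemma exists_equivalent_mem_fd (z : ℍ) : ∃ w ∈ ModularGroup.fd, Equivalent z w := by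
  obtain ⟨γ, h⟩ := ModularGroup.exists_smul_mem_fd z
  exact ⟨_, h, γ, rfl⟩

lemma tendsto_norm_jFun : Tendsto (fun z => ‖jFun z‖) atImInfty atTop := by
  have h : Tendsto (fun z => discriminant z / E₄ z ^ 3) atImInfty (𝓝 (0 / 1 ^ 3)) :=
    tendsto_discriminant.div (tendsto_E₄.pow 3) (by norm_num)
  rw [zero_div] at h
  have hne : ∀ᶠ z in atImInfty, E₄ z ≠ 0 := tendsto_E₄.eventually_ne one_ne_zero
  have h2 : Tendsto (fun z => discriminant z / E₄ z ^ 3) atImInfty (𝓝[≠] 0) :=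
    tendsto_nhdsWithin_iff.2 ⟨h, hne.mono fun z hz =>
      div_ne_zero (discriminant_ne_zero z) (pow_ne_zero _ hz)⟩
  have h3 := (tendsto_norm_inv_nhdsNE_zero_atTop (α := ℂ)).comp h2
  refine h3.congr fun z => ?_
  simp [jFun]

/-- Far up in the upper half-plane `J` separates orbits, because `1 / J` is a local coordinate at
the cusp. -/
lemma eventually_equivalent_of_jFun_eq : ∃ Y : ℝ, ∀ z w : ℍ, Y ≤ z.im → Y ≤ w.im →
    jFun z = jFun w → Equivalent z w := by
  let Φ : ℂ → ℂ := fun q => cuspFunction 1 discriminant q / cuspFunction 1 E₄ q ^ 3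
  have hΔ : AnalyticAt ℂ (cuspFunction 1 discriminant) 0 := by
    rw [← CuspForm.coe_discriminant]
    exact analyticAt_cuspFunction CuspForm.discriminant
  have h4 : AnalyticAt ℂ (cuspFunction 1 E₄) 0 := analyticAt_cuspFunction E₄
  have h40 : cuspFunction 1 E₄ 0 ^ 3 ≠ 0 := by rw [cuspFunction_E₄_zero]; norm_num
  have hΦ : AnalyticAt ℂ Φ 0 := hΔ.div (h4.pow 3) h40
  have hderiv : deriv Φ 0 = 1 := by
    have h := hΔ.differentiableAt.hasDerivAt.div (h4.differentiableAt.hasDerivAt.pow 3) h40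
    rw [show deriv Φ 0 = _ from h.deriv, cuspFunction_discriminant_zero,
      deriv_cuspFunction_discriminant]
    simp [cuspFunction_E₄_zero]
  have hl := hΦ.hasStrictDerivAt.eventually_left_inverse (by rw [hderiv]; exact one_ne_zero)
  have hl' := tendsto_qVar.eventually hl
  rw [UpperHalfPlane.atImInfty, eventually_comap, eventually_atTop] at hl'
  obtain ⟨Y, hY⟩ := hl'
  refine ⟨Y, fun z w hz hw h => ?_⟩
  have hΦz : ∀ z : ℍ, Φ (qVar z) = (jFun z)⁻¹ := fun z => by
    simp only [Φ]
    rw [cuspFunction_discriminant_qVar, cuspFunction_qVar, jFun, inv_div]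
  have h1 := hY _ hz z rfl
  have h2 := hY _ hw w rfl
  rw [hΦz] at h1 h2
  rw [← h] at h2
  exact equivalent_of_qVar_eq (h2.symm.trans h1)

/-- The values that `J` takes on two distinct orbits. -/
def doubleValues : Set ℂ := {c | ∃ z w : ℍ, ¬ Equivalent z w ∧ jFun z = c ∧ jFun w = c}

lemma isOpen_doubleValues : IsOpen doubleValues := by
  rw [isOpen_iff_mem_nhds]
  rintro c ⟨z, w, hzw, hz, hw⟩
  have h : ∀ᶠ x : ℍ × ℍ in 𝓝 (z, w), ¬ Equivalent x.1 x.2 :=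
    isClosed_equivalent.isOpen_compl.mem_nhds hzw
  rw [nhds_prod_eq] at h
  obtain ⟨U, hU, V, hV, hUV⟩ := Filter.mem_prod_iff.1 h
  have hU' := nhds_jFun_le_map z (image_mem_map hU)
  have hV' := nhds_jFun_le_map w (image_mem_map hV)
  rw [hz] at hU'
  rw [hw] at hV'
  filter_upwards [hU', hV']
  rintro d ⟨u, hu, rfl⟩ ⟨v, hv, hv'⟩
  exact ⟨u, v, hUV (Set.mk_mem_prod hu hv), rfl, hv'⟩

lemma exists_fd_of_mem_doubleValues {c : ℂ} (hc : c ∈ doubleValues) :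
    ∃ z ∈ ModularGroup.fd, ∃ w ∈ ModularGroup.fd, ¬ Equivalent z w ∧ jFun z = c ∧ jFun w = c := by
  obtain ⟨z, w, h, hz, hw⟩ := hc
  obtain ⟨z', hz', hzz⟩ := exists_equivalent_mem_fd z
  obtain ⟨w', hw', hww⟩ := exists_equivalent_mem_fd w
  refine ⟨z', hz', w', hw', fun h' => h (hzz.trans (h'.trans hww.symm)), ?_, ?_⟩
  · rw [transforms_jFun.eq_of_equivalent hzz, hz]
  · rw [transforms_jFun.eq_of_equivalent hww, hw]

lemma exists_norm_jFun_gt (R : ℝ) : ∃ Y : ℝ, ∀ z : ℍ, Y ≤ z.im → R < ‖jFun z‖ := by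
  have h := tendsto_norm_jFun.eventually (eventually_gt_atTop R)
  rw [UpperHalfPlane.atImInfty, eventually_comap, eventually_atTop] at h
  obtain ⟨Y, hY⟩ := h
  exact ⟨Y, fun z hz => hY _ hz z rfl⟩

/-- The double values accumulate only at double values or at the critical values of `J`. -/
lemma closure_doubleValues_inter_subset :
    closure doubleValues ∩ ({0, 1728} : Set ℂ)ᶜ ⊆ doubleValues := by
  rintro c ⟨hc, hc'⟩
  obtain ⟨u, hu, huc⟩ := mem_closure_iff_seq_limit.1 hc
  choose z hz w hw hzw hzu hwu using fun n => exists_fd_of_mem_doubleValues (hu n)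
  obtain ⟨Y, hY⟩ := exists_norm_jFun_gt (‖c‖ + 1)
  have hev : ∀ᶠ n in atTop, ‖u n‖ < ‖c‖ + 1 :=
    huc.norm.eventually (gt_mem_nhds (lt_add_one _))
  have hK : IsCompact (ModularGroup.truncatedFundamentalDomain Y ×ˢ
      ModularGroup.truncatedFundamentalDomain Y) :=
    (ModularGroup.isCompact_truncatedFundamentalDomain Y).prod
      (ModularGroup.isCompact_truncatedFundamentalDomain Y)
  have hmem : ∀ᶠ n in atTop, (z n, w n) ∈ ModularGroup.truncatedFundamentalDomain Y ×ˢ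
      ModularGroup.truncatedFundamentalDomain Y := by
    filter_upwards [hev] with n hn
    refine ⟨⟨hz n, ?_⟩, ⟨hw n, ?_⟩⟩
    · by_contra! h
      have := hY _ h.le
      rw [hzu] at this
      exact lt_asymm hn this
    · by_contra! h
      have := hY _ h.le
      rw [hwu] at this
      exact lt_asymm hn this
  obtain ⟨⟨a, b⟩, -, φ, hφ, hlim⟩ := hK.tendsto_subseq' hmem.frequently
  have ha : Tendsto (fun n => z (φ n)) atTop (𝓝 a) := hlim.fst_nhds
  have hb : Tendsto (fun n => w (φ n)) atTop (𝓝 b) := hlim.snd_nhds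
  have hua : Tendsto (fun n => u (φ n)) atTop (𝓝 c) := huc.comp hφ.tendsto_atTop
  have hja : jFun a = c := tendsto_nhds_unique (continuous_jFun.continuousAt.tendsto.comp ha)
    (hua.congr fun n => (hzu _).symm)
  have hjb : jFun b = c := tendsto_nhds_unique (continuous_jFun.continuousAt.tendsto.comp hb)
    (hua.congr fun n => (hwu _).symm)
  refine ⟨a, b, ?_, hja, hjb⟩
  rintro ⟨γ, hγ⟩
  -- otherwise two inequivalent points close to `b` have the same value under `J`
  have h4 : E₄ b ≠ 0 := fun h => hc' (by simp [← hjb, jFun_eq_zero_iff.2 h])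
  have h6 : E₆ b ≠ 0 := fun h => hc' (by simp [← hjb, jFun_eq_1728_iff.2 h])
  obtain ⟨s, hs, hinj⟩ := exists_injOn_jFun h4 h6
  have hγz : Tendsto (fun n => γ • z (φ n)) atTop (𝓝 b) := by
    have hcont : Continuous fun x : ℍ => γ • x := continuous_const_smul
      (Matrix.SpecialLinearGroup.mapGL ℝ γ)
    rw [← hγ]
    exact hcont.continuousAt.tendsto.comp ha
  obtain ⟨n, hn1, hn2⟩ := ((hγz.eventually hs).and (hb.eventually hs)).exists
  refine hzw (φ n) ⟨γ, hinj hn1 hn2 ?_⟩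
  rw [transforms_jFun.eq_of_equivalent ⟨γ, rfl⟩, hzu, hwu]

lemma exists_bound_doubleValues : ∃ R : ℝ, ∀ c ∈ doubleValues, ‖c‖ ≤ R := by
  obtain ⟨Y, hY⟩ := eventually_equivalent_of_jFun_eq
  obtain ⟨R, hR⟩ := (ModularGroup.isCompact_truncatedFundamentalDomain Y).exists_bound_of_continuousOn
    continuous_jFun.continuousOn
  refine ⟨R, fun c hc => ?_⟩
  obtain ⟨z, hz, w, hw, hzw, hzc, hwc⟩ := exists_fd_of_mem_doubleValues hc
  by_contra! h
  refine hzw (hY z w ?_ ?_ (hzc.trans hwc.symm))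
  · by_contra! hlt
    have := hR z ⟨hz, hlt.le⟩
    rw [hzc] at this
    exact not_lt.2 this h
  · by_contra! hlt
    have := hR w ⟨hw, hlt.le⟩
    rw [hwc] at this
    exact not_lt.2 this h

lemma doubleValues_eq_empty : doubleValues = ∅ := by
  have hconn : IsPreconnected ({0, 1728} : Set ℂ)ᶜ :=
    ((Set.toFinite _).countable.isPathConnected_compl_of_one_lt_rank
      (by simp)).isConnected.isPreconnected
  by_contra hne
  obtain ⟨c, hc⟩ := Set.nonempty_iff_ne_empty.2 hne
  -- an open set is not contained in a finite one
  have hinter : (({0, 1728} : Set ℂ)ᶜ ∩ doubleValues).Nonempty := by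
    have h1 : Dense ({0, 1728} : Set ℂ)ᶜ := (Set.toFinite _).countable.dense_compl ℂ
    exact (h1.inter_open_nonempty _ isOpen_doubleValues ⟨c, hc⟩).mono fun x hx => ⟨hx.2, hx.1⟩
  have hsub := hconn.subset_of_closure_inter_subset isOpen_doubleValues hinter
    closure_doubleValues_inter_subset
  obtain ⟨R, hR⟩ := exists_bound_doubleValues
  have hx := hR ((|R| + 1729 : ℝ) : ℂ) (hsub ?_)
  · rw [Complex.norm_real, Real.norm_of_nonneg (by positivity)] at hx
    linarith [le_abs_self R]
  · simp only [Set.mem_compl_iff, Set.mem_insert_iff, Set.mem_singleton_iff, not_or]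
    constructor <;> intro h
    · have : |R| + 1729 = 0 := by exact_mod_cast h
      linarith [abs_nonneg R]
    · have : |R| + 1729 = 1728 := by exact_mod_cast h
      linarith [abs_nonneg R]

/-- `J` separates the orbits of `SL(2, ℤ)`. -/
theorem equivalent_of_jFun_eq {z w : ℍ} (h : jFun z = jFun w) : Equivalent z w := by
  by_contra hzw
  have : jFun w ∈ doubleValues := ⟨z, w, hzw, h, rfl⟩
  rw [doubleValues_eq_empty] at this
  exact this

/-! ### Elliptic points -/

/-- The matrix of `z ↦ (z - 1) / z`, which fixes `ρ`. -/
def rotRho : SL(2, ℤ) := ⟨!![1, -1; 1, 0], by simp [Matrix.det_fin_two_of]⟩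

lemma rho_sq : (rho : ℂ) ^ 2 = rho - 1 := by
  have h3 : Real.sqrt 3 * Real.sqrt 3 = 3 := Real.mul_self_sqrt (by norm_num)
  apply Complex.ext
  · simp [rho, pow_two]; linarith
  · simp [rho, pow_two]; ring

lemma rotRho_smul_rho : rotRho • rho = rho := by
  apply UpperHalfPlane.ext
  rw [coe_specialLinearGroup_apply, div_eq_iff]
  · simp [rotRho]
    linear_combination -rho_sq
  · simpa [rotRho] using rho.ne_zero

lemma E₄_rho : E₄ rho = 0 := by
  have h := transforms_modularForm E₄ rotRho rho
  rw [rotRho_smul_rho] at h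
  have h4 : autFactor rotRho rho ^ (4 : ℤ) = -rho := by
    have : autFactor rotRho rho = rho := by simp [autFactor, rotRho]
    rw [this]
    norm_cast
    linear_combination ((rho : ℂ) ^ 2 + rho) * rho_sq
  rw [h4] at h
  have hne : (1 + rho : ℂ) ≠ 0 := fun h0 => by
    have := congrArg Complex.im h0
    simp [rho] at this
  have : (1 + rho : ℂ) * E₄ rho = 0 := by linear_combination h
  exact (mul_eq_zero.1 this).resolve_left hne

lemma S_smul_I : ModularGroup.S • UpperHalfPlane.I = UpperHalfPlane.I := by
  apply UpperHalfPlane.ext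
  rw [coe_specialLinearGroup_apply]
  simp [ModularGroup.S]

lemma E₆_I : E₆ UpperHalfPlane.I = 0 := by
  have h := transforms_modularForm E₆ ModularGroup.S UpperHalfPlane.I
  rw [S_smul_I] at h
  have h6 : autFactor ModularGroup.S UpperHalfPlane.I ^ (6 : ℤ) = -1 := by
    have : autFactor ModularGroup.S UpperHalfPlane.I = Complex.I := by
      simp [autFactor, ModularGroup.S]
    rw [this]
    norm_cast
    rw [show 6 = 2 * 3 from rfl, pow_mul, Complex.I_sq]
    norm_num
  rw [h6] at h
  linear_combination h / 2

/-- `E₄` vanishes exactly on the orbit of `ρ`. -/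
lemma E₄_eq_zero_iff {z : ℍ} : E₄ z = 0 ↔ Equivalent rho z := by
  constructor
  · intro h
    apply equivalent_of_jFun_eq
    rw [jFun_eq_zero_iff.2 h, jFun_eq_zero_iff.2 E₄_rho]
  · intro h
    exact ((transforms_modularForm E₄).eq_zero_iff_of_equivalent h).2 E₄_rho

/-- `E₆` vanishes exactly on the orbit of `i`. -/
lemma E₆_eq_zero_iff {z : ℍ} : E₆ z = 0 ↔ Equivalent UpperHalfPlane.I z := by
  constructor
  · intro h
    apply equivalent_of_jFun_eq
    rw [jFun_eq_1728_iff.2 h, jFun_eq_1728_iff.2 E₆_I]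
  · intro h
    exact ((transforms_modularForm E₆).eq_zero_iff_of_equivalent h).2 E₆_I

/-! ### Local criteria for apparent singularities -/

section LocalCriteria

variable {f g E : ℂ → ℂ} {p c : ℂ} {n : ℕ}

/-- Removable singularities: a meromorphic function with a limit is holomorphic off the point. -/
lemma exists_analyticAt_of_tendsto (hf : MeromorphicAt f p) (h : Tendsto f (𝓝[≠] p) (𝓝 c)) :
    ∃ g, AnalyticAt ℂ g p ∧ g p = c ∧ f =ᶠ[𝓝[≠] p] g := by
  have hord := (tendsto_nhds_iff_meromorphicOrderAt_nonneg hf).1 ⟨c, h⟩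
  have hg := hf.meromorphicOrderAt_nonneg_iff_analyticAt_toMeromorphicNFAt.1 hord
  refine ⟨toMeromorphicNFAt f p, hg, ?_, hf.eq_nhdsNE_toMeromorphicNFAt⟩
  exact tendsto_nhds_unique (hg.continuousAt.tendsto.mono_left nhdsWithin_le_nhds)
    (h.congr' hf.eq_nhdsNE_toMeromorphicNFAt)

lemma exists_isPotential_of_tendsto (hf : MeromorphicAt f p)
    (h : Tendsto (fun z => (z - p) ^ 2 * f z) (𝓝[≠] p) (𝓝 (((n : ℂ) ^ 2 - 1) / 4))) :
    ∃ E, IsPotential f p n E := by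
  have hm : MeromorphicAt (fun z => (z - p) ^ 2 * f z) p := by fun_prop
  obtain ⟨g, hg, hgp, hfg⟩ := exists_analyticAt_of_tendsto hm h
  refine ⟨fun z => g z - ((n : ℂ) ^ 2 - 1) / 4, by fun_prop, by simp [hgp], ?_⟩
  filter_upwards [hfg] with z hz
  rw [hz]
  ring

lemma IsPotential.tendsto (hE : IsPotential f p n E) :
    Tendsto (fun z => (z - p) ^ 2 * f z) (𝓝[≠] p) (𝓝 (((n : ℂ) ^ 2 - 1) / 4)) := by
  have h := (hE.analyticAt.continuousAt.tendsto.const_add (((n : ℂ) ^ 2 - 1) / 4)).mono_left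
    (nhdsWithin_le_nhds (s := {p}ᶜ))
  rw [hE.zero, add_zero] at h
  exact h.congr' (by filter_upwards [hE.eq] with z hz using hz.symm)

lemma HasLocalExponents.tendsto {κ : ℝ}
    (h : HasLocalExponents f p ((1 / 2 + κ : ℝ) : ℂ) ((1 / 2 - κ : ℝ) : ℂ)) :
    Tendsto (fun z => (z - p) ^ 2 * f z) (𝓝[≠] p) (𝓝 ((κ : ℂ) ^ 2 - 1 / 4)) := by
  obtain ⟨c, hc, hx⟩ := h
  have h0 := hx 0
  push_cast at h0
  rwa [show (κ : ℂ) ^ 2 - 1 / 4 = c by linear_combination h0]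

lemma tendsto_sq_mul_zero (h : Tendsto f (𝓝[≠] p) (𝓝 c)) :
    Tendsto (fun z => (z - p) ^ 2 * f z) (𝓝[≠] p) (𝓝 0) := by
  have h1 : Tendsto (fun z : ℂ => (z - p) ^ 2) (𝓝[≠] p) (𝓝 0) := by
    have : ContinuousAt (fun z : ℂ => (z - p) ^ 2) p := by fun_prop
    simpa using this.tendsto.mono_left nhdsWithin_le_nhds
  simpa using h1.mul h

/-- For exponents `1/2 ± 1/2` the small solution forces `f = h'' / h` to be holomorphic. -/
lemma HasSmallSolution.exists_analyticAt (h : HasSmallSolution f p 1) :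
    ∃ g, AnalyticAt ℂ g p ∧ f =ᶠ[𝓝[≠] p] g := by
  obtain ⟨h, hh, hp, heq⟩ := h
  have hne : ∀ᶠ z in 𝓝 p, h z ≠ 0 := hh.continuousAt.eventually_ne (by rw [hp]; exact one_ne_zero)
  refine ⟨fun z => deriv (deriv h) z / h z, hh.deriv.deriv.fun_div hh (by simp [hp]), ?_⟩
  filter_upwards [heq, nhdsWithin_le_nhds hne, self_mem_nhdsWithin] with z hz hz0 hzp
  have h2 : (z - p) ^ 2 ≠ 0 := pow_ne_zero _ (sub_ne_zero.2 hzp)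
  rw [eq_div_iff hz0]
  apply mul_left_cancel₀ h2
  simp only [FrobEq] at hz
  push_cast at hz
  linear_combination -hz

lemma hasSmallSolution_one_of_analyticAt (hg : AnalyticAt ℂ g p) (hfg : f =ᶠ[𝓝[≠] p] g) :
    HasSmallSolution f p 1 := by
  have hE : IsPotential f p 1 (fun z => (z - p) ^ 2 * g z) := by
    refine ⟨by fun_prop, by simp, ?_⟩
    filter_upwards [hfg] with z hz
    rw [hz]
    norm_num
  rw [hE.hasSmallSolution_iff_obstruction one_pos]
  -- the first Taylor coefficient of `(z - p)² g` vanishes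
  have h1 : AnalyticAt ℂ (fun z : ℂ => (z - p) * g z) p := by fun_prop
  have h2 : AnalyticAt ℂ (fun z : ℂ => z - p) p := by fun_prop
  have h3 : (fun z => (z - p) ^ 2 * g z) = (fun z => z - p) * fun z => (z - p) * g z := by
    ext z
    simp only [Pi.mul_apply]
    ring
  simp only [obstruction, Finset.sum_range_one, h3, taylor_mul h2 h1, taylor_sub_self]
  rw [show (1 - 0 : ℕ) = 0 + 1 from rfl, PowerSeries.coeff_succ_X_mul, coeff_zero_taylor]
  simp

lemma IsPotential.meromorphicOrderAt_neg (hE : IsPotential f p n E) (hf : MeromorphicAt f p)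
    (hn1 : n ≠ 1) : meromorphicOrderAt f p < 0 := by
  by_contra! h
  obtain ⟨c, hc⟩ := (tendsto_nhds_iff_meromorphicOrderAt_nonneg hf).2 h
  have h0 : ((n : ℂ) ^ 2 - 1) / 4 = 0 := tendsto_nhds_unique hE.tendsto (tendsto_sq_mul_zero hc)
  have h1 : (n : ℂ) ^ 2 = ((1 : ℕ) : ℂ) := by push_cast; linear_combination 4 * h0
  have h2 : n ^ 2 = 1 := by exact_mod_cast h1
  exact hn1 (by simpa using h2)

/-- The existence of the small solution expresses all the conditions imposed at a marked point. -/
theorem hasSmallSolution_iff (hf : MeromorphicAt f p) (hn : 0 < n) : HasSmallSolution f p n ↔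
    HasLocalExponents f p ((1 / 2 + (n / 2 : ℝ) : ℝ) : ℂ) ((1 / 2 - (n / 2 : ℝ) : ℝ) : ℂ) ∧
      (meromorphicOrderAt f p < 0 ↔ n ≠ 1) ∧
      (meromorphicOrderAt f p < 0 → IsApparentAt f p) := by
  constructor
  · intro h
    obtain ⟨E, hE⟩ := h.exists_isPotential
    refine ⟨hE.hasLocalExponents, ⟨?_, hE.meromorphicOrderAt_neg hf⟩, fun _ =>
      ⟨n / 2, ⟨n, rfl⟩, hE.hasLocalExponents, h.noLogarithm hn⟩⟩
    rintro hlt rfl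
    obtain ⟨g, hg, hfg⟩ := h.exists_analyticAt
    rw [meromorphicOrderAt_congr hfg] at hlt
    exact hlt.not_ge hg.meromorphicOrderAt_nonneg
  · rintro ⟨hexp, hpole, happ⟩
    by_cases hn1 : n = 1
    · subst hn1
      have hord : 0 ≤ meromorphicOrderAt f p := by
        by_contra! h
        exact hpole.1 h rfl
      obtain ⟨c, hc⟩ := (tendsto_nhds_iff_meromorphicOrderAt_nonneg hf).2 hord
      obtain ⟨g, hg, -, hfg⟩ := exists_analyticAt_of_tendsto hf hc
      exact hasSmallSolution_one_of_analyticAt hg hfg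
    · obtain ⟨κ, ⟨k, hk⟩, hexp', hlog⟩ := happ (hpole.2 hn1)
      -- both pairs of exponents come from the same indicial polynomial
      have hsq := tendsto_nhds_unique hexp.tendsto hexp'.tendsto
      have hsq' : ((n / 2 : ℝ) : ℂ) ^ 2 = (κ : ℂ) ^ 2 := by linear_combination hsq
      have hsq'' : (n / 2 : ℝ) ^ 2 = κ ^ 2 := by exact_mod_cast hsq'
      have hκ : κ = n / 2 := by
        have h0 : (0 : ℝ) ≤ κ := by rw [hk]; positivity
        exact ((pow_left_inj₀ (by positivity) h0 two_ne_zero).1 hsq'').symm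
      rw [hκ] at hlog
      have ht : Tendsto (fun z => (z - p) ^ 2 * f z) (𝓝[≠] p) (𝓝 (((n : ℂ) ^ 2 - 1) / 4)) := by
        have := hexp.tendsto
        convert this using 2
        push_cast
        ring
      obtain ⟨E, hE⟩ := exists_isPotential_of_tendsto hf ht
      exact hE.hasSmallSolution_of_noLogarithm hn hlog

end LocalCriteria

/-! ### Transport along the action of the modular group -/

/-- The Möbius transformation of `ℂ` given by `γ`. -/
def moeb (γ : SL(2, ℤ)) (z : ℂ) : ℂ :=
  (((γ 0 0 : ℤ) : ℂ) * z + ((γ 0 1 : ℤ) : ℂ)) / autFactor γ z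

lemma moeb_coe (γ : SL(2, ℤ)) (z : ℍ) : moeb γ z = (γ • z : ℍ) := by
  rw [coe_specialLinearGroup_apply]
  simp [moeb, autFactor]

lemma det_cast (γ : SL(2, ℤ)) : ((γ 0 0 : ℤ) : ℂ) * ((γ 1 1 : ℤ) : ℂ) -
    ((γ 0 1 : ℤ) : ℂ) * ((γ 1 0 : ℤ) : ℂ) = 1 := by
  have h := γ.det_coe
  rw [Matrix.det_fin_two] at h
  exact_mod_cast h

lemma hasDerivAt_moeb (γ : SL(2, ℤ)) {z : ℂ} (hz : autFactor γ z ≠ 0) :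
    HasDerivAt (moeb γ) (1 / autFactor γ z ^ 2) z := by
  have h1 : HasDerivAt (fun z : ℂ => ((γ 0 0 : ℤ) : ℂ) * z + ((γ 0 1 : ℤ) : ℂ))
      ((γ 0 0 : ℤ) : ℂ) z := by
    simpa using ((hasDerivAt_id z).const_mul ((γ 0 0 : ℤ) : ℂ)).add_const ((γ 0 1 : ℤ) : ℂ)
  have h2 : HasDerivAt (autFactor γ) ((γ 1 0 : ℤ) : ℂ) z := by
    have h := ((hasDerivAt_id z).const_mul ((γ 1 0 : ℤ) : ℂ)).add_const ((γ 1 1 : ℤ) : ℂ)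
    rwa [mul_one] at h
  refine (h1.div h2 hz).congr_deriv ?_
  congr 1
  rw [← det_cast γ, autFactor]
  ring

lemma analyticAt_autFactor (γ : SL(2, ℤ)) (z : ℂ) : AnalyticAt ℂ (autFactor γ) z := by
  unfold autFactor
  fun_prop

lemma analyticAt_moeb (γ : SL(2, ℤ)) {z : ℂ} (hz : autFactor γ z ≠ 0) :
    AnalyticAt ℂ (moeb γ) z :=
  AnalyticAt.fun_div (by fun_prop) (analyticAt_autFactor γ z) hz

lemma ext_moeb {k : ℤ} {f : ℍ → ℂ} (hf : Transforms k f) (γ : SL(2, ℤ)) {w : ℂ} (hw : 0 < w.im) :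
    ext f (moeb γ w) = autFactor γ w ^ k * ext f w := by
  have h := hf γ ⟨w, hw⟩
  have h2 := moeb_coe γ ⟨w, hw⟩
  rw [show (((⟨w, hw⟩ : ℍ) : ℂ)) = w from rfl] at h h2
  rw [h2, ext_coe, h, ← ext_coe f ⟨w, hw⟩]

lemma eventually_im_pos (z : ℍ) : ∀ᶠ w in 𝓝 (z : ℂ), 0 < w.im :=
  isOpen_upperHalfPlaneSet.mem_nhds z.im_pos

lemma Transforms.hasSmallSolution_of_smul {f : ℍ → ℂ} (hf : Transforms 4 f) (γ : SL(2, ℤ)) {z : ℍ}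
    {n : ℕ} (h : HasSmallSolution (ext f) (γ • z : ℍ) n) : HasSmallSolution (ext f) z n := by
  rw [← moeb_coe] at h
  refine HasSmallSolution.moebius _ _ _ _ (by rw [det_cast]; exact one_ne_zero)
    (autFactor_ne_zero γ z) h ?_
  have hne := (analyticAt_autFactor γ z).continuousAt.eventually_ne (autFactor_ne_zero γ z)
  filter_upwards [nhdsWithin_le_nhds (eventually_im_pos z), nhdsWithin_le_nhds hne] with w hw hw0
  have h4 : autFactor γ w ^ 4 ≠ 0 := pow_ne_zero _ hw0
  have h5 := ext_moeb hf γ hw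
  rw [det_cast, one_pow]
  change ext f w = 1 / autFactor γ w ^ 4 * ext f (moeb γ w)
  rw [h5, show (4 : ℤ) = ((4 : ℕ) : ℤ) from rfl, zpow_natCast, ← mul_assoc, one_div_mul_cancel h4,
    one_mul]

lemma Transforms.hasSmallSolution_of_equivalent {f : ℍ → ℂ} (hf : Transforms 4 f) {z w : ℍ}
    (hzw : Equivalent z w) {n : ℕ} (h : HasSmallSolution (ext f) z n) :
    HasSmallSolution (ext f) w n := by
  obtain ⟨γ, rfl⟩ := hzw.symm
  exact hf.hasSmallSolution_of_smul γ h

lemma Transforms.meromorphicOrderAt_eq {k : ℤ} {f : ℍ → ℂ} (hf : Transforms k f)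
    {z w : ℍ} (hzw : Equivalent z w) :
    meromorphicOrderAt (ext f) (w : ℂ) = meromorphicOrderAt (ext f) (z : ℂ) := by
  obtain ⟨γ, rfl⟩ := hzw
  have h1 := meromorphicOrderAt_comp_of_deriv_ne_zero (f := ext f)
    (analyticAt_moeb γ (autFactor_ne_zero γ z)) (by
      rw [(hasDerivAt_moeb γ (autFactor_ne_zero γ z)).deriv]
      exact one_div_ne_zero (pow_ne_zero _ (autFactor_ne_zero γ z)))
  rw [moeb_coe] at h1
  have ha := (analyticAt_autFactor γ z).zpow (n := k) (autFactor_ne_zero γ z)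
  have h2 : ext f ∘ moeb γ =ᶠ[𝓝[≠] (z : ℂ)] (autFactor γ ^ k) * ext f := by
    filter_upwards [nhdsWithin_le_nhds (eventually_im_pos z)] with v hv
    exact ext_moeb hf γ hv
  rw [← h1, meromorphicOrderAt_congr h2]
  exact meromorphicOrderAt_mul_of_ne_zero ha (zpow_ne_zero _ (autFactor_ne_zero γ z))

/-! ### Normal forms -/

/-- The normal form of a meromorphic function on the upper half-plane: the value is the limit where
it exists and `0` at the poles. -/
def normalForm (R : ℍ → ℂ) (z : ℍ) : ℂ := toMeromorphicNFAt (ext R) z z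

lemma normalForm_eq_self {R : ℍ → ℂ} {z : ℍ} (h : MeromorphicNFAt (ext R) z) :
    normalForm R z = R z := by
  rw [normalForm, toMeromorphicNFAt_eq_self.2 h, ext_coe]

lemma ext_normalForm_eventuallyEq {R : ℍ → ℂ} {z : ℍ} (h : MeromorphicAt (ext R) z) :
    ext (normalForm R) =ᶠ[𝓝[≠] (z : ℂ)] ext R := by
  filter_upwards [h.eventually_analyticAt, nhdsWithin_le_nhds (eventually_im_pos z)] with w hw hw'
  rw [show w = ((⟨w, hw'⟩ : ℍ) : ℂ) from rfl, ext_coe, ext_coe]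
  exact normalForm_eq_self hw.meromorphicNFAt

lemma meromorphicNFAt_normalForm {R : ℍ → ℂ} {z : ℍ} (h : MeromorphicAt (ext R) z) :
    MeromorphicNFAt (ext (normalForm R)) z := by
  have h1 := (ext_normalForm_eventuallyEq h).trans h.eq_nhdsNE_toMeromorphicNFAt
  have h2 : ext (normalForm R) =ᶠ[𝓝 (z : ℂ)] toMeromorphicNFAt (ext R) z := by
    have h3 := eventually_nhdsWithin_iff.1 h1
    filter_upwards [h3] with w hw
    by_cases hwz : w = z
    · rw [hwz, ext_coe, normalForm]
    · exact hw hwz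
  exact (meromorphicNFAt_congr h2).2 meromorphicNFAt_toMeromorphicNFAt

lemma eq_of_meromorphicNFAt {P Q : ℍ → ℂ} {z : ℍ} (hP : MeromorphicNFAt (ext P) z)
    (hQ : MeromorphicNFAt (ext Q) z) (h : ext P =ᶠ[𝓝[≠] (z : ℂ)] ext Q) : P z = Q z := by
  have := ((hP.eventuallyEq_nhdsNE_iff_eventuallyEq_nhds hQ).1 h).eq_of_nhds
  simpa using this

lemma Transforms.normalForm {k : ℤ} {R : ℍ → ℂ} (hR : Transforms k R)
    (hm : ∀ z : ℍ, MeromorphicAt (ext R) z) : Transforms k (normalForm R) := by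
  intro γ z
  set Q := ModularODE.normalForm R
  have hj := autFactor_ne_zero γ z
  have h1 : MeromorphicNFAt (ext Q ∘ moeb γ) z := by
    refine MeromorphicNFAt.comp_analyticAt ?_ (analyticAt_moeb γ hj)
    rw [moeb_coe]
    exact meromorphicNFAt_normalForm (hm _)
  have ha := (analyticAt_autFactor γ z).zpow (n := k) hj
  have h2 : MeromorphicNFAt ((autFactor γ ^ k) * ext Q) z :=
    (meromorphicNFAt_mul_iff_right ha (zpow_ne_zero _ hj)).2 (meromorphicNFAt_normalForm (hm z))
  have h3 : ∀ᶠ w in 𝓝[≠] (z : ℂ), ext Q (moeb γ w) = ext R (moeb γ w) :=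
    eventually_comp_of_hasDerivAt (hasDerivAt_moeb γ hj)
      (one_div_ne_zero (pow_ne_zero _ hj)) (moeb_coe γ z) (ext_normalForm_eventuallyEq (hm (γ • z)))
  have h4 : ext Q ∘ moeb γ =ᶠ[𝓝[≠] (z : ℂ)] (autFactor γ ^ k) * ext Q := by
    filter_upwards [h3, ext_normalForm_eventuallyEq (hm z),
      nhdsWithin_le_nhds (eventually_im_pos z)] with w hw1 hw2 hw3
    change ext Q (moeb γ w) = autFactor γ w ^ k * ext Q w
    rw [hw1, ext_moeb hR γ hw3, ← hw2]
  have h5 := ((h1.eventuallyEq_nhdsNE_iff_eventuallyEq_nhds h2).1 h4).eq_of_nhds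
  simpa [moeb_coe] using h5

/-! ### Meromorphic forms with prescribed poles -/

/-- A meromorphic function with the transformation law of weight `k` that is holomorphic at the
cusp, where it takes the value `v`. -/
structure IsForm (k : ℤ) (v : ℂ) (T : ℍ → ℂ) : Prop where
  transforms : Transforms k T
  meromorphic : ∀ z : ℍ, MeromorphicAt (ext T) z
  cusp : ∃ F : ℂ → ℂ, AnalyticAt ℂ F 0 ∧ F 0 = v ∧ ∀ᶠ z : ℍ in atImInfty, T z = F (qVar z)

namespace IsForm

variable {k l : ℤ} {v w : ℂ} {T S : ℍ → ℂ}

lemma tendsto (hT : IsForm k v T) : Tendsto T atImInfty (𝓝 v) := by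
  obtain ⟨F, hF, hF0, hTF⟩ := hT.cusp
  have h := hF.continuousAt.tendsto.comp tendsto_qVar
  rw [hF0] at h
  exact h.congr' (hTF.mono fun z hz => hz.symm)

lemma add (hT : IsForm k v T) (hS : IsForm k w S) : IsForm k (v + w) (fun z => T z + S z) := by
  obtain ⟨F, hF, hF0, hTF⟩ := hT.cusp
  obtain ⟨G, hG, hG0, hSG⟩ := hS.cusp
  refine ⟨hT.transforms.add hS.transforms, fun z => (hT.meromorphic z).add (hS.meromorphic z),
    fun q => F q + G q, hF.add hG, by simp only [hF0, hG0], ?_⟩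
  filter_upwards [hTF, hSG] with z h1 h2
  rw [h1, h2]

lemma mul (hT : IsForm k v T) (hS : IsForm l w S) : IsForm (k + l) (v * w) (fun z => T z * S z) := by
  obtain ⟨F, hF, hF0, hTF⟩ := hT.cusp
  obtain ⟨G, hG, hG0, hSG⟩ := hS.cusp
  refine ⟨hT.transforms.mul hS.transforms, fun z => (hT.meromorphic z).mul (hS.meromorphic z),
    fun q => F q * G q, hF.mul hG, by simp only [hF0, hG0], ?_⟩
  filter_upwards [hTF, hSG] with z h1 h2
  rw [h1, h2]

lemma div (hT : IsForm k v T) (hS : IsForm l w S) (hw : w ≠ 0) :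
    IsForm (k - l) (v / w) (fun z => T z / S z) := by
  obtain ⟨F, hF, hF0, hTF⟩ := hT.cusp
  obtain ⟨G, hG, hG0, hSG⟩ := hS.cusp
  refine ⟨hT.transforms.div hS.transforms, fun z => (hT.meromorphic z).div (hS.meromorphic z),
    fun q => F q / G q, hF.fun_div hG (by rwa [hG0]), by simp only [hF0, hG0], ?_⟩
  filter_upwards [hTF, hSG] with z h1 h2
  rw [h1, h2]

lemma const_mul (c : ℂ) (hT : IsForm k v T) : IsForm k (c * v) (fun z => c * T z) := by
  obtain ⟨F, hF, hF0, hTF⟩ := hT.cusp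
  refine ⟨hT.transforms.const_mul c, fun z => (MeromorphicAt.const c _).mul (hT.meromorphic z),
    fun q => c * F q, analyticAt_const.mul hF, by simp only [hF0], ?_⟩
  filter_upwards [hTF] with z h1
  rw [h1]

lemma zero (k : ℤ) : IsForm k 0 (fun _ => 0) :=
  ⟨fun γ z => by simp, fun z => MeromorphicAt.const 0 _, fun _ => 0, analyticAt_const, rfl,
    Eventually.of_forall fun _ => rfl⟩

lemma sum {ι : Type*} (s : Finset ι) {T : ι → ℍ → ℂ} (hT : ∀ i, IsForm k 0 (T i)) :
    IsForm k 0 (fun z => ∑ i ∈ s, T i z) := by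
  classical
  induction s using Finset.induction_on with
  | empty => simpa using zero k
  | insert i s hi ih => simpa [Finset.sum_insert hi] using (hT i).add ih

lemma cast (hT : IsForm k v T) (hk : k = l) (hv : v = w) : IsForm l w T := by
  subst hk hv
  exact hT

end IsForm

lemma isForm_E₄ : IsForm 4 1 E₄ :=
  ⟨transforms_modularForm E₄, fun z => (analyticAt_modularForm E₄ z).meromorphicAt,
    cuspFunction 1 E₄, analyticAt_cuspFunction E₄, cuspFunction_E₄_zero,
    Eventually.of_forall fun z => (cuspFunction_qVar E₄ z).symm⟩

lemma isForm_E₆ : IsForm 6 1 E₆ :=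
  ⟨transforms_modularForm E₆, fun z => (analyticAt_modularForm E₆ z).meromorphicAt,
    cuspFunction 1 E₆, analyticAt_cuspFunction E₆, cuspFunction_E₆_zero,
    Eventually.of_forall fun z => (cuspFunction_qVar E₆ z).symm⟩

lemma isForm_discriminant : IsForm 12 0 discriminant :=
  ⟨transforms_discriminant, fun z => (analyticAt_discriminant z).meromorphicAt,
    cuspFunction 1 discriminant, by
      rw [← CuspForm.coe_discriminant]
      exact analyticAt_cuspFunction CuspForm.discriminant, cuspFunction_discriminant_zero,
    Eventually.of_forall fun z => (cuspFunction_discriminant_qVar z).symm⟩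

/-- The form `E₄³ - c Δ` of weight `12`, which vanishes where `J = c`. -/
def fiberForm (c : ℂ) (z : ℍ) : ℂ := E₄ z ^ 3 - c * discriminant z

lemma isForm_fiberForm (c : ℂ) : IsForm 12 1 (fiberForm c) := by
  have h := ((isForm_E₄.mul isForm_E₄).mul isForm_E₄).add (isForm_discriminant.const_mul (-c))
  refine IsForm.cast (T := fiberForm c) ?_ rfl (show (1 * 1 * 1 + -c * 0 : ℂ) = 1 by ring)
  convert! h using 1
  ext z
  simp only [fiberForm]
  ring

lemma fiberForm_eq (c : ℂ) (z : ℍ) : fiberForm c z = discriminant z * (jFun z - c) := by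
  have := discriminant_ne_zero z
  rw [fiberForm, jFun]
  field_simp

lemma analyticAt_fiberForm (c : ℂ) (z : ℍ) : AnalyticAt ℂ (ext (fiberForm c)) z :=
  ((analyticAt_modularForm E₄ z).pow 3).sub (analyticAt_const.mul (analyticAt_discriminant z))

lemma fiberForm_eq_zero_iff (p z : ℍ) : fiberForm (jFun p) z = 0 ↔ Equivalent p z := by
  rw [fiberForm_eq, mul_eq_zero, or_iff_right (discriminant_ne_zero z), sub_eq_zero]
  exact ⟨fun h => equivalent_of_jFun_eq h.symm, fun h => transforms_jFun.eq_of_equivalent h⟩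

lemma deriv_fiberForm_ne_zero {p : ℍ} (h4 : E₄ p ≠ 0) (h6 : E₆ p ≠ 0) :
    deriv (ext (fiberForm (jFun p))) p ≠ 0 := by
  have hΔ := (analyticAt_discriminant p).differentiableAt.hasDerivAt
  have hJ := (analyticAt_jFun p).differentiableAt.hasDerivAt
  rw [show ext (fiberForm (jFun p)) = fun w => ext discriminant w * (ext jFun w - jFun p) from
    funext fun w => fiberForm_eq _ _, (hΔ.fun_mul (hJ.sub_const (jFun p))).deriv]
  simp only [ext_coe, sub_self, mul_zero, zero_add]
  exact mul_ne_zero (discriminant_ne_zero p) (deriv_jFun_ne_zero h4 h6)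

lemma tendsto_sq_mul_zero_of_analyticAt {g : ℂ → ℂ} {p : ℂ} (hg : AnalyticAt ℂ g p) :
    Tendsto (fun z => (z - p) ^ 2 * g z) (𝓝[≠] p) (𝓝 0) :=
  tendsto_sq_mul_zero (hg.continuousAt.tendsto.mono_left nhdsWithin_le_nhds)

lemma tendsto_sub_div {g : ℂ → ℂ} {p : ℂ} (hg : AnalyticAt ℂ g p) (h0 : g p = 0)
    (h1 : deriv g p ≠ 0) : Tendsto (fun z => (z - p) / g z) (𝓝[≠] p) (𝓝 (deriv g p)⁻¹) := by
  have h := (hasDerivAt_iff_tendsto_slope.1 hg.differentiableAt.hasDerivAt).inv₀ h1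
  refine h.congr fun z => ?_
  rw [slope_def_field, h0, sub_zero, inv_div]

/-- A quotient `u / g ^ e` of forms, where `g` vanishes exactly on the orbit of `p`, to first
order, normalised to have leading coefficient `1` at `p`. -/
lemma exists_isForm_of_quotient {k l : ℤ} {v : ℂ} {u g : ℍ → ℂ} {p : ℍ} (hu : IsForm k 0 u)
    (hg : IsForm l v g) (hv : v ≠ 0) (hua : ∀ z : ℍ, AnalyticAt ℂ (ext u) z)
    (hga : ∀ z : ℍ, AnalyticAt ℂ (ext g) z) (hgp : ∀ z, g z = 0 ↔ Equivalent p z)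
    (hg' : deriv (ext g) p ≠ 0) (hup : u p ≠ 0) (e : ℕ) (he : k - e * l = 4) :
    ∃ T, IsForm 4 0 T ∧ Tendsto (fun z => (z - p) ^ e * ext T z) (𝓝[≠] (p : ℂ)) (𝓝 1) ∧
      ∀ z, ¬ Equivalent p z → AnalyticAt ℂ (ext T) z := by
  have hge : IsForm (e * l) (v ^ e) (fun z => g z ^ e) := by
    clear he
    induction e with
    | zero =>
      refine ⟨fun γ z => by simp, fun z => ?_, fun _ => 1, analyticAt_const, by simp, by simp⟩
      exact ((hga z).pow 0).meromorphicAt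
    | succ e ih =>
      have := ih.mul hg
      convert this using 2
      · push_cast
        ring
      · exact pow_succ _ _
      · exact pow_succ _ _
  refine ⟨fun z => (deriv (ext g) p) ^ e / u p * (u z / g z ^ e),
    (((hu.div hge (pow_ne_zero _ hv)).const_mul _).cast he (by simp)), ?_, fun z hz => ?_⟩
  · have h1 := (tendsto_sub_div (hga p) (by rw [ext_coe, hgp]; exact Equivalent.refl p) hg').pow e
    have h2 := (hua p).continuousAt.tendsto.mono_left (nhdsWithin_le_nhds (s := {(p : ℂ)}ᶜ))
    have h3 := (h1.mul h2).const_mul ((deriv (ext g) p) ^ e / u p)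
    have h4 : (deriv (ext g) p) ^ e / u p * ((deriv (ext g) p)⁻¹ ^ e * ext u p) = 1 := by
      rw [ext_coe, inv_pow]
      have := pow_ne_zero e hg'
      generalize deriv (ext g) p ^ e = x at this ⊢
      field_simp
    rw [h4] at h3
    refine h3.congr fun z => ?_
    simp only [ext, Function.comp_apply, div_pow]
    ring
  · have hgz : g z ≠ 0 := fun h => hz ((hgp z).1 h)
    exact analyticAt_const.mul ((hua z).div ((hga z).pow e) (pow_ne_zero _ (by simpa using hgz)))

/-- A form of weight `4` with a single orbit of poles, where they are double. -/
lemma exists_isForm_double_pole (p : ℍ) :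
    ∃ T, IsForm 4 0 T ∧ Tendsto (fun z => (z - p) ^ 2 * ext T z) (𝓝[≠] (p : ℂ)) (𝓝 1) ∧
      ∀ z, ¬ Equivalent p z → AnalyticAt ℂ (ext T) z := by
  have hE4 := analyticAt_modularForm E₄
  have hΔ := analyticAt_discriminant
  by_cases h4 : E₄ p = 0
  · refine exists_isForm_of_quotient isForm_discriminant isForm_E₄ one_ne_zero hΔ hE4
      (fun z => ?_) (deriv_E₄_ne_zero h4) (discriminant_ne_zero p) 2 (by norm_num)
    have hp := E₄_eq_zero_iff.1 h4
    rw [E₄_eq_zero_iff]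
    exact ⟨fun h => hp.symm.trans h, fun h => hp.trans h⟩
  · by_cases h6 : E₆ p = 0
    · refine exists_isForm_of_quotient
        ((isForm_E₄.mul isForm_discriminant).cast rfl (mul_zero _)) isForm_E₆ one_ne_zero
        (fun z => (hE4 z).mul (hΔ z)) (analyticAt_modularForm E₆)
        (fun z => ?_) (deriv_E₆_ne_zero h6) (mul_ne_zero h4 (discriminant_ne_zero p)) 2
        (by norm_num)
      have hp := E₆_eq_zero_iff.1 h6
      rw [E₆_eq_zero_iff]
      exact ⟨fun h => hp.symm.trans h, fun h => hp.trans h⟩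
    · exact exists_isForm_of_quotient
        (((isForm_E₄.mul isForm_discriminant).mul isForm_discriminant).cast rfl (mul_zero _))
        (isForm_fiberForm (jFun p)) one_ne_zero (fun z => ((hE4 z).mul (hΔ z)).mul (hΔ z))
        (analyticAt_fiberForm _) (fiberForm_eq_zero_iff p) (deriv_fiberForm_ne_zero h4 h6)
        (mul_ne_zero (mul_ne_zero h4 (discriminant_ne_zero p)) (discriminant_ne_zero p)) 2
        (by norm_num)

/-- A form of weight `4` with a single orbit of poles, where they are simple. -/
lemma exists_isForm_simple_pole {p : ℍ} (hρ : ¬ Equivalent rho p)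
    (hi : ¬ Equivalent UpperHalfPlane.I p) :
    ∃ T, IsForm 4 0 T ∧ Tendsto (fun z => (z - p) * ext T z) (𝓝[≠] (p : ℂ)) (𝓝 1) ∧
      ∀ z, ¬ Equivalent p z → AnalyticAt ℂ (ext T) z := by
  have h4 : E₄ p ≠ 0 := fun h => hρ (E₄_eq_zero_iff.1 h)
  have h6 : E₆ p ≠ 0 := fun h => hi (E₆_eq_zero_iff.1 h)
  have h := exists_isForm_of_quotient
    ((isForm_E₄.mul isForm_discriminant).cast rfl (mul_zero _))
    (isForm_fiberForm (jFun p)) one_ne_zero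
    (fun z => (analyticAt_modularForm E₄ z).mul (analyticAt_discriminant z))
    (analyticAt_fiberForm _) (fiberForm_eq_zero_iff p) (deriv_fiberForm_ne_zero h4 h6)
    (mul_ne_zero h4 (discriminant_ne_zero p)) 1 (by norm_num)
  simpa only [pow_one] using h

/-- A form of weight `4` with at most double poles, whose leading coefficients at inequivalent
points and whose value at the cusp are prescribed. -/
lemma exists_isForm_leading_coeff {ι : Type*} [Fintype ι] (P : ι → ℍ)
    (hP : ∀ i j, i ≠ j → ¬ Equivalent (P i) (P j)) (c : ι → ℂ) (A : ℂ) :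
    ∃ R, IsForm 4 A R ∧
      (∀ i, Tendsto (fun z => (z - P i) ^ 2 * ext R z) (𝓝[≠] (P i : ℂ)) (𝓝 (c i))) ∧
      ∀ z, (∀ i, ¬ Equivalent (P i) z) → AnalyticAt ℂ (ext R) z := by
  classical
  choose T hT hlim hreg using fun i => exists_isForm_double_pole (P i)
  have hsum := IsForm.sum Finset.univ (fun i => ((hT i).const_mul (c i)).cast rfl (mul_zero _))
  refine ⟨fun z => A * E₄ z + ∑ i, c i * T i z,
    ((isForm_E₄.const_mul A).add hsum).cast rfl (by simp), fun i => ?_, fun z hz => ?_⟩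
  · have h1 : Tendsto (fun z => (z - P i) ^ 2 * (A * ext E₄ z)) (𝓝[≠] (P i : ℂ)) (𝓝 0) :=
      tendsto_sq_mul_zero_of_analyticAt (analyticAt_const.mul (analyticAt_modularForm E₄ (P i)))
    have h2 : ∀ j, Tendsto (fun z => (z - P i) ^ 2 * (c j * ext (T j) z)) (𝓝[≠] (P i : ℂ))
        (𝓝 (if j = i then c i else 0)) := by
      intro j
      split_ifs with hji
      · subst hji
        have := (hlim j).const_mul (c j)
        rw [mul_one] at this
        exact this.congr fun z => by ring
      · exact tendsto_sq_mul_zero_of_analyticAt (analyticAt_const.mul (hreg j _ (hP j i hji)))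
    have h3 := h1.add (tendsto_finsetSum Finset.univ fun j _ => h2 j)
    simp only [Finset.sum_ite_eq', Finset.mem_univ, if_true, zero_add] at h3
    refine h3.congr fun z => ?_
    simp only [ext, Function.comp_apply, mul_add, Finset.mul_sum]
  · have h : AnalyticAt ℂ (fun w => A * ext E₄ w + ∑ i, c i * ext (T i) w) z := by
      refine (analyticAt_const.mul (analyticAt_modularForm E₄ z)).add ?_
      exact Finset.analyticAt_fun_sum _ fun i _ => analyticAt_const.mul (hreg i z (hz i))
    exact h

/-! ### Reformulation of the conditions on `Q` -/

/-- The family consisting of a datum at `ρ`, a datum at `i` and data at the other marked points. -/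
def mark {α : Type*} {m : ℕ} (a b : α) (f : Fin m → α) : Option (Option (Fin m)) → α
  | none => a
  | some none => b
  | some (some j) => f j

/-- The marked points: `ρ`, `i` and the points `p j`. -/
abbrev markedPoint {m : ℕ} (p : Fin m → ℍ) : Option (Option (Fin m)) → ℍ :=
  mark rho UpperHalfPlane.I p

lemma exists_mark_iff {m : ℕ} {α β : Type*} {a b : α} {f : Fin m → α} {a' b' : β} {f' : Fin m → β}
    {C : α → β → Prop} : (∃ o, C (mark a b f o) (mark a' b' f' o)) ↔
      C a a' ∨ C b b' ∨ ∃ j, C (f j) (f' j) := by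
  constructor
  · rintro ⟨_ | _ | j, h⟩
    exacts [Or.inl h, Or.inr (Or.inl h), Or.inr (Or.inr ⟨j, h⟩)]
  · rintro (h | h | ⟨j, h⟩)
    exacts [⟨none, h⟩, ⟨some none, h⟩, ⟨some (some j), h⟩]

lemma not_equivalent_rho_I : ¬ Equivalent rho UpperHalfPlane.I := fun h =>
  E₆_ne_zero_of_E₄_eq_zero (E₄_eq_zero_iff.2 h) E₆_I

lemma mark_inequivalent {m : ℕ} {p : Fin m → ℍ} (hp : ∀ j k, j ≠ k → ¬ Equivalent (p j) (p k))
    (hpρ : ∀ j, ¬ Equivalent rho (p j)) (hpi : ∀ j, ¬ Equivalent UpperHalfPlane.I (p j)) :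
    ∀ o o', o ≠ o' → ¬ Equivalent (markedPoint p o)
      (markedPoint p o') := by
  rintro (_ | _ | j) (_ | _ | k) hne h
  · exact hne rfl
  · exact not_equivalent_rho_I h
  · exact hpρ k h
  · exact not_equivalent_rho_I h.symm
  · exact hne rfl
  · exact hpi k h
  · exact hpρ j h.symm
  · exact hpi j h.symm
  · exact hp j k (fun hjk => hne (by rw [hjk])) h

/-- The modular forms `Q` of weight `4` with value `A` at the cusp and poles at most at the orbits
of the points `P o`, where small solutions with exponent differences `N o` exist. -/
structure IsAdmissible {ι : Type*} (P : ι → ℍ) (N : ι → ℕ) (A : ℂ) (Q : ℍ → ℂ) : Prop where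
  modular : IsMeromorphicModularForm 4 Q
  small : ∀ o, HasSmallSolution (ext Q) (P o) (N o)
  regular : ∀ z, (∀ o, ¬ Equivalent (P o) z) → AnalyticAt ℂ (ext Q) z
  cusp : Tendsto Q atImInfty (𝓝 A)

lemma IsMeromorphicModularForm.nf {k : ℤ} {Q : ℍ → ℂ} (hQ : IsMeromorphicModularForm k Q) (z : ℍ) :
    MeromorphicNFAt (ext Q) z := hQ.meromorphic z.im_pos

lemma hasLocalExponentsAtInfty_iff {Q : ℍ → ℂ} {κ : ℝ} :
    HasLocalExponentsAtInfty Q (κ : ℂ) (-κ : ℂ) ↔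
      Tendsto Q atImInfty (𝓝 (-(4 * (Real.pi : ℂ) ^ 2 * (κ : ℂ) ^ 2))) := by
  have hπ : (4 * (Real.pi : ℂ) ^ 2) ≠ 0 := by simp [Real.pi_ne_zero]
  constructor
  · rintro ⟨c, hc, hx⟩
    have h0 := hx 0
    have : c = -(4 * (Real.pi : ℂ) ^ 2 * (κ : ℂ) ^ 2) := by
      field_simp at h0
      linear_combination h0
    rwa [← this]
  · intro h
    refine ⟨_, h, fun x => ?_⟩
    field_simp
    ring

lemma half_ne_half_iff {n : ℕ} : (n / 2 : ℝ) ≠ 1 / 2 ↔ n ≠ 1 := by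
  rw [ne_eq, ne_eq, div_left_inj' two_ne_zero, Nat.cast_eq_one]

section Admissible

variable {m : ℕ} {nρ ni : ℕ} {n : Fin m → ℕ} {p : Fin m → ℍ} {κinf : ℝ} {Q : ℍ → ℂ}

lemma isEquipped_iff (hN : ∀ o, 0 < mark nρ ni n o)
    (hP : ∀ o o', o ≠ o' → ¬ Equivalent (markedPoint p o)
      (markedPoint p o')) :
    IsEquipped (nρ / 2) (ni / 2) (fun j => n j / 2) p κinf Q ↔
      IsAdmissible (markedPoint p) (mark nρ ni n)
        (-(4 * (Real.pi : ℂ) ^ 2 * (κinf : ℂ) ^ 2)) Q := by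
  set P := markedPoint p with hPdef
  set N := mark nρ ni n with hNdef
  have hpoles : ∀ z, ((Equivalent rho z ∧ (nρ / 2 : ℝ) ≠ 1 / 2) ∨
      (Equivalent UpperHalfPlane.I z ∧ (ni / 2 : ℝ) ≠ 1 / 2) ∨
      ∃ j, Equivalent (p j) z ∧ (n j / 2 : ℝ) ≠ 1 / 2) ↔ ∃ o, Equivalent (P o) z ∧ N o ≠ 1 := by
    intro z
    simp only [half_ne_half_iff]
    exact (exists_mark_iff (C := fun w k => Equivalent w z ∧ k ≠ 1)).symm
  constructor
  · intro h
    refine ⟨h.modular, fun o => ?_, fun z hz => ?_, hasLocalExponentsAtInfty_iff.1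
      h.exponents_infty⟩
    · rw [hasSmallSolution_iff (h.modular.nf _).meromorphicAt (hN o)]
      refine ⟨?_, ?_, h.apparent (P o)⟩
      · rcases o with _ | _ | j
        exacts [h.exponents_rho, h.exponents_I, h.exponents j]
      · have := h.poles (P o)
        rw [hpoles, IsPole] at this
        rw [this]
        constructor
        · rintro ⟨o', ho', hne⟩
          by_cases hoo : o' = o
          · rwa [← hoo]
          · exact absurd ho' (hP _ _ hoo)
        · exact fun hne => ⟨o, Equivalent.refl _, hne⟩
    · rw [← (h.modular.nf z).meromorphicOrderAt_nonneg_iff_analyticAt]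
      by_contra! hlt
      obtain ⟨o, ho, -⟩ := (hpoles z).1 ((h.poles z).1 hlt)
      exact hz o ho
  · intro h
    have key : ∀ o z, Equivalent (P o) z → _ := fun o z ho =>
      (hasSmallSolution_iff (h.modular.nf z).meromorphicAt (hN o)).1
        (Transforms.hasSmallSolution_of_equivalent h.modular.transform ho (h.small o))
    have hex : ∀ z, IsPole Q z → ∃ o, Equivalent (P o) z := by
      intro z hz
      by_contra! hno
      exact hz.not_ge (h.regular z hno).meromorphicOrderAt_nonneg
    refine ⟨h.modular, fun z => ?_, (key none _ (Equivalent.refl _)).1,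
      (key (some none) _ (Equivalent.refl _)).1,
      fun j => (key (some (some j)) _ (Equivalent.refl _)).1, fun z hz => ?_,
      hasLocalExponentsAtInfty_iff.2 h.cusp⟩
    · rw [hpoles]
      constructor
      · intro hz
        obtain ⟨o, ho⟩ := hex z hz
        exact ⟨o, ho, (key o z ho).2.1.1 hz⟩
      · rintro ⟨o, ho, hne⟩
        exact (key o z ho).2.1.2 hne
    · obtain ⟨o, ho⟩ := hex z hz
      exact (key o z ho).2.2 hz

end Admissible

/-! ### Small solutions at the elliptic points -/

/-- At a point with a nontrivial stabiliser the equation has a symmetry, which excludes a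
logarithm unless the rotation number of the stabiliser resonates with the exponent difference. -/
lemma Transforms.hasSmallSolution_of_fixedPoint {f : ℍ → ℂ} (hf : Transforms 4 f) {γ : SL(2, ℤ)}
    {z : ℍ} {q : ℂ} {n : ℕ} {E : ℂ → ℂ} (hE : IsPotential (ext f) z n E) (hn : 0 < n)
    (hγ : γ • z = z) (hzq : (z : ℂ) ≠ q) (hq : autFactor γ q ≠ 0)
    (hfq : ((γ 0 0 : ℤ) : ℂ) * q + ((γ 0 1 : ℤ) : ℂ) = q * autFactor γ q)
    (hζ : (autFactor γ q / autFactor γ z) ^ n ≠ 1) : HasSmallSolution (ext f) z n := by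
  have hfp := moeb_coe γ z
  rw [hγ, moeb, div_eq_iff (autFactor_ne_zero γ z)] at hfp
  refine hE.hasSmallSolution_of_fixedPoint hn (det_cast γ) hzq hfp hfq (autFactor_ne_zero γ z) hq
    hζ ?_
  filter_upwards [nhdsWithin_le_nhds (eventually_im_pos z)] with w hw
  exact ext_moeb hf γ hw

lemma Transforms.hasSmallSolution_rho {f : ℍ → ℂ} (hf : Transforms 4 f) {n : ℕ} {E : ℂ → ℂ}
    (hE : IsPotential (ext f) rho n E) (hn : 0 < n) (h3 : ¬ 3 ∣ n) :
    HasSmallSolution (ext f) rho n := by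
  have hρ0 : (rho : ℂ) ≠ 0 := rho.ne_zero
  have him : (rho : ℂ).im ≠ 0 := rho.im_pos.ne'
  have ha : ∀ w : ℂ, autFactor rotRho w = w := fun w => by simp [autFactor, rotRho]
  -- the other fixed point is `1 - ρ`, the complex conjugate of `ρ`
  refine hf.hasSmallSolution_of_fixedPoint (γ := rotRho) (q := 1 - rho) hE hn rotRho_smul_rho ?_ ?_
    ?_ ?_
  · intro h
    have := congrArg Complex.im h
    simp only [Complex.sub_im, Complex.one_im, zero_sub] at this
    exact him (by linarith)
  · rw [ha, sub_ne_zero]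
    intro h
    exact him (by rw [← h, Complex.one_im])
  · rw [ha]
    simp [rotRho]
    linear_combination -rho_sq
  · rw [ha, ha, show (1 - rho : ℂ) / rho = -rho by
      rw [div_eq_iff hρ0]; linear_combination rho_sq]
    intro h
    have h1 : (-rho : ℂ) ^ 3 = 1 := by linear_combination (-(rho : ℂ) - 1) * rho_sq
    have h2 : (-rho : ℂ) ≠ 1 := fun h => by
      have := congrArg Complex.im h
      simp only [Complex.neg_im, Complex.one_im, neg_eq_zero] at this
      exact him this
    have : Fact (Nat.Prime 3) := ⟨Nat.prime_three⟩
    exact h3 (orderOf_eq_prime h1 h2 ▸ orderOf_dvd_of_pow_eq_one h)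

lemma Transforms.hasSmallSolution_I {f : ℍ → ℂ} (hf : Transforms 4 f) {n : ℕ} {E : ℂ → ℂ}
    (hE : IsPotential (ext f) UpperHalfPlane.I n E) (hn : 0 < n) (h2 : ¬ 2 ∣ n) :
    HasSmallSolution (ext f) UpperHalfPlane.I n := by
  have hI : ((UpperHalfPlane.I : ℍ) : ℂ) = Complex.I := rfl
  have ha : ∀ w : ℂ, autFactor ModularGroup.S w = w := fun w => by
    simp [autFactor, ModularGroup.S]
  refine hf.hasSmallSolution_of_fixedPoint (γ := ModularGroup.S) (q := -Complex.I) hE hn S_smul_I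
    ?_ ?_ ?_ ?_
  · rw [hI]
    intro h
    have := congrArg Complex.im h
    norm_num at this
  · rw [ha]
    exact neg_ne_zero.2 Complex.I_ne_zero
  · rw [ha]
    simp [ModularGroup.S]
  · rw [ha, ha, hI, neg_div, div_self Complex.I_ne_zero,
      (Nat.odd_iff.2 (Nat.two_dvd_ne_zero.1 h2)).neg_one_pow]
    norm_num

/-! ### The family of candidates -/

section Limits

variable {f : ℂ → ℂ} {p c : ℂ}

lemma tendsto_sub_zero (p : ℂ) : Tendsto (fun z : ℂ => z - p) (𝓝[≠] p) (𝓝 0) := by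
  have : ContinuousAt (fun z : ℂ => z - p) p := by fun_prop
  simpa using this.tendsto.mono_left nhdsWithin_le_nhds

/-- If `(z - p) f` tends to zero at `p` and `f` is meromorphic, then `f` has a limit at `p`. -/
lemma exists_tendsto_of_sub_mul (hf : MeromorphicAt f p)
    (h : Tendsto (fun z => (z - p) * f z) (𝓝[≠] p) (𝓝 0)) :
    ∃ c, Tendsto f (𝓝[≠] p) (𝓝 c) := by
  have hm : MeromorphicAt (fun z => (z - p) * f z) p := by fun_prop
  obtain ⟨g, hg, hgp, hfg⟩ := exists_analyticAt_of_tendsto hm h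
  have hs := hasDerivAt_iff_tendsto_slope.1 hg.differentiableAt.hasDerivAt
  refine ⟨_, hs.congr' ?_⟩
  filter_upwards [hfg, self_mem_nhdsWithin] with z hz hzp
  have hz0 : z - p ≠ 0 := sub_ne_zero.2 hzp
  rw [slope_def_field, hgp, sub_zero, ← hz]
  field_simp

/-- A meromorphic function with at most a simple pole has a residue. -/
lemma exists_tendsto_sub_mul (hf : MeromorphicAt f p)
    (h : Tendsto (fun z => (z - p) ^ 2 * f z) (𝓝[≠] p) (𝓝 0)) :
    ∃ c, Tendsto (fun z => (z - p) * f z) (𝓝[≠] p) (𝓝 c) :=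
  exists_tendsto_of_sub_mul (by fun_prop) (h.congr fun z => by ring)

end Limits

lemma eventually_not_equivalent (p : ℍ) : ∀ᶠ z in atImInfty, ¬ Equivalent p z := by
  filter_upwards [tendsto_norm_jFun.eventually (eventually_gt_atTop ‖jFun p‖)] with z hz h
  rw [transforms_jFun.eq_of_equivalent h] at hz
  exact lt_irrefl _ hz

/-- A form `base` and forms `term j` with the behaviour at the marked points that makes
`base + ∑ b j * term j` the general form with the prescribed exponents at the marked points: the
leading coefficients of `base` are the constants of the indicial polynomials, and `term j` has a
simple pole with residue `1` at `p j`. -/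
structure IsFamily {m : ℕ} (p : Fin m → ℍ) (N : Option (Option (Fin m)) → ℕ) (A : ℂ) (base : ℍ → ℂ)
    (term : Fin m → ℍ → ℂ) : Prop where
  inequivalent : ∀ o o', o ≠ o' → ¬ Equivalent (markedPoint p o)
    (markedPoint p o')
  base_isForm : IsForm 4 A base
  base_lim : ∀ o, Tendsto (fun z => (z - markedPoint p o) ^ 2 * ext base z)
    (𝓝[≠] (markedPoint p o : ℂ)) (𝓝 (((N o : ℂ) ^ 2 - 1) / 4))
  base_regular : ∀ z, (∀ o, ¬ Equivalent (markedPoint p o) z) →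
    AnalyticAt ℂ (ext base) z
  term_isForm : ∀ j, IsForm 4 0 (term j)
  term_lim : ∀ j, Tendsto (fun z => (z - p j) * ext (term j) z) (𝓝[≠] (p j : ℂ)) (𝓝 1)
  term_regular : ∀ j z, ¬ Equivalent (p j) z → AnalyticAt ℂ (ext (term j)) z

lemma exists_isFamily {m : ℕ} {p : Fin m → ℍ}
    (hP : ∀ o o', o ≠ o' → ¬ Equivalent (markedPoint p o)
      (markedPoint p o')) (N : Option (Option (Fin m)) → ℕ) (A : ℂ) :
    ∃ base term, IsFamily p N A base term := by
  obtain ⟨base, h1, h2, h3⟩ := exists_isForm_leading_coeff _ hP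
    (fun o => ((N o : ℂ) ^ 2 - 1) / 4) A
  choose term h4 h5 h6 using fun j => exists_isForm_simple_pole (p := p j)
    (hP none (some (some j)) (by simp)) (hP (some none) (some (some j)) (by simp))
  exact ⟨base, term, hP, h1, h2, h3, h4, h5, h6⟩

/-- The member with residue parameters `b` of the family. -/
def member {m : ℕ} (base : ℍ → ℂ) (term : Fin m → ℍ → ℂ) (b : Fin m → ℂ) (z : ℍ) : ℂ :=
  base z + ∑ j, b j * term j z

lemma ext_member {m : ℕ} (base : ℍ → ℂ) (term : Fin m → ℍ → ℂ) (b : Fin m → ℂ) (z : ℂ) :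
    ext (member base term b) z = ext base z + ∑ j, b j * ext (term j) z := rfl

namespace IsFamily

variable {m : ℕ} {p : Fin m → ℍ} {N : Option (Option (Fin m)) → ℕ} {A : ℂ} {base : ℍ → ℂ}
  {term : Fin m → ℍ → ℂ}

lemma term_lim_ite (h : IsFamily p N A base term) (j k : Fin m) :
    Tendsto (fun z => (z - p k) * ext (term j) z) (𝓝[≠] (p k : ℂ)) (𝓝 (if j = k then 1 else 0)) := by
  split_ifs with hjk
  · subst hjk
    exact h.term_lim j
  · have h1 := (h.term_regular j (p k) (h.inequivalent (some (some j)) (some (some k))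
      (by simpa using hjk))).continuousAt.tendsto.mono_left (nhdsWithin_le_nhds (s := {(p k : ℂ)}ᶜ))
    simpa using (tendsto_sub_zero (p k : ℂ)).mul h1

lemma term_lim_sq (h : IsFamily p N A base term) (j : Fin m) (o : Option (Option (Fin m))) :
    Tendsto (fun z => (z - markedPoint p o) ^ 2 * ext (term j) z)
      (𝓝[≠] (markedPoint p o : ℂ)) (𝓝 0) := by
  by_cases ho : some (some j) = o
  · subst ho
    change Tendsto (fun z => (z - p j) ^ 2 * ext (term j) z) (𝓝[≠] (p j : ℂ)) (𝓝 0)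
    have := (tendsto_sub_zero (p j : ℂ)).mul (h.term_lim j)
    rw [zero_mul] at this
    exact this.congr fun z => by ring
  · exact tendsto_sq_mul_zero_of_analyticAt (h.term_regular j _
      (h.inequivalent (some (some j)) o ho))

lemma isForm_member (h : IsFamily p N A base term) (b : Fin m → ℂ) :
    IsForm 4 A (member base term b) :=
  (h.base_isForm.add (IsForm.sum Finset.univ fun j =>
    ((h.term_isForm j).const_mul (b j)).cast rfl (mul_zero _))).cast rfl (add_zero _)

lemma member_lim (h : IsFamily p N A base term) (b : Fin m → ℂ) (o : Option (Option (Fin m))) :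
    Tendsto (fun z => (z - markedPoint p o) ^ 2 * ext (member base term b) z)
      (𝓝[≠] (markedPoint p o : ℂ)) (𝓝 (((N o : ℂ) ^ 2 - 1) / 4)) := by
  have h1 := (h.base_lim o).add
    (tendsto_finsetSum Finset.univ fun j _ => (h.term_lim_sq j o).const_mul (b j))
  simp only [mul_zero, Finset.sum_const_zero, add_zero] at h1
  refine h1.congr fun z => ?_
  rw [ext_member, mul_add, Finset.mul_sum]
  congr 1
  exact Finset.sum_congr rfl fun j _ => by ring

lemma member_regular (h : IsFamily p N A base term) (b : Fin m → ℂ) {z : ℍ}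
    (hz : ∀ o, ¬ Equivalent (markedPoint p o) z) :
    AnalyticAt ℂ (ext (member base term b)) z := by
  have : AnalyticAt ℂ (fun w => ext base w + ∑ j, b j * ext (term j) w) z :=
    (h.base_regular z hz).add (Finset.analyticAt_fun_sum _ fun j _ =>
      analyticAt_const.mul (h.term_regular j z (hz (some (some j)))))
  exact this

lemma eventually_regular (p : Fin m → ℍ) :
    ∀ᶠ z in atImInfty, ∀ o, ¬ Equivalent (markedPoint p o) z :=
  eventually_all.2 fun _ => eventually_not_equivalent _

/-- The members of the family with small solutions at the points `p j` are admissible: at `ρ` and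
`i` the small solutions exist by symmetry. -/
lemma isAdmissible_normalForm (h : IsFamily p N A base term) (hN : ∀ o, 0 < N o)
    (h3 : ¬ 3 ∣ N none) (h2 : ¬ 2 ∣ N (some none)) {b : Fin m → ℂ}
    (hb : ∀ j, HasSmallSolution (ext (member base term b)) (p j) (N (some (some j)))) :
    IsAdmissible (markedPoint p) N A (normalForm (member base term b)) := by
  set R := member base term b with hR
  have hRf : IsForm 4 A R := h.isForm_member b
  have hnf : ∀ᶠ z in atImInfty, normalForm R z = R z := by
    filter_upwards [eventually_regular p] with z hz
    exact normalForm_eq_self (h.member_regular b hz).meromorphicNFAt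
  have hpot := fun o => exists_isPotential_of_tendsto (hRf.meromorphic _) (h.member_lim b o)
  refine ⟨⟨fun z hz => meromorphicNFAt_normalForm (hRf.meromorphic ⟨z, hz⟩),
    hRf.transforms.normalForm hRf.meromorphic, ?_⟩, fun o => ?_, fun z hz => ?_, ?_⟩
  · obtain ⟨F, hF, -, hRF⟩ := hRf.cusp
    refine ⟨F, hF.meromorphicAt, ?_⟩
    filter_upwards [hnf, hRF] with z h1 h2
    rw [h1, h2, qVar]
  · refine HasSmallSolution.congr ?_ (ext_normalForm_eventuallyEq (hRf.meromorphic _)).symm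
    rcases o with _ | _ | j
    · obtain ⟨E, hE⟩ := hpot none
      exact hRf.transforms.hasSmallSolution_rho hE (hN _) h3
    · obtain ⟨E, hE⟩ := hpot (some none)
      exact hRf.transforms.hasSmallSolution_I hE (hN _) h2
    · exact hb j
  · rw [← (meromorphicNFAt_normalForm (hRf.meromorphic z)).meromorphicOrderAt_nonneg_iff_analyticAt,
      meromorphicOrderAt_congr (ext_normalForm_eventuallyEq (hRf.meromorphic z))]
    exact (h.member_regular b hz).meromorphicOrderAt_nonneg
  · exact hRf.tendsto.congr' (hnf.mono fun z hz => hz.symm)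

/-- A form of weight `4` with at most simple poles at `ρ` and `i`, no other poles and the value `0`
at the cusp is zero, since its product with `E₄ E₆` is a cusp form of weight `14`. -/
lemma eventuallyEq_zero {D : ℍ → ℂ} (hD : Transforms 4 D) (hm : ∀ z : ℍ, MeromorphicAt (ext D) z)
    (h0 : Tendsto D atImInfty (𝓝 0))
    (hlim : ∀ o, Tendsto (fun z => (z - markedPoint p o) ^ 2 * ext D z)
      (𝓝[≠] (markedPoint p o : ℂ)) (𝓝 0))
    (hres : ∀ j, Tendsto (fun z => (z - p j) * ext D z) (𝓝[≠] (p j : ℂ)) (𝓝 0))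
    (hreg : ∀ z, (∀ o, ¬ Equivalent (markedPoint p o) z) → AnalyticAt ℂ (ext D) z)
    (z : ℍ) : ext D =ᶠ[𝓝[≠] (z : ℂ)] 0 := by
  let W : ℍ → ℂ := fun z => D z * E₄ z * E₆ z
  have hWt : Transforms 14 W :=
    ((hD.mul (transforms_modularForm E₄)).mul (transforms_modularForm E₆)).cast (by norm_num)
  have hWm : ∀ z : ℍ, MeromorphicAt (ext W) z := fun z =>
    ((hm z).mul (analyticAt_modularForm E₄ z).meromorphicAt).mul
      (analyticAt_modularForm E₆ z).meromorphicAt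
  have hc4 : ∀ z : ℍ, Tendsto (ext E₄) (𝓝[≠] (z : ℂ)) (𝓝 (E₄ z)) := fun z => by
    have := (analyticAt_modularForm E₄ z).continuousAt.tendsto.mono_left
      (nhdsWithin_le_nhds (s := {(z : ℂ)}ᶜ))
    rwa [ext_coe] at this
  have hc6 : ∀ z : ℍ, Tendsto (ext E₆) (𝓝[≠] (z : ℂ)) (𝓝 (E₆ z)) := fun z => by
    have := (analyticAt_modularForm E₆ z).continuousAt.tendsto.mono_left
      (nhdsWithin_le_nhds (s := {(z : ℂ)}ᶜ))
    rwa [ext_coe] at this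
  have hWreg : ∀ z, (∀ o, ¬ Equivalent (markedPoint p o) z) →
      AnalyticAt ℂ (ext W) z := fun z hz =>
    ((hreg z hz).mul (analyticAt_modularForm E₄ z)).mul (analyticAt_modularForm E₆ z)
  have hWord : ∀ z : ℍ, 0 ≤ meromorphicOrderAt (ext W) z := by
    intro z
    by_cases hz : ∃ o, Equivalent (markedPoint p o) z
    · obtain ⟨o, ho⟩ := hz
      rw [hWt.meromorphicOrderAt_eq ho, ← tendsto_nhds_iff_meromorphicOrderAt_nonneg (hWm _)]
      obtain ⟨r, hr⟩ := exists_tendsto_sub_mul (hm _) (hlim o)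
      rcases o with _ | _ | j
      · -- the zero of `E₄` cancels the pole
        have hs := hasDerivAt_iff_tendsto_slope.1
          (analyticAt_modularForm E₄ rho).differentiableAt.hasDerivAt
        refine ⟨_, ((hr.mul hs).mul (hc6 rho)).congr' ?_⟩
        filter_upwards [self_mem_nhdsWithin] with w hw
        have hw0 : w - rho ≠ 0 := sub_ne_zero.2 hw
        rw [slope_def_field, ext_coe, E₄_rho, sub_zero]
        change (w - rho) * ext D w * (ext E₄ w / (w - rho)) * ext E₆ w = ext D w * ext E₄ w * ext E₆ w
        field_simp
      · -- the zero of `E₆` cancels the pole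
        have hs := hasDerivAt_iff_tendsto_slope.1
          (analyticAt_modularForm E₆ UpperHalfPlane.I).differentiableAt.hasDerivAt
        refine ⟨_, ((hr.mul (hc4 UpperHalfPlane.I)).mul hs).congr' ?_⟩
        filter_upwards [self_mem_nhdsWithin] with w hw
        have hw0 : w - UpperHalfPlane.I ≠ 0 := sub_ne_zero.2 hw
        rw [slope_def_field, ext_coe, E₆_I, sub_zero]
        change (w - UpperHalfPlane.I) * ext D w * ext E₄ w * (ext E₆ w / (w - UpperHalfPlane.I)) =
          ext D w * ext E₄ w * ext E₆ w
        field_simp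
      · obtain ⟨c, hc⟩ := exists_tendsto_of_sub_mul (hm _) (hres j)
        exact ⟨_, (hc.mul (hc4 (p j))).mul (hc6 (p j))⟩
    · exact (hWreg z (not_exists.1 hz)).meromorphicOrderAt_nonneg
  have hWan : ∀ z : ℍ, AnalyticAt ℂ (ext (normalForm W)) z := fun z => by
    rw [← (meromorphicNFAt_normalForm (hWm z)).meromorphicOrderAt_nonneg_iff_analyticAt,
      meromorphicOrderAt_congr (ext_normalForm_eventuallyEq (hWm z))]
    exact hWord z
  have hW0 : Tendsto (normalForm W) atImInfty (𝓝 0) := by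
    have h1 : Tendsto W atImInfty (𝓝 (0 * 1 * 1)) := (h0.mul tendsto_E₄).mul tendsto_E₆
    rw [zero_mul, zero_mul] at h1
    refine h1.congr' ?_
    filter_upwards [eventually_regular p] with z hz
    exact (normalForm_eq_self (hWreg z hz).meromorphicNFAt).symm
  have hW := (hWt.normalForm hWm).eq_zero_of_weight_fourteen (mdiff_iff_analyticAt.2 hWan) hW0
  filter_upwards [ext_normalForm_eventuallyEq (hWm z), eventually_ne_zero_E₄_E₆ z] with w hw hne
  rw [hW] at hw
  have hw' : ext D w * ext E₄ w * ext E₆ w = 0 := hw.symm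
  rw [mul_eq_zero, mul_eq_zero] at hw'
  exact (hw'.resolve_right hne.2).resolve_right hne.1

/-- Every admissible form is a member of the family. -/
lemma exists_eq_normalForm (h : IsFamily p N A base term) {Q : ℍ → ℂ}
    (hQ : IsAdmissible (markedPoint p) N A Q) :
    ∃ b, (∀ j, HasSmallSolution (ext (member base term b)) (p j) (N (some (some j)))) ∧
      Q = normalForm (member base term b) := by
  have hQt : Transforms 4 Q := hQ.modular.transform
  have hQm : ∀ z : ℍ, MeromorphicAt (ext Q) z := fun z => (hQ.modular.nf z).meromorphicAt
  have hQlim : ∀ o, Tendsto (fun z => (z - markedPoint p o) ^ 2 * ext Q z)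
      (𝓝[≠] (markedPoint p o : ℂ)) (𝓝 (((N o : ℂ) ^ 2 - 1) / 4)) := fun o => by
    obtain ⟨E, hE⟩ := (hQ.small o).exists_isPotential
    exact hE.tendsto
  -- the residues of `Q - base` determine the parameters
  have hres : ∀ j, ∃ r, Tendsto (fun z => (z - p j) * (ext Q z - ext base z)) (𝓝[≠] (p j : ℂ))
      (𝓝 r) := fun j => by
    refine exists_tendsto_sub_mul ((hQm _).sub (h.base_isForm.meromorphic _)) ?_
    have := (hQlim (some (some j))).sub (h.base_lim (some (some j)))
    rw [sub_self] at this
    exact this.congr fun z => by simp only [mark]; ring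
  choose b hb using hres
  have hRf := h.isForm_member b
  have heq : ∀ z : ℍ, ext Q =ᶠ[𝓝[≠] (z : ℂ)] ext (member base term b) := by
    intro z
    have hD := eventuallyEq_zero (p := p) (D := fun z => Q z - member base term b z)
      (hQt.sub hRf.transforms)
      (fun z => (hQm z).sub (hRf.meromorphic z)) (by simpa using hQ.cusp.sub hRf.tendsto)
      (fun o => by
        have := (hQlim o).sub (h.member_lim b o)
        rw [sub_self] at this
        refine this.congr fun z => ?_
        simp only [ext, Function.comp_apply]
        ring)
      (fun j => by
        have := (hb j).sub (tendsto_finsetSum Finset.univ fun i _ =>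
          (h.term_lim_ite i j).const_mul (b i))
        simp only [mul_ite, mul_one, mul_zero, Finset.sum_ite_eq', Finset.mem_univ, if_true,
          sub_self] at this
        refine this.congr fun z => ?_
        change _ = (z - p j) * (ext Q z - ext (member base term b) z)
        rw [ext_member, ← sub_sub, mul_sub _ (ext Q z - ext base z), Finset.mul_sum]
        congr 1
        exact Finset.sum_congr rfl fun i _ => by ring)
      (fun z hz => (hQ.regular z hz).sub (h.member_regular b hz)) z
    filter_upwards [hD] with w hw
    exact sub_eq_zero.1 hw
  refine ⟨b, fun j => (hQ.small (some (some j))).congr (heq (p j)), funext fun z => ?_⟩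
  exact eq_of_meromorphicNFAt (hQ.modular.nf z) (meromorphicNFAt_normalForm (hRf.meromorphic z))
    ((heq z).trans (ext_normalForm_eventuallyEq (hRf.meromorphic z)).symm)

/-- The existence of a small solution at `p k` is a polynomial equation of degree `N k` in the
parameters, with leading part a multiple of the power of the `k`-th parameter: in terms of
`t = z - p k`, the parameter `b k` enters `t² Q` with the factor `t + O(t²)`, and the others with
factors `O(t²)`. -/
lemma exists_polynomial (h : IsFamily p N A base term) (hN : ∀ o, 0 < N o) (k : Fin m) :
    ∃ (P : MvPolynomial (Fin m) ℂ) (α : ℂ), α ≠ 0 ∧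
      (P - MvPolynomial.C α * MvPolynomial.X k ^ N (some (some k))).totalDegree <
        N (some (some k)) ∧
      ∀ b, MvPolynomial.eval b P = 0 ↔
        HasSmallSolution (ext (member base term b)) (p k) (N (some (some k))) := by
  obtain ⟨E, hE⟩ := exists_isPotential_of_tendsto (h.base_isForm.meromorphic _)
    (h.base_lim (some (some k)))
  have hsub : MeromorphicAt (fun z : ℂ => z - p k) (p k) := by fun_prop
  choose g hg hgp hgT using fun j => exists_analyticAt_of_tendsto
    (hsub.mul ((h.term_isForm j).meromorphic (p k))) (h.term_lim_ite j k)
  have hid : AnalyticAt ℂ (fun z : ℂ => z - p k) (p k) := by fun_prop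
  have hF : ∀ j, AnalyticAt ℂ ((fun z : ℂ => z - p k) * g j) (p k) := fun j => hid.mul (hg j)
  have hpot : ∀ b : Fin m → ℂ, IsPotential (ext (member base term b)) (p k) (N (some (some k)))
      (E + fun z => ∑ j, b j * ((fun z : ℂ => z - p k) * g j) z) := by
    intro b
    refine ⟨hE.analyticAt.add (Finset.analyticAt_fun_sum _ fun j _ =>
      analyticAt_const.mul (hF j)), by simp [show E (p k) = 0 from hE.zero], ?_⟩
    filter_upwards [hE.eq, eventually_all.2 hgT] with z hz hzT
    have hz' : (z - p k) ^ 2 * ext base z = _ := hz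
    rw [ext_member, mul_add, hz', add_assoc]
    congr 1
    rw [Pi.add_apply, Finset.mul_sum]
    congr 1
    refine Finset.sum_congr rfl fun j _ => ?_
    have hj : (z - p k) * ext (term j) z = g j z := hzT j
    rw [Pi.mul_apply, ← hj]
    ring
  let G : ℕ → MvPolynomial (Fin m) ℂ := fun i =>
    MvPolynomial.C (PowerSeries.coeff i (taylor E (p k))) +
      ∑ j, MvPolynomial.C (PowerSeries.coeff i (taylor ((fun z : ℂ => z - p k) * g j) (p k))) *
        MvPolynomial.X j
  have hGdeg : ∀ i, (G i).totalDegree ≤ 1 := by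
    intro i
    refine (MvPolynomial.totalDegree_add _ _).trans (max_le (by simp) ?_)
    refine (MvPolynomial.totalDegree_finsetSum _ _).trans (Finset.sup_le fun j _ => ?_)
    refine (MvPolynomial.totalDegree_mul _ _).trans ?_
    simp
  have hG1 : G 1 = MvPolynomial.C (PowerSeries.coeff 1 (taylor E (p k))) +
      MvPolynomial.C 1 * MvPolynomial.X k := by
    simp only [G]
    congr 1
    rw [Finset.sum_eq_single k]
    · rw [taylor_mul hid (hg k), taylor_sub_self, show 1 = 0 + 1 from rfl,
        PowerSeries.coeff_succ_X_mul, coeff_zero_taylor, hgp, if_pos rfl]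
    · intro j _ hjk
      rw [taylor_mul hid (hg j), taylor_sub_self, show 1 = 0 + 1 from rfl,
        PowerSeries.coeff_succ_X_mul, coeff_zero_taylor, hgp, if_neg hjk]
      simp
    · simp
  have hGeval : ∀ b i, MvPolynomial.eval b (G i) = PowerSeries.coeff i
      (taylor (E + fun z => ∑ j, b j * ((fun z : ℂ => z - p k) * g j) z) (p k)) := by
    intro b i
    have hEk : AnalyticAt ℂ E (p k) := hE.analyticAt
    have hbF : ∀ j ∈ Finset.univ, AnalyticAt ℂ
        (fun z => b j * ((fun z : ℂ => z - p k) * g j) z) (p k) :=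
      fun j _ => analyticAt_const.mul (hF j)
    rw [taylor_add hEk (Finset.analyticAt_fun_sum _ hbF), taylor_sum _ _ hbF]
    simp only [G, map_add, map_sum, map_mul, MvPolynomial.eval_C, MvPolynomial.eval_X]
    congr 1
    refine Finset.sum_congr rfl fun j _ => ?_
    rw [taylor_const_mul (hF j), PowerSeries.coeff_C_mul, mul_comm]
  obtain ⟨P, α, hα, hdeg, hP⟩ := exists_obstruction_polynomial hGdeg hG1 one_ne_zero
    (hN (some (some k)))
  refine ⟨P, α, hα, hdeg, fun b => ?_⟩
  have := (hpot b).hasSmallSolution_iff_obstruction (hN _)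
  rw [hP, this]
  simp only [hGeval]

/-- The admissible forms are the image of the zero set of a system of polynomials whose leading
forms are powers of the individual variables. -/
theorem isAdmissible_nonempty_finite_ncard_le (h : IsFamily p N A base term) (hN : ∀ o, 0 < N o)
    (h3 : ¬ 3 ∣ N none) (h2 : ¬ 2 ∣ N (some none)) :
    {Q | IsAdmissible (markedPoint p) N A Q}.Nonempty ∧
      {Q | IsAdmissible (markedPoint p) N A Q}.Finite ∧
      {Q | IsAdmissible (markedPoint p) N A Q}.ncard ≤
        ∏ j, N (some (some j)) := by
  choose P α hα hdeg hP using h.exists_polynomial hN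
  obtain ⟨hne, hfin, hcard⟩ := zeros_nonempty_finite_ncard_le hα hdeg
  have himage : {Q | IsAdmissible (markedPoint p) N A Q} =
      (fun b => normalForm (member base term b)) ''
        {b : Fin m → ℂ | ∀ j, MvPolynomial.eval b (P j) = 0} := by
    ext Q
    constructor
    · intro hQ
      obtain ⟨b, hb, rfl⟩ := h.exists_eq_normalForm hQ
      exact ⟨b, fun j => (hP j b).2 (hb j), rfl⟩
    · rintro ⟨b, hb, rfl⟩
      exact h.isAdmissible_normalForm hN h3 h2 fun j => (hP j b).1 (hb j)
  rw [himage]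
  exact ⟨hne.image _, hfin.image _, (Set.ncard_image_le hfin).trans hcard⟩

end IsFamily

end ModularODE

end

theorem mainTheorem5 (m : ℕ) (κρ κi : ℝ) (κ : Fin m → ℝ) (p : Fin m → ℍ) (κinf : ℝ)
    (hρ : ModularODE.IsPosHalfInt κρ) (hi : ModularODE.IsPosHalfInt κi)
    (hκ : ∀ j, ModularODE.IsPosHalfInt (κ j))
    (hρ' : ¬ ∃ n : ℕ, 2 * κρ / 3 = n) (hi' : ¬ ∃ n : ℕ, κi = n)
    (hp : ∀ j k, j ≠ k → ¬ ModularODE.Equivalent (p j) (p k))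
    (hpρ : ∀ j, ¬ ModularODE.Equivalent ModularODE.rho (p j))
    (hpi : ∀ j, ¬ ModularODE.Equivalent UpperHalfPlane.I (p j))
    (hinf : 0 < κinf) :
    {Q : ℍ → ℂ | ModularODE.IsEquipped κρ κi κ p κinf Q}.Nonempty ∧
    {Q : ℍ → ℂ | ModularODE.IsEquipped κρ κi κ p κinf Q}.Finite ∧
    ({Q : ℍ → ℂ | ModularODE.IsEquipped κρ κi κ p κinf Q}.ncard : ℝ) ≤ ∏ j, 2 * κ j := by
  obtain ⟨nρ, hnρ, rfl⟩ := hρ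
  obtain ⟨ni, hni, rfl⟩ := hi
  choose n hn hκn using hκ
  obtain rfl : κ = fun j => (n j : ℝ) / 2 := funext hκn
  have hP := ModularODE.mark_inequivalent hp hpρ hpi
  have hN : ∀ o, 0 < ModularODE.mark nρ ni n o := by
    rintro (_ | _ | j)
    exacts [hnρ, hni, hn j]
  have h3 : ¬ 3 ∣ nρ := by
    rintro ⟨k, rfl⟩
    exact hρ' ⟨k, by push_cast; ring⟩
  have h2 : ¬ 2 ∣ ni := by
    rintro ⟨k, rfl⟩
    exact hi' ⟨k, by push_cast; ring⟩
  obtain ⟨base, term, h⟩ := ModularODE.exists_isFamily hP (ModularODE.mark nρ ni n)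
    (-(4 * (Real.pi : ℂ) ^ 2 * (κinf : ℂ) ^ 2))
  obtain ⟨hne, hfin, hcard⟩ := h.isAdmissible_nonempty_finite_ncard_le hN h3 h2
  simp only [ModularODE.isEquipped_iff hN hP]
  refine ⟨hne, hfin, (Nat.cast_le.2 hcard).trans_eq ?_⟩
  rw [Nat.cast_prod]
  refine Finset.prod_congr rfl fun j _ => ?_
  change (n j : ℝ) = 2 * ((n j : ℝ) / 2)
  ring
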